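/- **Problems.** All data are rational; dimensions are arbitrary (zero allowed), and $\|u\|_0$ is the number of nonzero entries of $u$. - *Exact dictionary representation* (EDR): an instance is $\langle D,s\rangle$ with $D\in\mathbb{Q}^{m\times n}$ and $s\in\mathrm{col}(D)$. The solutions are the $v\in\mathbb{Q}^n$ with $Dv=s$; minimize $\|v\|_0$. - *Min unsatisfy* (MU): an instance is $\langle A,y\rangle$ with $A\in\mathbb{Q}^{m\times n}$ and $y\in\mathbb{Q}^m$. The solutions are all $x\in\mathbb{Q}^n$; minimize $\|y-Ax\|_0$. **Exact reductions.** Let $F$ and $G$ be minimization problems, where $S_F(x)$ is the set of solutions of the instance $x$, $M_F(x,y)$ is the measure of the solution $y\in S_F(x)$, and $\|F(x)\|=\min_{y\in S_F(x)}M_F(x,y)$. An *exact reduction* from $F$ to $G$ is a pair $\langle t_1,t_2\rangle$ of polynomial-time computable maps such that 1. $t_1$ maps instances of $F$ to instances of $G$, and $t_2(x,y)\in S_F(x)$ for every instance $x$ of $F$ and every $y\in S_G(t_1(x))$; 2. $M_F(x,t_2(x,y))=M_G(t_1(x),y)$ for all such $x,y$; 3. $\|F(x)\|\ge\|G(t_1(x))\|$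 for every instance $x$ of $F$. Write $F\preceq G$ if such a pair exists. The problems are *(approximation-)equivalent*, $F\sim G$, if $F\preceq G$ and $G\preceq F$. Polynomial time means time polynomial in the bit length of the input (rationals are given in lowest terms, dimensions count as if written in unary), measured on a random access machine under the logarithmic cost criterion. A matrix $N$ is a *full null matrix* for a matrix $A$ with $n$ columns if $AN=0$ and $\mathrm{rank}(N)=n-\mathrm{rank}(A)$. **Lemma.** Exact dictionary representation and min unsatisfy are equivalent: $\mathrm{EDR}\sim\mathrm{MU}$. Moreover, the reductions can be chosen of the following form. - There is an exact reduction $\langle t_1,t_2\rangle$ from EDR to MU with $t_1(\langle D,s\rangle)=\langle A,y\rangle$ and $t_2(\langle D,s\rangle,x)=y-Ax$, where $A$ is a full null matrix for $D$ and $y$ satisfies $Dy=s$. - There is an exact reduction $\langle t_1,t_2\rangle$ from MU to EDR with $t_1(\langle A,y\rangle)=\langle D,Dy\rangle$, where $A$ is a full null matrix for $D$, and such that $x=t_2(\langle A,y\rangle,v)$ satisfies $Ax=y-v$. -/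

import Mathlib

open Matrix

/-! ## Polynomial time: a random access machine with structured control and logarithmic cost

A program works on finitely many integer variables, finitely many integer arrays with random
access, and a write-only output tape.  Every operation is charged the bit lengths of all integers
it touches (addresses, operands and results): the logarithmic cost criterion, under which
polynomial time on such machines is polynomial time on Turing machines. -/

namespace RAM

/-- Bit length of an integer, with one unit for the sign. -/
def bitLen (z : ℤ) : ℕ := Nat.size z.natAbs + 1

/-- Total bit length of a word of integers. -/
def wordSize (w : List ℤ) : ℕ := (w.map bitLen).sum

/-- A machine configuration: variables, arrays (array `a` at address `i` is `arr a i`), and what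
has been written to the output tape so far. -/
structure State where
  var : ℕ → ℤ
  arr : ℕ → ℤ → ℤ
  out : List ℤ

/-- Arithmetic expressions; `div` is integer division and `get a e` reads array `a` at
address `e`. -/
inductive Expr where
  | const (c : ℤ)
  | var (x : ℕ)
  | get (a : ℕ) (e : Expr)
  | add (e₁ e₂ : Expr)
  | sub (e₁ e₂ : Expr)
  | mul (e₁ e₂ : Expr)
  | div (e₁ e₂ : Expr)

/-- The value of an expression. -/
def Expr.eval (σ : State) : Expr → ℤ
  | .const c => c
  | .var x => σ.var x
  | .get a e => σ.arr a (e.eval σ)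
  | .add e₁ e₂ => e₁.eval σ + e₂.eval σ
  | .sub e₁ e₂ => e₁.eval σ - e₂.eval σ
  | .mul e₁ e₂ => e₁.eval σ * e₂.eval σ
  | .div e₁ e₂ => e₁.eval σ / e₂.eval σ

/-- The logarithmic cost of evaluating an expression: the sum of the bit lengths of the values of
all its subexpressions. -/
def Expr.cost (σ : State) : Expr → ℕ
  | .const c => bitLen c
  | .var x => bitLen (σ.var x)
  | .get a e => e.cost σ + bitLen (σ.arr a (e.eval σ))
  | .add e₁ e₂ => e₁.cost σ + e₂.cost σ + bitLen (e₁.eval σ + e₂.eval σ)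
  | .sub e₁ e₂ => e₁.cost σ + e₂.cost σ + bitLen (e₁.eval σ - e₂.eval σ)
  | .mul e₁ e₂ => e₁.cost σ + e₂.cost σ + bitLen (e₁.eval σ * e₂.eval σ)
  | .div e₁ e₂ => e₁.cost σ + e₂.cost σ + bitLen (e₁.eval σ / e₂.eval σ)

/-- Programs. `store a i e` puts `e` into array `a` at address `i`; `write e` appends `e` to the
output; `ifPos e p q` and `whilePos e p` test whether `0 < e`. -/
inductive Prog where
  | skip
  | assign (x : ℕ) (e : Expr)
  | store (a : ℕ) (i e : Expr)
  | write (e : Expr)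
  | seq (p q : Prog)
  | ifPos (e : Expr) (p q : Prog)
  | whilePos (e : Expr) (p : Prog)

def State.setVar (σ : State) (x : ℕ) (v : ℤ) : State :=
  { σ with var := Function.update σ.var x v }

def State.setArr (σ : State) (a : ℕ) (i v : ℤ) : State :=
  { σ with arr := Function.update σ.arr a (Function.update (σ.arr a) i v) }

def State.write (σ : State) (v : ℤ) : State :=
  { σ with out := σ.out ++ [v] }

/-- `Runs p σ σ' t`: started in `σ`, the program `p` halts in `σ'` after time `t`. -/
inductive Runs : Prog → State → State → ℕ → Prop where
  | skip (σ : State) : Runs .skip σ σ 1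
  | assign (x : ℕ) (e : Expr) (σ : State) :
      Runs (.assign x e) σ (σ.setVar x (e.eval σ)) (1 + e.cost σ)
  | store (a : ℕ) (i e : Expr) (σ : State) :
      Runs (.store a i e) σ (σ.setArr a (i.eval σ) (e.eval σ)) (1 + i.cost σ + e.cost σ)
  | write (e : Expr) (σ : State) :
      Runs (.write e) σ (σ.write (e.eval σ)) (1 + e.cost σ)
  | seq {p q : Prog} {σ σ' σ'' : State} {t t' : ℕ} :
      Runs p σ σ' t → Runs q σ' σ'' t' → Runs (.seq p q) σ σ'' (t + t')
  | ifTrue {e : Expr} {p q : Prog} {σ σ' : State} {t : ℕ} :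
      0 < e.eval σ → Runs p σ σ' t → Runs (.ifPos e p q) σ σ' (1 + e.cost σ + t)
  | ifFalse {e : Expr} {p q : Prog} {σ σ' : State} {t : ℕ} :
      ¬ 0 < e.eval σ → Runs q σ σ' t → Runs (.ifPos e p q) σ σ' (1 + e.cost σ + t)
  | whileTrue {e : Expr} {p : Prog} {σ σ' σ'' : State} {t t' : ℕ} :
      0 < e.eval σ → Runs p σ σ' t → Runs (.whilePos e p) σ' σ'' t' →
        Runs (.whilePos e p) σ σ'' (1 + e.cost σ + t + t')
  | whileFalse {e : Expr} {p : Prog} {σ : State} :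
      ¬ 0 < e.eval σ → Runs (.whilePos e p) σ σ (1 + e.cost σ)

/-- The initial configuration on input `w`: the length of `w` is in variable `0`, the letters of
`w` are in array `0` from address `0` on, everything else is `0` and the output is empty. -/
def init (w : List ℤ) : State where
  var x := if x = 0 then (w.length : ℤ) else 0
  arr a i := if a = 0 ∧ 0 ≤ i then w.getD i.toNat 0 else 0
  out := []

/-- One program turns the input word `input a` into the output word `output a`, for every `a`, in
time polynomial in the bit length of the input word. -/
def PolyTime {α : Type} (input output : α → List ℤ) : Prop :=
  ∃ (p : Prog) (q : Polynomial ℕ), ∀ a : α, ∃ (σ : State) (t : ℕ),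
    Runs p (init (input a)) σ t ∧ σ.out = output a ∧ t ≤ q.eval (wordSize (input a))

/-- The encoding of a pair of words. -/
def encPair (u v : List ℤ) : List ℤ := (u.length : ℤ) :: (u ++ v)

/-- A list of rationals, each in lowest terms as numerator and positive denominator. -/
def encRats (l : List ℚ) : List ℤ := l.flatMap fun q => [q.num, (q.den : ℤ)]

/-- A vector: its length, then its entries. -/
def encVec {n : ℕ} (v : Fin n → ℚ) : List ℤ := (n : ℤ) :: encRats (List.ofFn v)

/-- A matrix: its dimensions, then `m + n` padding zeros, then its entries row by row.  The padding
makes the code at least as long as with dimensions in unary, which matters only for matrices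
without rows or without columns. -/
def encMat {m n : ℕ} (A : Matrix (Fin m) (Fin n) ℚ) : List ℤ :=
  (m : ℤ) :: (n : ℤ) :: (List.replicate (m + n) 0 ++
    encRats (List.ofFn fun i => List.ofFn fun j => A i j).flatten)

theorem length_encRats (l : List ℚ) : (encRats l).length = 2 * l.length := by
  induction l with
  | nil => rfl
  | cons q l ih =>
    simp only [encRats, List.flatMap_cons, List.length_append, List.length_cons,
      List.length_nil] at ih ⊢
    omega

theorem encRats_injective : Function.Injective encRats := by
  intro l
  induction l with
  | nil =>
    intro l' h
    cases l' with
    | nil => rfl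
    | cons q l' => simp [encRats] at h
  | cons q l ih =>
    intro l' h
    cases l' with
    | nil => simp [encRats] at h
    | cons q' l' =>
      simp only [encRats, List.flatMap_cons, List.cons_append, List.nil_append,
        List.cons.injEq] at h
      obtain ⟨h₁, h₂, h₃⟩ := h
      rw [ih h₃, Rat.ext h₁ (by exact_mod_cast h₂)]

theorem encVec_injective {n : ℕ} : Function.Injective (encVec (n := n)) := by
  intro v w h
  simp only [encVec, List.cons.injEq, true_and] at h
  exact List.ofFn_injective (encRats_injective h)

theorem length_encMat {m n : ℕ} (A : Matrix (Fin m) (Fin n) ℚ) :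
    (encMat A).length = 2 + (m + n) + 2 * (m * n) := by
  have : (List.ofFn fun i => List.ofFn fun j => A i j).flatten.length = m * n := by
    simp [List.length_flatten, List.map_ofFn, Function.comp_def]
  simp only [encMat, List.length_cons, List.length_append, List.length_replicate,
    length_encRats, this]
  omega

theorem encMat_injective {m n : ℕ} : Function.Injective (encMat (m := m) (n := n)) := by
  intro A B h
  simp only [encMat, List.cons.injEq, true_and, List.append_cancel_left_eq] at h
  have h' := encRats_injective h
  have h'' : (List.ofFn fun i => List.ofFn fun j => A i j)
      = List.ofFn fun i => List.ofFn fun j => B i j := by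
    rw [List.eq_iff_flatten_eq]
    exact ⟨h', by simp [List.map_ofFn, Function.comp_def]⟩
  ext i j
  exact congrFun (List.ofFn_injective (congrFun (List.ofFn_injective h'') i)) j

/-- The code of a matrix followed by a vector with as many entries as the matrix has rows. -/
def encSystem {m n : ℕ} (A : Matrix (Fin m) (Fin n) ℚ) (b : Fin m → ℚ) : List ℤ :=
  encMat A ++ encRats (List.ofFn b)

theorem encSystem_dims {m n m' n' : ℕ} {A : Matrix (Fin m) (Fin n) ℚ} {b : Fin m → ℚ}
    {A' : Matrix (Fin m') (Fin n') ℚ} {b' : Fin m' → ℚ}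
    (h : encSystem A b = encSystem A' b') : m = m' ∧ n = n' := by
  simp only [encSystem, encMat, List.cons_append, List.cons.injEq, Nat.cast_inj] at h
  exact ⟨h.1, h.2.1⟩

theorem encSystem_inj {m n : ℕ} {A A' : Matrix (Fin m) (Fin n) ℚ} {b b' : Fin m → ℚ}
    (h : encSystem A b = encSystem A' b') : A = A' ∧ b = b' := by
  have h' := List.append_inj h (by rw [length_encMat, length_encMat])
  exact ⟨encMat_injective h'.1, List.ofFn_injective (encRats_injective h'.2)⟩

end RAM

/-! ## Minimization problems and exact reductions -/

/-- A minimization problem with integer measure, together with encodings of its instances and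
solutions as words of integers. -/
structure MinProblem where
  /-- the input instances -/
  Inst : Type
  /-- the solution space of an instance -/
  Sol : Inst → Type
  sol_nonempty : ∀ x, Nonempty (Sol x)
  /-- the objective metric -/
  metric : ∀ x, Sol x → ℕ
  encInst : Inst → List ℤ
  encInst_injective : Function.Injective encInst
  encSol : ∀ x, Sol x → List ℤ
  encSol_injective : ∀ x, Function.Injective (encSol x)

namespace MinProblem

/-- The optimal value of an instance; it is attained, as the set is a nonempty set of natural
numbers. -/
noncomputable def opt (F : MinProblem) (x : F.Inst) : ℕ := sInf (Set.range (F.metric x))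

/-- `⟨t₁, t₂⟩` is an exact reduction from `F` to `G`.  That `t₂ x y` is a solution of `x` for every
solution `y` of `t₁ x` is expressed by its type. -/
structure IsExactReduction (F G : MinProblem) (t₁ : F.Inst → G.Inst)
    (t₂ : ∀ x : F.Inst, G.Sol (t₁ x) → F.Sol x) : Prop where
  polyTime_fst : RAM.PolyTime F.encInst fun x => G.encInst (t₁ x)
  polyTime_snd : RAM.PolyTime
    (fun p : (x : F.Inst) × G.Sol (t₁ x) => RAM.encPair (F.encInst p.1) (G.encSol (t₁ p.1) p.2))
    (fun p => F.encSol p.1 (t₂ p.1 p.2))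
  metric_eq : ∀ (x : F.Inst) (y : G.Sol (t₁ x)), F.metric x (t₂ x y) = G.metric (t₁ x) y
  opt_le : ∀ x : F.Inst, G.opt (t₁ x) ≤ F.opt x

/-- `F ⪯ G`: there is an exact reduction from `F` to `G`. -/
def Reduces (F G : MinProblem) : Prop :=
  ∃ (t₁ : F.Inst → G.Inst) (t₂ : ∀ x : F.Inst, G.Sol (t₁ x) → F.Sol x), IsExactReduction F G t₁ t₂

/-- `F ∼ G`: each problem has an exact reduction to the other. -/
def Equivalent (F G : MinProblem) : Prop := Reduces F G ∧ Reduces G F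

end MinProblem

/-! ## The two vector problems -/

/-- An instance `⟨D, s⟩` of exact dictionary representation: `s` is in the column span of `D`. -/
structure EDRInst where
  m : ℕ
  n : ℕ
  D : Matrix (Fin m) (Fin n) ℚ
  s : Fin m → ℚ
  mem : s ∈ Submodule.span ℚ (Set.range D.col)

/-- An instance `⟨A, y⟩` of min unsatisfy. -/
structure MUInst where
  m : ℕ
  n : ℕ
  A : Matrix (Fin m) (Fin n) ℚ
  y : Fin m → ℚ

/-- The instance `⟨D, D y⟩` of exact dictionary representation. -/
def EDRInst.ofVec {m n : ℕ} (D : Matrix (Fin m) (Fin n) ℚ) (y : Fin n → ℚ) : EDRInst where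
  m := m
  n := n
  D := D
  s := D *ᵥ y
  mem := by
    rw [← Matrix.range_mulVecLin]
    exact ⟨y, rfl⟩

/-- Exact dictionary representation: given `⟨D, s⟩`, minimize `‖v‖₀` over all rational `v` with
`D v = s`. -/
def EDR : MinProblem where
  Inst := EDRInst
  Sol I := {v : Fin I.n → ℚ // I.D *ᵥ v = I.s}
  sol_nonempty I := by
    have h := I.mem
    rw [← Matrix.range_mulVecLin] at h
    obtain ⟨v, hv⟩ := h
    exact ⟨⟨v, hv⟩⟩
  metric _ v := hammingNorm v.1
  encInst I := RAM.encSystem I.D I.s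
  encInst_injective := by
    rintro ⟨m, n, D, s, hs⟩ ⟨m', n', D', s', hs'⟩ h
    obtain ⟨rfl, rfl⟩ := RAM.encSystem_dims h
    obtain ⟨rfl, rfl⟩ := RAM.encSystem_inj h
    rfl
  encSol _ v := RAM.encVec v.1
  encSol_injective _ := RAM.encVec_injective.comp Subtype.val_injective

/-- Min unsatisfy: given `⟨A, y⟩`, minimize `‖y - A x‖₀` over all rational `x`. -/
def MU : MinProblem where
  Inst := MUInst
  Sol I := Fin I.n → ℚ
  sol_nonempty _ := ⟨0⟩
  metric I x := hammingNorm (I.y - I.A *ᵥ x)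
  encInst I := RAM.encSystem I.A I.y
  encInst_injective := by
    rintro ⟨m, n, A, y⟩ ⟨m', n', A', y'⟩ h
    obtain ⟨rfl, rfl⟩ := RAM.encSystem_dims h
    obtain ⟨rfl, rfl⟩ := RAM.encSystem_inj h
    rfl
  encSol _ x := RAM.encVec x
  encSol_injective _ := RAM.encVec_injective

/-- `N` is a full null matrix for `A`: the columns of `N` are in the null space of `A`, and the rank
of `N` is the corank `n - rank A` of `A`. -/
def IsFullNullMatrix {m n k : ℕ} (A : Matrix (Fin m) (Fin n) ℚ) (N : Matrix (Fin n) (Fin k) ℚ) :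
    Prop :=
  A * N = 0 ∧ A.rank + N.rank = n

/-! Let `P` be the orthogonal projection onto the null space of `D`; it is a rational matrix. If `D
y = s`, the solutions of `D v = s` are exactly the vectors `y - P x`, so `⟨P, y⟩` is an instance of
min unsatisfy with the same values. Conversely, let `P` be the projection onto the null space of
`Aᵀ`. Its own null space is the column space of `A`, so `P v = P y` means that `y - v = A x` for
some `x`, and every such `x` has measure `‖v‖₀`. See `isExactReduction_EDR_MU` and
`isExactReduction_MU_EDR`.

What remains is to compute projections and particular solutions in polynomial time. The projection
is uniquely determined by the null space and its entries are at most one in absolute value. `elim`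
obtains it by intersecting with one hyperplane after another, storing it as an integer matrix `Q`
over a denominator `d`. For a row `a` with `e = a · Q a > 0` the step is `Q ← (e Q - (Q a)(Q a)ᵀ) /
d`, `d ← e`; if `e = 0`, the row is orthogonal to the current space and nothing changes. The
denominator is always the Gram determinant of the rows used so far (`det_gram_fromRows`), and a Gram
determinant clears the denominators of the projection (`IsOrthProj.exists_int`). So the division is
exact and bit lengths stay polynomial (`natAbs_elim_snd_le`).

A particular solution comes from the projection for the augmented matrix `(D | s)`: its last column
is a null vector, with positive last entry if the system is solvable (`nullProj_augment_last_pos`).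
Eliminating the last unit vector afterwards leaves the projection for `D` itself (`elim_unit_fst`),
so one elimination serves both purposes.

On the machine, a program whose registers stay below `M` and whose loops take at most `K` passes
runs in time polynomial in `K` times the bit length of `M` (`polyTime_of_exec`). The input is scaled
to integers by a common multiple of its denominators, and results are reduced to lowest terms by
Euclid's algorithm. -/

namespace RAM

/-! ## Running times from bounds on the registers -/

/-- All variables and array cells are at most `M` in absolute value. -/
def State.Bdd (M : ℕ) (σ : State) : Prop :=
  (∀ x, (σ.var x).natAbs ≤ M) ∧ ∀ a i, (σ.arr a i).natAbs ≤ M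

/-- The values of `e` are at most `M ^ e.deg` when the registers are at most `M`. -/
def Expr.deg : Expr → ℕ
  | .const c => c.natAbs + 1
  | .var _ => 1
  | .get _ _ => 1
  | .add e₁ e₂ => e₁.deg + e₂.deg
  | .sub e₁ e₂ => e₁.deg + e₂.deg
  | .mul e₁ e₂ => e₁.deg + e₂.deg
  | .div e₁ e₂ => e₁.deg + e₂.deg

/-- The evaluation cost in units of the bit length of the registers. -/
def Expr.wt : Expr → ℕ
  | .const c => c.natAbs + 1
  | .var _ => 1
  | .get _ e => e.wt + 1
  | .add e₁ e₂ => e₁.wt + e₂.wt + (e₁.deg + e₂.deg)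
  | .sub e₁ e₂ => e₁.wt + e₂.wt + (e₁.deg + e₂.deg)
  | .mul e₁ e₂ => e₁.wt + e₂.wt + (e₁.deg + e₂.deg)
  | .div e₁ e₂ => e₁.wt + e₂.wt + (e₁.deg + e₂.deg)

theorem Expr.deg_pos (e : Expr) : 1 ≤ e.deg := by
  induction e <;> simp only [Expr.deg] <;> omega

/-- Numbers that are at least 2 have a sum bounded by their product. -/
theorem add_pow_le {M a b : ℕ} (hM : 2 ≤ M) (ha : 1 ≤ a) (hb : 1 ≤ b) :
    M ^ a + M ^ b ≤ M ^ (a + b) := by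
  have h1 : 2 ≤ M ^ a := hM.trans (Nat.le_self_pow (by omega) M)
  have h2 : 2 ≤ M ^ b := hM.trans (Nat.le_self_pow (by omega) M)
  rw [pow_add]
  nlinarith

/-- Intermediate values are not stored, so they may exceed `M`. Each operation at most multiplies
the bounds of its operands, and constants are absorbed into powers of `M ≥ 2`. -/
theorem Expr.natAbs_eval_le {M : ℕ} (hM : 2 ≤ M) {σ : State} (h : σ.Bdd M) (e : Expr) :
    (e.eval σ).natAbs ≤ M ^ e.deg := by
  induction e with
  | const c =>
    simp only [Expr.eval, Expr.deg]
    calc c.natAbs ≤ 2 ^ c.natAbs := Nat.lt_two_pow_self.le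
      _ ≤ 2 ^ (c.natAbs + 1) := Nat.pow_le_pow_right (by norm_num) (by omega)
      _ ≤ _ := Nat.pow_le_pow_left hM _
  | var x => simpa [Expr.eval, Expr.deg] using h.1 x
  | get a e _ => simpa [Expr.eval, Expr.deg] using h.2 a _
  | add e₁ e₂ h₁ h₂ =>
    exact (Int.natAbs_add_le _ _).trans
      ((add_le_add h₁ h₂).trans (add_pow_le hM e₁.deg_pos e₂.deg_pos))
  | sub e₁ e₂ h₁ h₂ =>
    exact (Int.natAbs_sub_le _ _).trans
      ((add_le_add h₁ h₂).trans (add_pow_le hM e₁.deg_pos e₂.deg_pos))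
  | mul e₁ e₂ h₁ h₂ =>
    simp only [Expr.eval, Expr.deg, Int.natAbs_mul, pow_add]
    exact Nat.mul_le_mul h₁ h₂
  | div e₁ e₂ h₁ _ =>
    simp only [Expr.eval, Expr.deg]
    exact (Int.natAbs_ediv_le_natAbs _ _).trans
      (h₁.trans (Nat.pow_le_pow_right (by omega) (by omega)))

theorem bitLen_le {M d : ℕ} (hd : 1 ≤ d) {z : ℤ} (h : z.natAbs ≤ M ^ d) :
    bitLen z ≤ d * (Nat.size M + 1) := by
  have h1 : Nat.size z.natAbs ≤ d * Nat.size M := by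
    rw [Nat.size_le]
    calc z.natAbs ≤ M ^ d := h
      _ < (2 ^ Nat.size M) ^ d := Nat.pow_lt_pow_left (Nat.lt_size_self M) (by omega)
      _ = 2 ^ (d * Nat.size M) := by rw [← pow_mul, mul_comm]
  rw [bitLen, mul_add, mul_one]
  omega

theorem Expr.cost_le {M : ℕ} (hM : 2 ≤ M) {σ : State} (h : σ.Bdd M) (e : Expr) :
    e.cost σ ≤ e.wt * (Nat.size M + 1) := by
  have key := fun e : Expr => bitLen_le e.deg_pos (Expr.natAbs_eval_le hM h e)
  induction e with
  | const c => exact key (.const c)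
  | var x => exact key (.var x)
  | get a e ih =>
    have := key (.get a e)
    simp only [Expr.cost, Expr.wt, Expr.deg, Expr.eval] at *
    rw [add_mul]
    omega
  | add e₁ e₂ h₁ h₂ =>
    have := key (.add e₁ e₂)
    simp only [Expr.cost, Expr.wt, Expr.deg, Expr.eval] at *
    rw [add_mul, add_mul]
    omega
  | sub e₁ e₂ h₁ h₂ =>
    have := key (.sub e₁ e₂)
    simp only [Expr.cost, Expr.wt, Expr.deg, Expr.eval] at *
    rw [add_mul, add_mul]
    omega
  | mul e₁ e₂ h₁ h₂ =>
    have := key (.mul e₁ e₂)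
    simp only [Expr.cost, Expr.wt, Expr.deg, Expr.eval] at *
    rw [add_mul, add_mul]
    omega
  | div e₁ e₂ h₁ h₂ =>
    have := key (.div e₁ e₂)
    simp only [Expr.cost, Expr.wt, Expr.deg, Expr.eval] at *
    rw [add_mul, add_mul]
    omega

/-- A bound for the running time of a program all of whose loops are passed at most `K` times, in
units of the bit length of the registers. -/
def Prog.wt (K : ℕ) : Prog → ℕ
  | .skip => 1
  | .assign _ e => 1 + e.wt
  | .store _ i e => 1 + i.wt + e.wt
  | .write e => 1 + e.wt
  | .seq p q => p.wt K + q.wt K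
  | .ifPos e p q => 1 + e.wt + (p.wt K + q.wt K)
  | .whilePos e p => (K + 1) * (1 + e.wt + p.wt K)

/-- The weight depends on `K` only through one factor `K + 1` per loop, so its degree is bounded by
the nesting depth of the loops. -/
theorem Prog.exists_wt_eq (p : Prog) : ∃ q : Polynomial ℕ, ∀ K, p.wt K = q.eval K := by
  induction p with
  | skip => exact ⟨1, fun K => by simp [Prog.wt]⟩
  | assign x e => exact ⟨Polynomial.C (1 + e.wt), fun K => by simp [Prog.wt]⟩
  | store a i e => exact ⟨Polynomial.C (1 + i.wt + e.wt), fun K => by simp [Prog.wt]⟩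
  | write e => exact ⟨Polynomial.C (1 + e.wt), fun K => by simp [Prog.wt]⟩
  | seq p q hp hq =>
    obtain ⟨f, hf⟩ := hp
    obtain ⟨g, hg⟩ := hq
    exact ⟨f + g, fun K => by simp [Prog.wt, hf, hg]⟩
  | ifPos e p q hp hq =>
    obtain ⟨f, hf⟩ := hp
    obtain ⟨g, hg⟩ := hq
    exact ⟨Polynomial.C (1 + e.wt) + (f + g), fun K => by simp [Prog.wt, hf, hg]⟩
  | whilePos e p hp =>
    obtain ⟨f, hf⟩ := hp
    exact ⟨(Polynomial.X + 1) * (Polynomial.C (1 + e.wt) + f), fun K => by simp [Prog.wt, hf]⟩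

/-- Started in `σ` with registers bounded by `M`, the program `p` halts in `σ'`, with registers
bounded by `M`, after passing every loop at most `K` times per entry. -/
def Exec (M K : ℕ) (p : Prog) (σ σ' : State) : Prop :=
  σ.Bdd M → σ'.Bdd M ∧ ∃ t, Runs p σ σ' t ∧ t ≤ p.wt K * (Nat.size M + 1)

/-- The bound `M` for the registers and the bound `K` for the number of passes fit together. -/
structure Limits (M K : ℕ) : Prop where
  two_le : 2 ≤ M
  le : K ≤ M
  size_le : 2 * Nat.size M ≤ K

variable {M K : ℕ}

theorem Exec.seq {p q : Prog} {σ σ' σ'' : State} (hp : Exec M K p σ σ') (hq : Exec M K q σ' σ'') :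
    Exec M K (.seq p q) σ σ'' := by
  intro h
  obtain ⟨h', t, ht, htb⟩ := hp h
  obtain ⟨h'', t', ht', htb'⟩ := hq h'
  exact ⟨h'', t + t', .seq ht ht', by rw [Prog.wt, add_mul]; omega⟩

theorem Exec.skip (σ : State) : Exec M K .skip σ σ :=
  fun h => ⟨h, 1, .skip σ, by simp [Prog.wt]⟩

theorem State.Bdd.setVar {σ : State} (h : σ.Bdd M) (x : ℕ) {v : ℤ} (hv : v.natAbs ≤ M) :
    (σ.setVar x v).Bdd M := by
  refine ⟨fun y => ?_, h.2⟩
  by_cases hy : y = x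
  · subst hy; simpa [State.setVar] using hv
  · simpa [State.setVar, Function.update_of_ne hy] using h.1 y

theorem State.Bdd.setArr {σ : State} (h : σ.Bdd M) (a : ℕ) (i : ℤ) {v : ℤ} (hv : v.natAbs ≤ M) :
    (σ.setArr a i v).Bdd M := by
  refine ⟨h.1, fun b j => ?_⟩
  by_cases hb : b = a
  · subst hb
    by_cases hj : j = i
    · subst hj; simpa [State.setArr] using hv
    · simpa [State.setArr, Function.update_of_ne hj] using h.2 b j
  · simpa [State.setArr, Function.update_of_ne hb] using h.2 b j

theorem Exec.assign (hM : 2 ≤ M) {x : ℕ} {e : Expr} {σ : State} (hv : (e.eval σ).natAbs ≤ M) :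
    Exec M K (.assign x e) σ (σ.setVar x (e.eval σ)) := by
  intro h
  refine ⟨h.setVar x hv, _, .assign x e σ, ?_⟩
  have := e.cost_le hM h
  rw [Prog.wt, add_mul]
  omega

theorem Exec.store (hM : 2 ≤ M) {a : ℕ} {i e : Expr} {σ : State} (hv : (e.eval σ).natAbs ≤ M) :
    Exec M K (.store a i e) σ (σ.setArr a (i.eval σ) (e.eval σ)) := by
  intro h
  refine ⟨h.setArr a _ hv, _, .store a i e σ, ?_⟩
  have := e.cost_le hM h
  have := i.cost_le hM h
  rw [Prog.wt, add_mul, add_mul]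
  omega

theorem Exec.write (hM : 2 ≤ M) {e : Expr} {σ : State} :
    Exec M K (.write e) σ (σ.write (e.eval σ)) := by
  intro h
  refine ⟨h, _, .write e σ, ?_⟩
  have := e.cost_le hM h
  rw [Prog.wt, add_mul]
  omega

theorem Exec.ifTrue (hM : 2 ≤ M) {e : Expr} {p q : Prog} {σ σ' : State} (he : 0 < e.eval σ)
    (hp : Exec M K p σ σ') : Exec M K (.ifPos e p q) σ σ' := by
  intro h
  obtain ⟨h', t, ht, htb⟩ := hp h
  refine ⟨h', _, .ifTrue he ht, ?_⟩
  have := e.cost_le hM h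
  rw [Prog.wt, add_mul, add_mul, add_mul]
  omega

theorem Exec.ifFalse (hM : 2 ≤ M) {e : Expr} {p q : Prog} {σ σ' : State} (he : ¬ 0 < e.eval σ)
    (hq : Exec M K q σ σ') : Exec M K (.ifPos e p q) σ σ' := by
  intro h
  obtain ⟨h', t, ht, htb⟩ := hq h
  refine ⟨h', _, .ifFalse he ht, ?_⟩
  have := e.cost_le hM h
  rw [Prog.wt, add_mul, add_mul, add_mul]
  omega

/-- `F k` is the state after `k` passes. -/
theorem Exec.whilePos (hM : 2 ≤ M) {e : Expr} {p : Prog} (F : ℕ → State) {n : ℕ} (hn : n ≤ K)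
    (ht : ∀ k < n, 0 < e.eval (F k)) (hp : ∀ k < n, Exec M K p (F k) (F (k + 1)))
    (hf : ¬ 0 < e.eval (F n)) : Exec M K (.whilePos e p) (F 0) (F n) := by
  -- Induction on the number `j` of passes still to come; the last, failing test accounts for the `+
  -- 1`.
  have key : ∀ j k, j + k = n → (F k).Bdd M → (F n).Bdd M ∧
      ∃ t, Runs (.whilePos e p) (F k) (F n) t ∧
        t ≤ (j + 1) * (1 + e.wt + p.wt K) * (Nat.size M + 1) := by
    intro j
    induction j with
    | zero =>
      intro k hk h
      obtain rfl : k = n := by omega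
      refine ⟨h, _, .whileFalse hf, ?_⟩
      have := e.cost_le hM h
      rw [zero_add, one_mul, add_mul, add_mul]
      omega
    | succ j ih =>
      intro k hk h
      obtain ⟨h', t, hr, htb⟩ := hp k (by omega) h
      obtain ⟨h'', t', hr', htb'⟩ := ih (k + 1) (by omega) h'
      refine ⟨h'', _, .whileTrue (ht k (by omega)) hr hr', ?_⟩
      have := e.cost_le hM h
      have : (j + 1 + 1) * (1 + e.wt + p.wt K) * (Nat.size M + 1)
        = (j + 1) * (1 + e.wt + p.wt K) * (Nat.size M + 1) +
          ((Nat.size M + 1) + e.wt * (Nat.size M + 1) + p.wt K * (Nat.size M + 1)) := by ring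
      omega
  intro h
  obtain ⟨h', t, hr, hb⟩ := key n 0 (by omega) h
  refine ⟨h', t, hr, hb.trans ?_⟩
  rw [Prog.wt]
  gcongr

/-- `for x < N do p`; the counter `x` is `0` before and afterwards. -/
def Prog.loop (x : ℕ) (N : Expr) (p : Prog) : Prog :=
  .seq (.whilePos (.sub N (.var x)) (.seq p (.assign x (.add (.var x) (.const 1)))))
    (.assign x (.const 0))

theorem State.setVar_setVar (σ : State) (x : ℕ) (v w : ℤ) :
    (σ.setVar x v).setVar x w = σ.setVar x w := by
  simp [State.setVar]

theorem State.setVar_self {σ : State} {x : ℕ} {v : ℤ} (h : σ.var x = v) : σ.setVar x v = σ := by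
  subst h
  simp [State.setVar]

/-- `F k` is the state before pass `k` with its counter reset to zero, so that a completed loop
leaves no trace of its counter and loops can be nested. `K ≤ M` keeps the counter within the
register bound. -/
theorem Exec.loop (hM : Limits M K) {x : ℕ} {N : Expr} {p : Prog} (F : ℕ → State) {n : ℕ}
    (hn : n ≤ K) (h0 : ∀ k, (F k).var x = 0)
    (hN : ∀ k ≤ n, N.eval ((F k).setVar x k) = n)
    (hp : ∀ k < n, Exec M K p ((F k).setVar x k) ((F (k + 1)).setVar x k)) :
    Exec M K (.loop x N p) (F 0) (F n) := by
  have hKM := hM.le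
  have hx : ∀ k (v : ℤ), ((F k).setVar x v).var x = v := fun k v => by simp [State.setVar]
  have hw := Exec.whilePos (K := K) (e := .sub N (.var x))
    (p := .seq p (.assign x (.add (.var x) (.const 1)))) hM.two_le
    (fun k => (F k).setVar x (k : ℤ)) hn
    (fun k hk => by simp only [Expr.eval, hN k hk.le, hx]; omega)
    (fun k hk => by
      refine (hp k hk).seq ?_
      have := Exec.assign (K := K) (x := x) (e := .add (.var x) (.const 1))
        (σ := (F (k + 1)).setVar x k) hM.two_le (by simp only [Expr.eval, hx]; omega)
      simpa only [Expr.eval, hx, State.setVar_setVar, Nat.cast_add, Nat.cast_one] using this)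
    (by simp only [Expr.eval, hN n le_rfl, hx]; omega)
  simp only [Nat.cast_zero] at hw
  rw [State.setVar_self (h0 0)] at hw
  refine hw.seq ?_
  have := Exec.assign (K := K) (x := x) (e := .const 0)
    (σ := (F n).setVar x n) hM.two_le (by simp [Expr.eval])
  simpa only [Expr.eval, State.setVar_setVar, State.setVar_self (h0 n)] using this

theorem polyTime_of_exec {α : Type} {input output : α → List ℤ} (p : Prog) (X : Polynomial ℕ)
    (h : ∀ a, ∃ M K : ℕ, Nat.size M + 1 ≤ X.eval (wordSize (input a)) ∧
      K ≤ X.eval (wordSize (input a)) ∧ (init (input a)).Bdd M ∧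
      ∃ σ, Exec M K p (init (input a)) σ ∧ σ.out = output a) :
    PolyTime input output := by
  obtain ⟨f, hf⟩ := p.exists_wt_eq
  refine ⟨p, f.comp X * X, fun a => ?_⟩
  obtain ⟨M, K, hM, hK, h0, σ, hσ, hout⟩ := h a
  obtain ⟨-, t, ht, htb⟩ := hσ h0
  refine ⟨σ, t, ht, hout, htb.trans ?_⟩
  rw [Polynomial.eval_mul, Polynomial.eval_comp, hf]
  refine Nat.mul_le_mul ?_ hM
  have mono : ∀ q : Polynomial ℕ, ∀ a b : ℕ, a ≤ b → q.eval a ≤ q.eval b := by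
    intro q a b hab
    rw [Polynomial.eval_eq_sum, Polynomial.eval_eq_sum]
    exact Finset.sum_le_sum fun i _ => Nat.mul_le_mul_left _ (Nat.pow_le_pow_left hab i)
  exact mono f _ _ hK

end RAM

/-! ## Orthogonal projections onto null spaces -/

/-- `P` is the matrix of the orthogonal projection onto `V`. -/
structure IsOrthProj {κ : Type*} [Fintype κ] (V : Submodule ℚ (κ → ℚ)) (P : Matrix κ κ ℚ) :
    Prop where
  symm : Pᵀ = P
  mem : ∀ z, P *ᵥ z ∈ V
  fix : ∀ z ∈ V, P *ᵥ z = z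

namespace IsOrthProj

variable {κ : Type*} [Fintype κ] {V : Submodule ℚ (κ → ℚ)} {P : Matrix κ κ ℚ}

/-- `P` fixes the columns of `P'`, which lie in `V' ≤ V`. -/
theorem mul_eq {V' : Submodule ℚ (κ → ℚ)} (h : IsOrthProj V P) {P' : Matrix κ κ ℚ}
    (h' : IsOrthProj V' P') (hV : V' ≤ V) : P * P' = P' := by
  classical
  refine Matrix.ext_of_mulVec_single fun i => ?_
  rw [← Matrix.mulVec_mulVec]
  exact h.fix _ (hV (h'.mem _))

/-- Both products `P P'` and `P' P` are known from `mul_eq`, and transposition exchanges them. -/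
theorem unique (h : IsOrthProj V P) {P' : Matrix κ κ ℚ} (h' : IsOrthProj V P') : P = P' := by
  have h1 := congrArg Matrix.transpose (h'.mul_eq h le_rfl)
  rw [Matrix.transpose_mul, h.symm, h'.symm, h.mul_eq h' le_rfl] at h1
  exact h1.symm

theorem mul_self (h : IsOrthProj V P) : P * P = P := h.mul_eq h le_rfl

theorem dotProduct_mulVec_comm (h : IsOrthProj V P) (a b : κ → ℚ) :
    a ⬝ᵥ P *ᵥ b = P *ᵥ a ⬝ᵥ b := by
  rw [Matrix.dotProduct_mulVec, ← Matrix.mulVec_transpose, h.symm]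

theorem dotProduct_mulVec_self (h : IsOrthProj V P) (a : κ → ℚ) :
    a ⬝ᵥ P *ᵥ a = P *ᵥ a ⬝ᵥ P *ᵥ a := by
  rw [← h.dotProduct_mulVec_comm, Matrix.mulVec_mulVec, h.mul_self]

theorem apply_self (h : IsOrthProj V P) (i : κ) : P i i = ∑ j, P i j ^ 2 := by
  conv_lhs => rw [← h.mul_self]
  rw [Matrix.mul_apply]
  refine Finset.sum_congr rfl fun j _ => ?_
  rw [sq]
  congr 1
  conv_lhs => rw [← h.symm]
  rfl

/-- By `apply_self`, a diagonal entry is the sum of the squares of its row. Hence `P i i ^ 2 ≤ P i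
i`, so `P i i ≤ 1`, and this bounds every square in the row. -/
theorem abs_apply_le (h : IsOrthProj V P) (i j : κ) : |P i j| ≤ 1 := by
  have h1 : ∀ j, P i j ^ 2 ≤ P i i := fun j => by
    rw [h.apply_self i]
    exact Finset.single_le_sum (f := fun j => P i j ^ 2) (fun _ _ => sq_nonneg _)
      (Finset.mem_univ j)
  have h2 : P i i ≤ 1 := by nlinarith [h1 i]
  exact abs_le_one_iff_mul_self_le_one.2 (by nlinarith [h1 j])

/-- Since `a · P a = |P a|²`, the hypothesis forces `P a = 0`, so `a` is already orthogonal to `V`.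
-/
theorem eq_of_dotProduct_eq_zero (h : IsOrthProj V P) {V' : Submodule ℚ (κ → ℚ)} {a : κ → ℚ}
    (hV : ∀ z, z ∈ V' ↔ z ∈ V ∧ a ⬝ᵥ z = 0) (ha : a ⬝ᵥ P *ᵥ a = 0) : V' = V := by
  ext z
  rw [hV, and_iff_left_iff_imp]
  intro hz
  rw [h.dotProduct_mulVec_self, dotProduct_self_eq_zero] at ha
  rw [← h.fix z hz, h.dotProduct_mulVec_comm, ha, zero_dotProduct]

/-- On `V`, orthogonality to `a` is orthogonality to `P a`, so the projection onto the line of `P a`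
has to be subtracted; `a · P a` is the squared length of `P a`. -/
theorem inter (h : IsOrthProj V P) {V' : Submodule ℚ (κ → ℚ)} {a : κ → ℚ}
    (hV : ∀ z, z ∈ V' ↔ z ∈ V ∧ a ⬝ᵥ z = 0) (ha : a ⬝ᵥ P *ᵥ a ≠ 0) :
    IsOrthProj V' (P - (a ⬝ᵥ P *ᵥ a)⁻¹ • vecMulVec (P *ᵥ a) (P *ᵥ a)) where
  symm := by
    rw [Matrix.transpose_sub, Matrix.transpose_smul, Matrix.transpose_vecMulVec, h.symm]
  mem z := by
    rw [hV, Matrix.sub_mulVec, Matrix.smul_mulVec, Matrix.vecMulVec_mulVec]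
    refine ⟨V.sub_mem (h.mem z) (V.smul_mem _ ?_), ?_⟩
    · rw [op_smul_eq_smul]
      exact V.smul_mem _ (h.mem a)
    · rw [dotProduct_sub, dotProduct_smul, op_smul_eq_smul, dotProduct_smul,
        h.dotProduct_mulVec_comm a z]
      simp only [smul_eq_mul]
      field_simp
      ring
  fix z hz := by
    obtain ⟨hz, haz⟩ := (hV z).1 hz
    rw [Matrix.sub_mulVec, Matrix.smul_mulVec, Matrix.vecMulVec_mulVec,
      ← h.dotProduct_mulVec_comm, h.fix z hz, haz]
    simp

theorem range_eq (h : IsOrthProj V P) : LinearMap.range P.mulVecLin = V := by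
  ext z
  constructor
  · rintro ⟨y, rfl⟩
    exact h.mem y
  · intro hz
    exact ⟨z, h.fix z hz⟩

theorem rank_eq (h : IsOrthProj V P) : P.rank = Module.finrank ℚ V := by
  rw [Matrix.rank, h.range_eq]

end IsOrthProj

/-- The null space of a matrix. -/
abbrev nullSpace {ι κ : Type*} [Fintype κ] (R : Matrix ι κ ℚ) : Submodule ℚ (κ → ℚ) :=
  LinearMap.ker R.mulVecLin

theorem finrank_nullSpace {ι κ : Type*} [Fintype ι] [Fintype κ] (R : Matrix ι κ ℚ) :
    R.rank + Module.finrank ℚ (nullSpace R) = Fintype.card κ := by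
  rw [Matrix.rank, LinearMap.finrank_range_add_finrank_ker, Module.finrank_fintype_fun_eq_card]

/-- An integer matrix as a rational matrix. -/
def Matrix.toRat {ι κ : Type*} (S : Matrix ι κ ℤ) : Matrix ι κ ℚ := S.map (Int.castRingHom ℚ)

theorem Matrix.toRat_apply {ι κ : Type*} (S : Matrix ι κ ℤ) (i : ι) (j : κ) :
    S.toRat i j = S i j := rfl

theorem Matrix.toRat_transpose {ι κ : Type*} (S : Matrix ι κ ℤ) : Sᵀ.toRat = S.toRatᵀ := rfl

theorem Matrix.toRat_mul {ι κ μ : Type*} [Fintype κ] (S : Matrix ι κ ℤ) (T : Matrix κ μ ℤ) :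
    (S * T).toRat = S.toRat * T.toRat := Matrix.map_mul

/-! ### Gram determinants as denominators of projections -/

section Gram

variable {ι κ : Type*} [Fintype ι] [DecidableEq ι] [Fintype κ]

theorem Matrix.det_toRat (S : Matrix ι ι ℤ) : S.toRat.det = S.det := (Int.cast_det S).symm

theorem Matrix.adjugate_toRat (S : Matrix ι ι ℤ) : S.toRat.adjugate = S.adjugate.toRat :=
  (RingHom.map_adjugate (Int.castRingHom ℚ) S).symm

theorem det_gram_toRat (S : Matrix ι κ ℤ) : (S.toRat * S.toRatᵀ).det = (S * Sᵀ).det := by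
  rw [← Matrix.toRat_transpose, ← Matrix.toRat_mul, Matrix.det_toRat]

variable [DecidableEq κ]

/-- The subtracted matrix is the projection onto the row space of `S`. -/
theorem isOrthProj_gram (S : Matrix ι κ ℚ) (hS : (S * Sᵀ).det ≠ 0) :
    IsOrthProj (nullSpace S) (1 - Sᵀ * (S * Sᵀ)⁻¹ * S) where
  symm := by
    simp only [Matrix.transpose_sub, Matrix.transpose_one, Matrix.transpose_mul,
      Matrix.transpose_nonsing_inv, Matrix.transpose_transpose, Matrix.mul_assoc]
  mem z := by
    rw [LinearMap.mem_ker, Matrix.mulVecLin_apply, Matrix.mulVec_mulVec, Matrix.mul_sub,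
      Matrix.mul_one, ← Matrix.mul_assoc, ← Matrix.mul_assoc,
      Matrix.mul_nonsing_inv _ (Ne.isUnit hS), Matrix.one_mul, sub_self, Matrix.zero_mulVec]
  fix z hz := by
    rw [LinearMap.mem_ker, Matrix.mulVecLin_apply] at hz
    rw [Matrix.sub_mulVec, ← Matrix.mulVec_mulVec, hz, Matrix.mulVec_zero, Matrix.one_mulVec,
      sub_zero]

/-- The Gram determinant of the rows of an integer matrix clears the denominators of the
projection onto its null space. -/
theorem IsOrthProj.exists_int {P : Matrix κ κ ℚ} {S : Matrix ι κ ℤ} (hS : (S * Sᵀ).det ≠ 0)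
    (h : IsOrthProj (nullSpace S.toRat) P) :
    ∃ Z : Matrix κ κ ℤ, ∀ i j, (Z i j : ℚ) = (S * Sᵀ).det * P i j := by
  have h0 : (S.toRat * S.toRatᵀ).det ≠ 0 := by
    rw [det_gram_toRat]
    exact_mod_cast hS
  obtain rfl := h.unique (isOrthProj_gram _ h0)
  -- By Cramer's rule the inverse Gram matrix is the adjugate over the determinant, so this integer
  -- matrix is the determinant times the projection.
  refine ⟨(S * Sᵀ).det • 1 - Sᵀ * (S * Sᵀ).adjugate * S, fun i j => ?_⟩
  have e : ((Sᵀ * (S * Sᵀ).adjugate * S) i j : ℚ) =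
      (S.toRatᵀ * (S.toRat * S.toRatᵀ).adjugate * S.toRat) i j := by
    rw [← Matrix.toRat_apply, Matrix.toRat_mul, Matrix.toRat_mul, ← Matrix.adjugate_toRat,
      Matrix.toRat_mul, Matrix.toRat_transpose]
  rw [Matrix.sub_apply, Int.cast_sub, e, Matrix.inv_def, Matrix.sub_apply, mul_sub,
    Matrix.mul_smul, Matrix.smul_mul, Matrix.smul_apply, Matrix.smul_apply, Ring.inverse_eq_inv',
    smul_eq_mul, smul_eq_mul, ← det_gram_toRat, mul_inv_cancel_left₀ h0, Int.cast_mul,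
    ← det_gram_toRat]
  simp [Matrix.one_apply]

/-- Appending the row `a` borders the Gram matrix. Its Schur complement is `a · a - a Sᵀ (S Sᵀ)⁻¹ S
a`, which equals `a · P a`. -/
theorem det_gram_fromRows {P : Matrix κ κ ℚ} {S : Matrix ι κ ℤ} (hS : (S * Sᵀ).det ≠ 0)
    (h : IsOrthProj (nullSpace S.toRat) P) (a : κ → ℤ) :
    ((fromRows S (replicateRow Unit a) * (fromRows S (replicateRow Unit a))ᵀ).det : ℚ) =
      (S * Sᵀ).det * ((fun i => (a i : ℚ)) ⬝ᵥ P *ᵥ fun i => (a i : ℚ)) := by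
  have h0 : (S.toRat * S.toRatᵀ).det ≠ 0 := by
    rw [det_gram_toRat]
    exact_mod_cast hS
  obtain rfl := h.unique (isOrthProj_gram _ h0)
  set T := S.toRat with hT
  set b : κ → ℚ := fun i => (a i : ℚ) with hb
  have hmap : (fromRows S (replicateRow Unit a)).toRat = fromRows T (replicateRow Unit b) := by
    ext i j
    cases i <;> rfl
  rw [← det_gram_toRat, ← det_gram_toRat, hmap, Matrix.transpose_fromRows,
    Matrix.fromRows_mul_fromCols]
  have : Invertible (T * Tᵀ) := Matrix.invertibleOfIsUnitDet _ (Ne.isUnit h0)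
  rw [Matrix.det_fromBlocks₁₁, Matrix.det_unique (n := Unit), Matrix.invOf_eq_nonsing_inv]
  congr 1
  rw [Matrix.sub_mulVec, Matrix.one_mulVec, dotProduct_sub, Matrix.sub_apply]
  congr 1
  have : replicateRow Unit b * Tᵀ * (T * Tᵀ)⁻¹ * (T * (replicateRow Unit b)ᵀ) =
      replicateRow Unit b * ((Tᵀ * (T * Tᵀ)⁻¹ * T) * (replicateRow Unit b)ᵀ) := by
    simp only [Matrix.mul_assoc]
  rw [this]
  rfl

end Gram

/-! ## Fraction-free computation of the projection onto a null space -/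

/-- The entries of a matrix-vector product, with indices in `ℕ`. -/
def mulVecN (c : ℕ) (q : ℕ → ℕ → ℤ) (a : ℕ → ℤ) (i : ℕ) : ℤ := ∑ j ∈ Finset.range c, q i j * a j

/-- The dot product of the first `c` entries. -/
def dotN (c : ℕ) (a b : ℕ → ℤ) : ℤ := ∑ i ∈ Finset.range c, a i * b i

/-- Intersects the range of the projection `s.1 / s.2` with the hyperplane orthogonal to `a`. -/
def elimStep (c : ℕ) (a : ℕ → ℤ) (s : (ℕ → ℕ → ℤ) × ℤ) : (ℕ → ℕ → ℤ) × ℤ :=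
  if 0 < dotN c a (mulVecN c s.1 a) then
    (fun i j =>
      (dotN c a (mulVecN c s.1 a) * s.1 i j - mulVecN c s.1 a i * mulVecN c s.1 a j) / s.2,
      dotN c a (mulVecN c s.1 a))
  else s

/-- The projection, with its denominator, onto the vectors orthogonal to the first rows of `R`. -/
def elim (c : ℕ) (R : ℕ → ℕ → ℤ) : ℕ → (ℕ → ℕ → ℤ) × ℤ
  | 0 => (fun i j => if i = j then 1 else 0, 1)
  | k + 1 => elimStep c (R k) (elim c R k)

/-- The matrix of the first `k` rows and `c` columns of `R`. -/
def rowMat (c : ℕ) (R : ℕ → ℕ → ℤ) (k : ℕ) : Matrix (Fin k) (Fin c) ℤ := of fun i j => R i j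

theorem mem_nullSpace_rowMat {c : ℕ} {R : ℕ → ℕ → ℤ} {k : ℕ} {z : Fin c → ℚ} :
    z ∈ nullSpace (rowMat c R k).toRat ↔ ∀ i < k, (fun j : Fin c => (R i j : ℚ)) ⬝ᵥ z = 0 := by
  rw [LinearMap.mem_ker, Matrix.mulVecLin_apply, funext_iff]
  exact ⟨fun h i hi => h ⟨i, hi⟩, fun h i => h i i.2⟩

/-- `s` holds the projection, with its denominator, onto the vectors orthogonal to `k` rows of `R`. -/
structure ElimInv (c : ℕ) (R : ℕ → ℕ → ℤ) (k : ℕ) (s : (ℕ → ℕ → ℤ) × ℤ)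
    (P : Matrix (Fin c) (Fin c) ℚ) : Prop where
  pos : 0 < s.2
  proj : IsOrthProj (nullSpace (rowMat c R k).toRat) P
  eq : ∀ i j : Fin c, (s.1 i j : ℚ) = s.2 * P i j
  gram : ∃ (ι : Type) (_ : Fintype ι) (_ : DecidableEq ι) (S : Matrix ι (Fin c) ℤ),
    (S * Sᵀ).det = s.2 ∧ nullSpace S.toRat = nullSpace (rowMat c R k).toRat

/-! ### The invariant of the fraction-free elimination -/

namespace ElimInv

variable {c : ℕ} {R : ℕ → ℕ → ℤ} {k : ℕ} {s : (ℕ → ℕ → ℤ) × ℤ} {P : Matrix (Fin c) (Fin c) ℚ}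

theorem mulVecN_eq (h : ElimInv c R k s P) (a : ℕ → ℤ) (i : Fin c) :
    (mulVecN c s.1 a i : ℚ) = s.2 * (P *ᵥ fun j => (a j : ℚ)) i := by
  rw [mulVecN, Finset.sum_range, Int.cast_sum, Matrix.mulVec, dotProduct, Finset.mul_sum]
  refine Finset.sum_congr rfl fun j _ => ?_
  rw [Int.cast_mul, h.eq, mul_assoc]

theorem dotN_eq (h : ElimInv c R k s P) (a : ℕ → ℤ) :
    (dotN c a (mulVecN c s.1 a) : ℚ) =
      s.2 * ((fun j : Fin c => (a j : ℚ)) ⬝ᵥ P *ᵥ fun j => (a j : ℚ)) := by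
  rw [dotN, Finset.sum_range, Int.cast_sum, dotProduct, Finset.mul_sum]
  refine Finset.sum_congr rfl fun j _ => ?_
  rw [Int.cast_mul, h.mulVecN_eq]
  ring

theorem nullSpace_succ (z : Fin c → ℚ) : z ∈ nullSpace (rowMat c R (k + 1)).toRat ↔
    z ∈ nullSpace (rowMat c R k).toRat ∧ (fun j : Fin c => (R k j : ℚ)) ⬝ᵥ z = 0 := by
  simp only [mem_nullSpace_rowMat, Nat.lt_succ_iff_lt_or_eq, or_imp, forall_and, forall_eq]

/-- A row that cuts down the null space is appended to `S`; the new denominator `e` is then the Gram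
determinant of the longer matrix. A row orthogonal to the current null space changes neither the
projection nor `S`. -/
theorem step (h : ElimInv c R k s P) : ∃ P', ElimInv c R (k + 1) (elimStep c (R k) s) P' := by
  obtain ⟨ι, _, _, S, hS, hV⟩ := h.gram
  have hd : (0 : ℚ) < s.2 := by exact_mod_cast h.pos
  have hS0 : (S * Sᵀ).det ≠ 0 := by rw [hS]; exact h.pos.ne'
  set a : Fin c → ℚ := fun j => (R k j : ℚ) with ha
  have hdot : (dotN c (R k) (mulVecN c s.1 (R k)) : ℚ) = s.2 * (a ⬝ᵥ P *ᵥ a) := h.dotN_eq (R k)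
  have hmul : ∀ i : Fin c, (mulVecN c s.1 (R k) i : ℚ) = s.2 * (P *ᵥ a) i := h.mulVecN_eq (R k)
  by_cases he : 0 < dotN c (R k) (mulVecN c s.1 (R k))
  · rw [elimStep, if_pos he]
    set e := dotN c (R k) (mulVecN c s.1 (R k)) with hedef
    have heQ : (0 : ℚ) < e := by exact_mod_cast he
    have hne : a ⬝ᵥ P *ᵥ a ≠ 0 := by
      intro h0
      rw [h0, mul_zero] at hdot
      exact heQ.ne' hdot
    have hproj := h.proj.inter (a := a) nullSpace_succ hne
    set S' := fromRows S (replicateRow Unit fun j : Fin c => R k j) with hS'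
    have hdet : (S' * S'ᵀ).det = e := by
      have := det_gram_fromRows hS0 (hV ▸ h.proj) fun j : Fin c => R k j
      rw [hS, ← hdot] at this
      exact_mod_cast this
    have hnull : nullSpace S'.toRat = nullSpace (rowMat c R (k + 1)).toRat := by
      ext z
      rw [nullSpace_succ, ← hV]
      simp only [LinearMap.mem_ker, Matrix.mulVecLin_apply, funext_iff, Sum.forall]
      refine and_congr Iff.rfl ⟨fun h => h (), fun h _ => h⟩
    refine ⟨_, he, hproj, fun i j => ?_, ι ⊕ Unit, inferInstance, inferInstance, S', hdet, hnull⟩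
    obtain ⟨Z, hZ⟩ := IsOrthProj.exists_int (S := S') (by rw [hdet]; exact he.ne')
      (hnull ▸ hproj)
    rw [hdet] at hZ
    -- `Z` is `e` times the new projection, an integer matrix because `e` is a Gram determinant. The
    -- numerator is `s.2 * Z`, so the integer division in `elimStep` is exact.
    have hnum : e * s.1 i j - mulVecN c s.1 (R k) i * mulVecN c s.1 (R k) j = s.2 * Z i j := by
      have : ((e * s.1 i j - mulVecN c s.1 (R k) i * mulVecN c s.1 (R k) j : ℤ) : ℚ) =
          (s.2 * Z i j : ℤ) := by
        push_cast
        rw [hmul, hmul, h.eq, hZ, hdot, Matrix.sub_apply, Matrix.smul_apply,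
          Matrix.vecMulVec_apply, smul_eq_mul]
        field_simp
      exact_mod_cast this
    dsimp only
    rw [hnum, Int.mul_ediv_cancel_left _ h.pos.ne', hZ]
  · rw [elimStep, if_neg he]
    -- `a · P a` is a squared length, so it vanishes once it is not positive.
    have h0 : a ⬝ᵥ P *ᵥ a = 0 := by
      have h1 : 0 ≤ a ⬝ᵥ P *ᵥ a := by
        rw [h.proj.dotProduct_mulVec_self]
        exact Finset.sum_nonneg fun i _ => mul_self_nonneg _
      have h2 : (dotN c (R k) (mulVecN c s.1 (R k)) : ℚ) ≤ 0 := by exact_mod_cast not_lt.1 he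
      rw [hdot] at h2
      nlinarith
    have hVV := h.proj.eq_of_dotProduct_eq_zero nullSpace_succ h0
    exact ⟨P, h.pos, hVV ▸ h.proj, h.eq, by rw [hVV]; exact h.gram⟩

theorem natAbs_le (h : ElimInv c R k s P) {i j : ℕ} (hi : i < c) (hj : j < c) :
    (s.1 i j).natAbs ≤ s.2.natAbs := by
  have h1 := h.eq ⟨i, hi⟩ ⟨j, hj⟩
  have h2 := h.proj.abs_apply_le ⟨i, hi⟩ ⟨j, hj⟩
  have hd : (0 : ℚ) < s.2 := by exact_mod_cast h.pos
  have h3 : |(s.1 i j : ℚ)| ≤ |(s.2 : ℚ)| := by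
    rw [h1, abs_mul]
    exact mul_le_of_le_one_right (abs_nonneg _) h2
  exact Int.natAbs_le_iff_sq_le.2 (sq_le_sq.2 (by exact_mod_cast h3))

end ElimInv

theorem exists_elimInv (c : ℕ) (R : ℕ → ℕ → ℤ) (k : ℕ) : ∃ P, ElimInv c R k (elim c R k) P := by
  induction k with
  | zero =>
    -- Without rows, `S` is the empty matrix, whose Gram determinant is the initial denominator 1.
    refine ⟨1, one_pos, ⟨Matrix.transpose_one, fun z => ?_, fun z _ => Matrix.one_mulVec z⟩,
      fun i j => ?_, Empty, inferInstance, inferInstance, 0, by simp [elim], ?_⟩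
    · rw [mem_nullSpace_rowMat]
      exact fun i hi => absurd hi (Nat.not_lt_zero i)
    · simp [elim, Matrix.one_apply, Fin.ext_iff]
    · ext z
      simp only [LinearMap.mem_ker, funext_iff]
      simp
  | succ k ih =>
    obtain ⟨P, hP⟩ := ih
    exact hP.step

theorem natAbs_sum_le {E : ℕ} {f : ℕ → ℤ} (k : ℕ) (h : ∀ i < k, (f i).natAbs ≤ E) :
    (∑ i ∈ Finset.range k, f i).natAbs ≤ k * E := by
  induction k with
  | zero => simp
  | succ k ih =>
    rw [Finset.sum_range_succ]
    have h1 := ih fun i hi => h i (by omega)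
    have h2 := h k (by omega)
    have h3 := Int.natAbs_add_le (∑ i ∈ Finset.range k, f i) (f k)
    rw [add_mul, one_mul]
    omega

theorem natAbs_elim_le {c : ℕ} {R : ℕ → ℕ → ℤ} (k : ℕ) {i j : ℕ} (hi : i < c) (hj : j < c) :
    ((elim c R k).1 i j).natAbs ≤ (elim c R k).2.natAbs := by
  obtain ⟨P, hP⟩ := exists_elimInv c R k
  exact hP.natAbs_le hi hj

theorem elim_pos (c : ℕ) (R : ℕ → ℕ → ℤ) (k : ℕ) : 0 < (elim c R k).2 := by
  obtain ⟨P, hP⟩ := exists_elimInv c R k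
  exact hP.pos

theorem natAbs_dotN_le {c k D E : ℕ} {a b : ℕ → ℤ} (hk : k ≤ c) (ha : ∀ i < c, (a i).natAbs ≤ D)
    (hb : ∀ i < c, (b i).natAbs ≤ E) : (dotN k a b).natAbs ≤ c * (D * E) := by
  refine (natAbs_sum_le k fun i hi => ?_).trans (Nat.mul_le_mul_right _ hk)
  rw [Int.natAbs_mul]
  exact Nat.mul_le_mul (ha i (by omega)) (hb i (by omega))

/-- The new denominator `a · Q a` has `c * c` summands, each made of two entries of `a` and an entry
of `Q`, and the latter is at most the old denominator. The base uses `c + 1` instead of `c` to stay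
positive when `c = 0`. -/
theorem natAbs_elim_snd_le {c E N : ℕ} {R : ℕ → ℕ → ℤ} (hE : 1 ≤ E)
    (hR : ∀ i < N, ∀ j < c, (R i j).natAbs ≤ E) (k : ℕ) (hk : k ≤ N) :
    (elim c R k).2.natAbs ≤ ((c + 1) * E) ^ (2 * k) := by
  induction k with
  | zero => simp [elim]
  | succ k ih =>
    have ih := ih (by omega)
    have h1 : 1 ≤ (c + 1) * E := Nat.mul_pos (by omega) hE
    rw [elim, elimStep]
    split_ifs with he
    · refine (natAbs_dotN_le le_rfl (hR k (by omega)) fun i hi =>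
        natAbs_dotN_le (a := (elim c R k).1 i) le_rfl
          (fun j hj => (natAbs_elim_le k hi hj).trans ih) (hR k (by omega))).trans ?_
      calc c * (E * (c * (((c + 1) * E) ^ (2 * k) * E)))
          = (c * E) * (c * E) * ((c + 1) * E) ^ (2 * k) := by ring
        _ ≤ ((c + 1) * E) * ((c + 1) * E) * ((c + 1) * E) ^ (2 * k) := by gcongr <;> omega
        _ = _ := by ring
    · exact ih.trans (Nat.pow_le_pow_right h1 (by omega))

/-! ## Full null matrices and particular solutions -/

theorem nullSpace_rowMat_eq {r c : ℕ} {R : Matrix (Fin r) (Fin c) ℚ} {Z : ℕ → ℕ → ℤ} {L : ℚ}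
    (hL : L ≠ 0) (hZ : ∀ (i : Fin r) (j : Fin c), (Z i j : ℚ) = L * R i j) :
    nullSpace (rowMat c Z r).toRat = nullSpace R := by
  have : (rowMat c Z r).toRat = L • R := by
    ext i j
    exact hZ i j
  ext z
  rw [this, LinearMap.mem_ker, LinearMap.mem_ker, Matrix.mulVecLin_apply, Matrix.mulVecLin_apply,
    Matrix.smul_mulVec, smul_eq_zero_iff_right hL]

/-- Existence is read off from the elimination itself, run on an integer multiple of `R`. -/
theorem exists_isOrthProj {r c : ℕ} (R : Matrix (Fin r) (Fin c) ℚ) :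
    ∃ P, IsOrthProj (nullSpace R) P := by
  obtain ⟨L, hL⟩ := IsLocalization.exist_integer_multiples_of_finite (nonZeroDivisors ℤ)
    fun p : Fin r × Fin c => R p.1 p.2
  choose f hf using hL
  obtain ⟨P, hP⟩ := exists_elimInv c
    (fun i j => if h : i < r ∧ j < c then f (⟨i, h.1⟩, ⟨j, h.2⟩) else 0) r
  refine ⟨P, nullSpace_rowMat_eq (R := R) (L := ((L : ℤ) : ℚ)) ?_ (fun i j => ?_) ▸ hP.proj⟩
  · exact_mod_cast nonZeroDivisors.coe_ne_zero L
  · have := hf (i, j)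
    simpa [Algebra.smul_def] using this

/-- The orthogonal projection onto the null space of `R`. -/
noncomputable def nullProj {r c : ℕ} (R : Matrix (Fin r) (Fin c) ℚ) : Matrix (Fin c) (Fin c) ℚ :=
  (exists_isOrthProj R).choose

theorem isOrthProj_nullProj {r c : ℕ} (R : Matrix (Fin r) (Fin c) ℚ) :
    IsOrthProj (nullSpace R) (nullProj R) := (exists_isOrthProj R).choose_spec

/-- By uniqueness, `nullProj` is the matrix that the elimination computes, although it is defined by
choice. -/
theorem ElimInv.eq_nullProj {r c k : ℕ} {R : Matrix (Fin r) (Fin c) ℚ} {Z : ℕ → ℕ → ℤ}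
    {s : (ℕ → ℕ → ℤ) × ℤ} {P : Matrix (Fin c) (Fin c) ℚ} (h : ElimInv c Z k s P)
    (hR : nullSpace (rowMat c Z k).toRat = nullSpace R) : P = nullProj R :=
  (hR ▸ h.proj).unique (isOrthProj_nullProj R)

theorem elim_eq_nullProj {r c : ℕ} {R : Matrix (Fin r) (Fin c) ℚ} {Z : ℕ → ℕ → ℤ} {L : ℚ}
    (hL : L ≠ 0) (hZ : ∀ (i : Fin r) (j : Fin c), (Z i j : ℚ) = L * R i j) (i j : Fin c) :
    ((elim c Z r).1 i j : ℚ) = (elim c Z r).2 * nullProj R i j := by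
  obtain ⟨P, hP⟩ := exists_elimInv c Z r
  rw [hP.eq, hP.eq_nullProj (nullSpace_rowMat_eq hL hZ)]

theorem mul_nullProj {r c : ℕ} (R : Matrix (Fin r) (Fin c) ℚ) : R * nullProj R = 0 := by
  refine Matrix.ext_of_mulVec_single fun i => ?_
  rw [← Matrix.mulVec_mulVec, Matrix.zero_mulVec]
  exact (isOrthProj_nullProj R).mem _

theorem isFullNullMatrix_nullProj {r c : ℕ} (R : Matrix (Fin r) (Fin c) ℚ) :
    IsFullNullMatrix R (nullProj R) :=
  ⟨mul_nullProj R, by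
    rw [(isOrthProj_nullProj R).rank_eq, finrank_nullSpace, Fintype.card_fin]⟩

/-- The projection is symmetric, so transposing `Aᵀ P = 0` gives `P A = 0`; the rank condition is
symmetric in the two matrices, up to transposing `A`. -/
theorem isFullNullMatrix_nullProj_transpose {r c : ℕ} (A : Matrix (Fin r) (Fin c) ℚ) :
    IsFullNullMatrix (nullProj Aᵀ) A := by
  refine ⟨?_, ?_⟩
  · have := congrArg Matrix.transpose (mul_nullProj Aᵀ)
    rwa [Matrix.transpose_mul, (isOrthProj_nullProj _).symm, Matrix.transpose_transpose,
      Matrix.transpose_zero] at this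
  · rw [add_comm, ← Matrix.rank_transpose A]
    exact (isFullNullMatrix_nullProj Aᵀ).2

/-- The column space of `N` lies in the null space of `A` and has the same dimension. -/
theorem exists_mulVec_eq_of_isFullNullMatrix {m n k : ℕ} {A : Matrix (Fin m) (Fin n) ℚ}
    {N : Matrix (Fin n) (Fin k) ℚ} (h : IsFullNullMatrix A N) {v : Fin n → ℚ} (hv : A *ᵥ v = 0) :
    ∃ x, N *ᵥ x = v := by
  have hle : LinearMap.range N.mulVecLin ≤ nullSpace A := by
    rintro _ ⟨x, rfl⟩
    rw [LinearMap.mem_ker, Matrix.mulVecLin_apply, Matrix.mulVecLin_apply, Matrix.mulVec_mulVec,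
      h.1, Matrix.zero_mulVec]
  have heq : LinearMap.range N.mulVecLin = nullSpace A := by
    refine Submodule.eq_of_le_of_finrank_eq hle ?_
    have h1 := finrank_nullSpace A
    have h2 := h.2
    rw [Fintype.card_fin] at h1
    rw [Matrix.rank, Matrix.rank] at *
    omega
  have : v ∈ LinearMap.range N.mulVecLin := heq ▸ hv
  exact this

/-- The matrix `D` with the additional column `s`. -/
def augment {m n : ℕ} (D : Matrix (Fin m) (Fin n) ℚ) (s : Fin m → ℚ) :
    Matrix (Fin m) (Fin (n + 1)) ℚ := of fun i => Fin.snoc (D i) (s i)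

theorem augment_mulVec {m n : ℕ} (D : Matrix (Fin m) (Fin n) ℚ) (s : Fin m → ℚ)
    (z : Fin (n + 1) → ℚ) :
    augment D s *ᵥ z = D *ᵥ (fun j => z j.castSucc) + z (Fin.last n) • s := by
  ext i
  simp [augment, Matrix.mulVec, dotProduct, Fin.sum_univ_castSucc, mul_comm]

/-- A particular solution of `D v = s`, if there is any. -/
noncomputable def particular {m n : ℕ} (D : Matrix (Fin m) (Fin n) ℚ) (s : Fin m → ℚ) :
    Fin n → ℚ := fun j =>
  -(nullProj (augment D s) j.castSucc (Fin.last n) /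
    nullProj (augment D s) (Fin.last n) (Fin.last n))

/-! ### A particular solution from the augmented matrix -/

section particular

variable {m n : ℕ} {D : Matrix (Fin m) (Fin n) ℚ} {s : Fin m → ℚ}

/-- A solution `v` yields the null vector `(v, -1)`, which the projection fixes. If the diagonal
entry, a sum of squares, were zero, the last row would vanish and the last entry of that fixed
vector would be 0 instead of -1. -/
theorem nullProj_augment_last_pos (h : ∃ v, D *ᵥ v = s) :
    0 < nullProj (augment D s) (Fin.last n) (Fin.last n) := by
  obtain ⟨v, hv⟩ := h
  have hP := isOrthProj_nullProj (augment D s)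
  have hz : (Fin.snoc v (-1) : Fin (n + 1) → ℚ) ∈ nullSpace (augment D s) := by
    rw [LinearMap.mem_ker, Matrix.mulVecLin_apply, augment_mulVec]
    simp [hv]
  have h1 := congrFun (hP.fix _ hz) (Fin.last n)
  rw [hP.apply_self]
  refine (Finset.sum_nonneg fun _ _ => sq_nonneg _).lt_of_ne fun h0 => ?_
  have h2 := (Finset.sum_eq_zero_iff_of_nonneg fun _ _ => sq_nonneg _).1 h0.symm
  have h3 : (nullProj (augment D s) *ᵥ (Fin.snoc v (-1) : Fin (n + 1) → ℚ)) (Fin.last n) = 0 := by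
    rw [Matrix.mulVec, dotProduct]
    exact Finset.sum_eq_zero fun j hj => by
      rw [pow_eq_zero_iff two_ne_zero |>.1 (h2 j hj), zero_mul]
  rw [h3, Fin.snoc_last] at h1
  norm_num at h1

/-- The last column of the projection is a null vector `(u, t)` of `(D | s)`, that is, `D u = -t s`;
so `-u / t` is a solution. -/
theorem mulVec_particular (h : ∃ v, D *ᵥ v = s) : D *ᵥ particular D s = s := by
  have h0 := (nullProj_augment_last_pos h).ne'
  have hP := (isOrthProj_nullProj (augment D s)).mem (Pi.single (Fin.last n) 1)
  rw [LinearMap.mem_ker, Matrix.mulVecLin_apply, augment_mulVec, Matrix.mulVec_single_one] at hP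
  have : particular D s = -(nullProj (augment D s) (Fin.last n) (Fin.last n))⁻¹ •
      fun j : Fin n => nullProj (augment D s) j.castSucc (Fin.last n) := by
    ext j
    simp only [particular, Pi.smul_apply, smul_eq_mul]
    field_simp
  rw [this, Matrix.mulVec_smul]
  have h2 := eq_neg_of_add_eq_zero_left hP
  change (D *ᵥ fun j : Fin n => nullProj (augment D s) j.castSucc (Fin.last n)) =
    -(nullProj (augment D s) (Fin.last n) (Fin.last n) • s) at h2
  rw [h2, smul_neg, neg_smul, neg_neg, smul_smul, inv_mul_cancel₀ h0, one_smul]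

variable {Z : ℕ → ℕ → ℤ} {L : ℚ}

theorem elim_augment (hL : L ≠ 0) (hZ : ∀ (i : Fin m) (j : Fin n), (Z i j : ℚ) = L * D i j)
    (hs : ∀ i : Fin m, (Z i n : ℚ) = L * s i) (i j : Fin (n + 1)) :
    ((elim (n + 1) Z m).1 i j : ℚ) = (elim (n + 1) Z m).2 * nullProj (augment D s) i j := by
  refine elim_eq_nullProj hL (fun i j => ?_) i j
  refine Fin.lastCases ?_ (fun j => ?_) j
  · simpa [augment] using hs i
  · simpa [augment] using hZ i j

/-- The multiplication of the computed projection with the last unit vector. -/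
theorem mulVecN_unit {c : ℕ} {q : ℕ → ℕ → ℤ} {e : ℕ → ℤ}
    (he : ∀ j ≤ c, e j = if j = c then 1 else 0)
    (i : ℕ) : mulVecN (c + 1) q e i = q i c := by
  rw [mulVecN, Finset.sum_eq_single c]
  · simp [he]
  · intro j hj hjc
    rw [he j (by simpa [Nat.lt_succ_iff] using hj), if_neg hjc, mul_zero]
  · simp

theorem dotN_unit {c : ℕ} {a e : ℕ → ℤ} (he : ∀ j ≤ c, e j = if j = c then 1 else 0) :
    dotN (c + 1) e a = a c := by
  have := mulVecN_unit (q := fun _ => a) he 0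
  rw [mulVecN] at this
  rw [dotN, ← this]
  exact Finset.sum_congr rfl fun _ _ => mul_comm _ _

section unit

variable (hsol : ∃ v, D *ᵥ v = s) (hL : L ≠ 0)
  (hZ : ∀ (i : Fin m) (j : Fin n), (Z i j : ℚ) = L * D i j)
  (hs : ∀ i : Fin m, (Z i n : ℚ) = L * s i)
  (he : ∀ j ≤ n, Z m j = if j = n then 1 else 0)
include hsol hL hZ hs he

/-- For the last unit vector, `a · Q a` is the last diagonal entry of `Q`. Solvability makes it
positive, so the step takes its first branch. -/
theorem elim_unit_pos : 0 < dotN (n + 1) (Z m) (mulVecN (n + 1) (elim (n + 1) Z m).1 (Z m)) := by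
  rw [dotN_unit he, mulVecN_unit he]
  have h := elim_augment hL hZ hs (Fin.last n) (Fin.last n)
  have h1 : (0 : ℚ) < (elim (n + 1) Z m).2 := by exact_mod_cast elim_pos _ _ _
  have h2 := mul_pos h1 (nullProj_augment_last_pos hsol)
  rw [← h] at h2
  exact_mod_cast h2

theorem elim_unit_snd : (elim (n + 1) Z (m + 1)).2 = (elim (n + 1) Z m).1 n n := by
  rw [elim, elimStep, if_pos (elim_unit_pos hsol hL hZ hs he), dotN_unit he, mulVecN_unit he]

/-- The product is the last column of `Q`, and the denominator after the step is the last entry of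
that column; their quotients are the negatives of the particular solution. -/
theorem mulVecN_elim_unit (i : Fin n) :
    (mulVecN (n + 1) (elim (n + 1) Z m).1 (Z m) i : ℚ) =
      -((elim (n + 1) Z (m + 1)).2 * particular D s i) := by
  rw [mulVecN_unit he, elim_unit_snd hsol hL hZ hs he, particular]
  have h1 := elim_augment hL hZ hs (Fin.last n) (Fin.last n)
  have h2 := elim_augment hL hZ hs i.castSucc (Fin.last n)
  rw [Fin.val_last] at h1 h2
  rw [Fin.val_castSucc] at h2
  have h0 := (nullProj_augment_last_pos hsol).ne'
  rw [h1, h2]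
  field_simp

omit hsol in
-- The null space of `(D | s)` together with the last unit row consists of the vectors `(z, 0)` with
-- `D z = 0`. The leading block of its projection is therefore the projection onto the null space of
-- `D`.
theorem elim_unit_fst (i j : Fin n) :
    ((elim (n + 1) Z (m + 1)).1 i j : ℚ) = (elim (n + 1) Z (m + 1)).2 * nullProj D i j := by
  obtain ⟨P, hP⟩ := exists_elimInv (n + 1) Z (m + 1)
  have hV : ∀ z, z ∈ nullSpace (rowMat (n + 1) Z (m + 1)).toRat ↔
      D *ᵥ (fun j => z j.castSucc) = 0 ∧ z (Fin.last n) = 0 := by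
    intro z
    rw [ElimInv.nullSpace_succ, nullSpace_rowMat_eq (R := augment D s) hL, LinearMap.mem_ker,
      Matrix.mulVecLin_apply, augment_mulVec]
    · have : (fun j : Fin (n + 1) => (Z m j : ℚ)) ⬝ᵥ z = z (Fin.last n) := by
        rw [dotProduct, Fin.sum_univ_castSucc]
        simp [he, (Fin.is_lt _).ne, (Fin.is_lt _).le]
      rw [this]
      refine ⟨fun h => ⟨by simpa [h.2] using h.1, h.2⟩, fun h => ⟨by simp [h.1, h.2], h.2⟩⟩
    · refine fun i j => Fin.lastCases ?_ (fun j => ?_) j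
      · simpa [augment] using hs i
      · simpa [augment] using hZ i j
  have hmul : ∀ z : Fin n → ℚ, P.submatrix Fin.castSucc Fin.castSucc *ᵥ z =
      fun j => (P *ᵥ (Fin.snoc z 0 : Fin (n + 1) → ℚ)) j.castSucc := by
    intro z
    ext j
    simp [Matrix.mulVec, dotProduct, Fin.sum_univ_castSucc]
  have hproj : IsOrthProj (nullSpace D) (P.submatrix Fin.castSucc Fin.castSucc) := by
    refine ⟨by rw [Matrix.transpose_submatrix, hP.proj.symm], fun z => ?_, fun z hz => ?_⟩
    · rw [hmul]
      exact ((hV _).1 (hP.proj.mem _)).1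
    · rw [hmul, hP.proj.fix]
      · simp
      · rw [hV]
        simpa using hz
  rw [← hproj.unique (isOrthProj_nullProj D), Matrix.submatrix_apply, ← hP.eq]
  rfl

end unit

end particular

/-! ## The reductions -/

theorem EDRInst.exists_mulVec_eq (I : EDRInst) : ∃ v, I.D *ᵥ v = I.s := by
  have h := I.mem
  rw [← Matrix.range_mulVecLin] at h
  exact h

namespace MinProblem

theorem opt_le_opt {F G : MinProblem} {x : F.Inst} {x' : G.Inst}
    (h : ∀ y : F.Sol x, ∃ y' : G.Sol x', G.metric x' y' = F.metric x y) :
    G.opt x' ≤ F.opt x := by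
  have := F.sol_nonempty x
  obtain ⟨y, hy⟩ := Nat.sInf_mem (Set.range_nonempty (F.metric x))
  obtain ⟨y', hy'⟩ := h y
  refine Nat.sInf_le ⟨y', ?_⟩
  rw [hy', hy]
  rfl

end MinProblem

namespace EDRInst

/-- The instance `⟨A, y⟩` of min unsatisfy with `A` a full null matrix and `y` a solution. -/
noncomputable def toMU (I : EDRInst) : MUInst where
  m := I.n
  n := I.n
  A := nullProj I.D
  y := particular I.D I.s

noncomputable def ofMUSol (I : EDRInst) (x : Fin I.n → ℚ) : {v : Fin I.n → ℚ // I.D *ᵥ v = I.s} :=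
  ⟨particular I.D I.s - nullProj I.D *ᵥ x, by
    rw [Matrix.mulVec_sub, mulVec_particular I.exists_mulVec_eq, Matrix.mulVec_mulVec,
      mul_nullProj, Matrix.zero_mulVec, sub_zero]⟩

end EDRInst

namespace MUInst

/-- The instance `⟨D, D y⟩` of exact dictionary representation with `A` a full null matrix
for `D`. -/
noncomputable def toEDR (I : MUInst) : EDRInst := EDRInst.ofVec (nullProj I.Aᵀ) I.y

noncomputable def ofEDRSol (I : MUInst)
    (v : {v : Fin I.m → ℚ // nullProj I.Aᵀ *ᵥ v = nullProj I.Aᵀ *ᵥ I.y}) : Fin I.n → ℚ :=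
  particular I.A (I.y - v.1)

theorem exists_mulVec_eq (I : MUInst)
    (v : {v : Fin I.m → ℚ // nullProj I.Aᵀ *ᵥ v = nullProj I.Aᵀ *ᵥ I.y}) :
    ∃ x, I.A *ᵥ x = I.y - v.1 :=
  exists_mulVec_eq_of_isFullNullMatrix (isFullNullMatrix_nullProj_transpose I.A)
    (by rw [Matrix.mulVec_sub, v.2, sub_self])

theorem nullProj_mulVec_sub (I : MUInst) (x : Fin I.n → ℚ) :
    nullProj I.Aᵀ *ᵥ (I.y - I.A *ᵥ x) = nullProj I.Aᵀ *ᵥ I.y := by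
  rw [Matrix.mulVec_sub, Matrix.mulVec_mulVec, (isFullNullMatrix_nullProj_transpose I.A).1,
    Matrix.zero_mulVec, sub_zero]

theorem mulVec_ofEDRSol (I : MUInst)
    (v : {v : Fin I.m → ℚ // nullProj I.Aᵀ *ᵥ v = nullProj I.Aᵀ *ᵥ I.y}) :
    I.A *ᵥ I.ofEDRSol v = I.y - v.1 := mulVec_particular (I.exists_mulVec_eq v)

theorem sub_mulVec_ofEDRSol (I : MUInst)
    (v : {v : Fin I.m → ℚ // nullProj I.Aᵀ *ᵥ v = nullProj I.Aᵀ *ᵥ I.y}) :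
    I.y - I.A *ᵥ I.ofEDRSol v = v.1 := by
  rw [I.mulVec_ofEDRSol, sub_sub_cancel]

end MUInst

theorem isExactReduction_EDR_MU
    (h₁ : RAM.PolyTime EDR.encInst fun I => MU.encInst (EDRInst.toMU I))
    (h₂ : RAM.PolyTime
      (fun p : (I : EDRInst) × (Fin I.n → ℚ) => RAM.encPair (EDR.encInst p.1) (RAM.encVec p.2))
      (fun p => RAM.encVec (p.1.ofMUSol p.2).1)) :
    MinProblem.IsExactReduction EDR MU EDRInst.toMU EDRInst.ofMUSol where
  polyTime_fst := h₁
  polyTime_snd := h₂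
  metric_eq _ _ := rfl
  opt_le I := MinProblem.opt_le_opt fun v => by
    -- Every solution `v` has the form `y - P x`, as `y - v` lies in the null space of `D`.
    obtain ⟨x, hx⟩ := exists_mulVec_eq_of_isFullNullMatrix (isFullNullMatrix_nullProj I.D)
      (v := particular I.D I.s - v.1)
      (by rw [Matrix.mulVec_sub, mulVec_particular I.exists_mulVec_eq, v.2, sub_self])
    refine ⟨x, ?_⟩
    change hammingNorm (particular I.D I.s - nullProj I.D *ᵥ x) = hammingNorm v.1
    rw [hx, sub_sub_cancel]

theorem isExactReduction_MU_EDR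
    (h₁ : RAM.PolyTime MU.encInst fun I => EDR.encInst (MUInst.toEDR I))
    (h₂ : RAM.PolyTime
      (fun p : (I : MUInst) × {v : Fin I.m → ℚ // nullProj I.Aᵀ *ᵥ v = nullProj I.Aᵀ *ᵥ I.y} =>
        RAM.encPair (MU.encInst p.1) (RAM.encVec p.2.1))
      (fun p => RAM.encVec (p.1.ofEDRSol p.2))) :
    MinProblem.IsExactReduction MU EDR MUInst.toEDR MUInst.ofEDRSol where
  polyTime_fst := h₁
  polyTime_snd := h₂
  metric_eq I v := congrArg hammingNorm (MUInst.sub_mulVec_ofEDRSol I v)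
  opt_le I := MinProblem.opt_le_opt fun x => by
    refine ⟨⟨I.y - I.A *ᵥ x, I.nullProj_mulVec_sub x⟩, rfl⟩

namespace RAM

/-! ## Named registers -/

instance : Add Expr := ⟨.add⟩
instance : Sub Expr := ⟨.sub⟩
instance : Mul Expr := ⟨.mul⟩
instance : Div Expr := ⟨.div⟩
instance (k : ℕ) : OfNat Expr k := ⟨.const k⟩

@[simp] theorem Expr.eval_add (σ : State) (e₁ e₂ : Expr) :
    (e₁ + e₂).eval σ = e₁.eval σ + e₂.eval σ := rfl
@[simp] theorem Expr.eval_sub (σ : State) (e₁ e₂ : Expr) :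
    (e₁ - e₂).eval σ = e₁.eval σ - e₂.eval σ := rfl
@[simp] theorem Expr.eval_mul (σ : State) (e₁ e₂ : Expr) :
    (e₁ * e₂).eval σ = e₁.eval σ * e₂.eval σ := rfl
@[simp] theorem Expr.eval_div (σ : State) (e₁ e₂ : Expr) :
    (e₁ / e₂).eval σ = e₁.eval σ / e₂.eval σ := rfl
@[simp] theorem Expr.eval_zero (σ : State) : (0 : Expr).eval σ = 0 := rfl
@[simp] theorem Expr.eval_one (σ : State) : (1 : Expr).eval σ = 1 := rfl
@[simp] theorem Expr.eval_two (σ : State) : (2 : Expr).eval σ = 2 := rfl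

/-- The registers of the programs below. -/
structure Regs where
  len : ℤ
  L : ℤ
  m : ℤ
  n : ℤ
  c : ℤ
  d : ℤ
  e : ℤ
  s : ℤ
  i : ℤ
  j : ℤ
  t : ℤ
  u : ℤ
  v : ℤ
  b : ℤ
  x : ℤ
  y : ℤ
  k : ℤ
  inp : ℤ → ℤ
  S : ℤ → ℤ
  Q : ℤ → ℤ
  a : ℤ → ℤ
  w : ℤ → ℤ
  z : ℤ → ℤ
  out : List ℤ

namespace Regs

/-- The variables of the machine. -/
def varAt (r : Regs) : ℕ → ℤ
  | 0 => r.len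
  | 1 => r.L
  | 2 => r.m
  | 3 => r.n
  | 4 => r.c
  | 5 => r.d
  | 6 => r.e
  | 7 => r.s
  | 8 => r.i
  | 9 => r.j
  | 10 => r.t
  | 11 => r.u
  | 12 => r.v
  | 13 => r.b
  | 14 => r.x
  | 15 => r.y
  | 16 => r.k
  | _ => 0

/-- The arrays of the machine. -/
def arrAt (r : Regs) : ℕ → ℤ → ℤ
  | 0 => r.inp
  | 1 => r.S
  | 2 => r.Q
  | 3 => r.a
  | 4 => r.w
  | 5 => r.z
  | _ => fun _ => 0

/-- The state of the machine with these registers. -/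
def state (r : Regs) : State := ⟨r.varAt, r.arrAt, r.out⟩

end Regs

namespace Expr

abbrev len : Expr := .var 0
abbrev L : Expr := .var 1
abbrev m : Expr := .var 2
abbrev n : Expr := .var 3
abbrev c : Expr := .var 4
abbrev d : Expr := .var 5
abbrev e : Expr := .var 6
abbrev s : Expr := .var 7
abbrev i : Expr := .var 8
abbrev j : Expr := .var 9
abbrev t : Expr := .var 10
abbrev u : Expr := .var 11
abbrev v : Expr := .var 12
abbrev b : Expr := .var 13
abbrev x : Expr := .var 14
abbrev y : Expr := .var 15
abbrev k : Expr := .var 16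
abbrev inp (p : Expr) : Expr := .get 0 p
abbrev S (p : Expr) : Expr := .get 1 p
abbrev Q (p : Expr) : Expr := .get 2 p
abbrev a (p : Expr) : Expr := .get 3 p
abbrev w (p : Expr) : Expr := .get 4 p
abbrev z (p : Expr) : Expr := .get 5 p

end Expr

namespace Regs

variable (r : Regs) (p : Expr)

@[simp] theorem eval_L : Expr.L.eval r.state = r.L := rfl
@[simp] theorem eval_m : Expr.m.eval r.state = r.m := rfl
@[simp] theorem eval_n : Expr.n.eval r.state = r.n := rfl
@[simp] theorem eval_c : Expr.c.eval r.state = r.c := rfl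
@[simp] theorem eval_d : Expr.d.eval r.state = r.d := rfl
@[simp] theorem eval_e : Expr.e.eval r.state = r.e := rfl
@[simp] theorem eval_s : Expr.s.eval r.state = r.s := rfl
@[simp] theorem eval_i : Expr.i.eval r.state = r.i := rfl
@[simp] theorem eval_j : Expr.j.eval r.state = r.j := rfl
@[simp] theorem eval_t : Expr.t.eval r.state = r.t := rfl
@[simp] theorem eval_u : Expr.u.eval r.state = r.u := rfl
@[simp] theorem eval_v : Expr.v.eval r.state = r.v := rfl
@[simp] theorem eval_x : Expr.x.eval r.state = r.x := rfl
@[simp] theorem eval_y : Expr.y.eval r.state = r.y := rfl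
@[simp] theorem eval_k : Expr.k.eval r.state = r.k := rfl
@[simp] theorem eval_inp : (Expr.inp p).eval r.state = r.inp (p.eval r.state) := rfl
@[simp] theorem eval_Q : (Expr.Q p).eval r.state = r.Q (p.eval r.state) := rfl
@[simp] theorem eval_a : (Expr.a p).eval r.state = r.a (p.eval r.state) := rfl
@[simp] theorem eval_w : (Expr.w p).eval r.state = r.w (p.eval r.state) := rfl
@[simp] theorem eval_z : (Expr.z p).eval r.state = r.z (p.eval r.state) := rfl

/-- Machine updates of numbered cells become updates of record fields, so that the states in the
program proofs can be compared field by field. -/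
theorem setVar_eq {r r' : Regs} {x : ℕ} {v : ℤ} (h : ∀ y ≠ x, r.varAt y = r'.varAt y)
    (hx : r'.varAt x = v) (ha : r.arrAt = r'.arrAt) (ho : r.out = r'.out) :
    r.state.setVar x v = r'.state := by
  have : Function.update r.varAt x v = r'.varAt := by
    funext y
    by_cases hy : y = x
    · subst hy; rw [Function.update_self, hx]
    · rw [Function.update_of_ne hy, h y hy]
  simp only [state, State.setVar, this, ha, ho]

theorem setArr_eq {r r' : Regs} {a : ℕ} {i v : ℤ} (h : ∀ b ≠ a, r.arrAt b = r'.arrAt b)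
    (ha : r'.arrAt a = Function.update (r.arrAt a) i v) (hv : r.varAt = r'.varAt)
    (ho : r.out = r'.out) : r.state.setArr a i v = r'.state := by
  have : Function.update r.arrAt a (Function.update (r.arrAt a) i v) = r'.arrAt := by
    funext y
    by_cases hy : y = a
    · subst hy; rw [Function.update_self, ha]
    · rw [Function.update_of_ne hy, h y hy]
  simp only [state, State.setArr, this, hv, ho]

variable (q : ℤ)

theorem set_L : r.state.setVar 1 q = { r with L := q }.state :=
  setVar_eq (fun y hy => by unfold varAt; split <;> first | rfl | exact absurd rfl hy) rfl rfl rfl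

theorem set_m : r.state.setVar 2 q = { r with m := q }.state :=
  setVar_eq (fun y hy => by unfold varAt; split <;> first | rfl | exact absurd rfl hy) rfl rfl rfl

theorem set_n : r.state.setVar 3 q = { r with n := q }.state :=
  setVar_eq (fun y hy => by unfold varAt; split <;> first | rfl | exact absurd rfl hy) rfl rfl rfl

theorem set_c : r.state.setVar 4 q = { r with c := q }.state :=
  setVar_eq (fun y hy => by unfold varAt; split <;> first | rfl | exact absurd rfl hy) rfl rfl rfl

theorem set_d : r.state.setVar 5 q = { r with d := q }.state :=
  setVar_eq (fun y hy => by unfold varAt; split <;> first | rfl | exact absurd rfl hy) rfl rfl rfl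

theorem set_e : r.state.setVar 6 q = { r with e := q }.state :=
  setVar_eq (fun y hy => by unfold varAt; split <;> first | rfl | exact absurd rfl hy) rfl rfl rfl

theorem set_s : r.state.setVar 7 q = { r with s := q }.state :=
  setVar_eq (fun y hy => by unfold varAt; split <;> first | rfl | exact absurd rfl hy) rfl rfl rfl

theorem set_i : r.state.setVar 8 q = { r with i := q }.state :=
  setVar_eq (fun y hy => by unfold varAt; split <;> first | rfl | exact absurd rfl hy) rfl rfl rfl

theorem set_j : r.state.setVar 9 q = { r with j := q }.state :=
  setVar_eq (fun y hy => by unfold varAt; split <;> first | rfl | exact absurd rfl hy) rfl rfl rfl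

theorem set_t : r.state.setVar 10 q = { r with t := q }.state :=
  setVar_eq (fun y hy => by unfold varAt; split <;> first | rfl | exact absurd rfl hy) rfl rfl rfl

theorem set_u : r.state.setVar 11 q = { r with u := q }.state :=
  setVar_eq (fun y hy => by unfold varAt; split <;> first | rfl | exact absurd rfl hy) rfl rfl rfl

theorem set_v : r.state.setVar 12 q = { r with v := q }.state :=
  setVar_eq (fun y hy => by unfold varAt; split <;> first | rfl | exact absurd rfl hy) rfl rfl rfl

theorem set_b : r.state.setVar 13 q = { r with b := q }.state :=
  setVar_eq (fun y hy => by unfold varAt; split <;> first | rfl | exact absurd rfl hy) rfl rfl rfl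

theorem set_x : r.state.setVar 14 q = { r with x := q }.state :=
  setVar_eq (fun y hy => by unfold varAt; split <;> first | rfl | exact absurd rfl hy) rfl rfl rfl

theorem set_y : r.state.setVar 15 q = { r with y := q }.state :=
  setVar_eq (fun y hy => by unfold varAt; split <;> first | rfl | exact absurd rfl hy) rfl rfl rfl

theorem set_k : r.state.setVar 16 q = { r with k := q }.state :=
  setVar_eq (fun y hy => by unfold varAt; split <;> first | rfl | exact absurd rfl hy) rfl rfl rfl

variable (o : ℤ)

theorem store_S : r.state.setArr 1 o q = { r with S := Function.update r.S o q }.state :=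
  setArr_eq (fun y hy => by unfold arrAt; split <;> first | rfl | exact absurd rfl hy) rfl rfl rfl

theorem store_Q : r.state.setArr 2 o q = { r with Q := Function.update r.Q o q }.state :=
  setArr_eq (fun y hy => by unfold arrAt; split <;> first | rfl | exact absurd rfl hy) rfl rfl rfl

theorem store_a : r.state.setArr 3 o q = { r with a := Function.update r.a o q }.state :=
  setArr_eq (fun y hy => by unfold arrAt; split <;> first | rfl | exact absurd rfl hy) rfl rfl rfl

theorem store_w : r.state.setArr 4 o q = { r with w := Function.update r.w o q }.state :=
  setArr_eq (fun y hy => by unfold arrAt; split <;> first | rfl | exact absurd rfl hy) rfl rfl rfl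

theorem store_z : r.state.setArr 5 o q = { r with z := Function.update r.z o q }.state :=
  setArr_eq (fun y hy => by unfold arrAt; split <;> first | rfl | exact absurd rfl hy) rfl rfl rfl

end Regs

variable {M K : ℕ}

theorem Exec.set (hM : Limits M K) {r r' : Regs} {x : ℕ} {e : Expr} {v : ℤ}
    (h : r.state.setVar x v = r'.state) (hv : e.eval r.state = v) (hb : v.natAbs ≤ M) :
    Exec M K (.assign x e) r.state r'.state := by
  rw [← h, ← hv]
  exact Exec.assign hM.two_le (hv ▸ hb)

theorem Exec.put (hM : Limits M K) {r r' : Regs} {a : ℕ} {p e : Expr} {i v : ℤ}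
    (h : r.state.setArr a i v = r'.state) (hi : p.eval r.state = i) (hv : e.eval r.state = v)
    (hb : v.natAbs ≤ M) : Exec M K (.store a p e) r.state r'.state := by
  rw [← h, ← hv, ← hi]
  exact Exec.store hM.two_le (hv ▸ hb)

theorem Exec.emit (hM : Limits M K) {r : Regs} {e : Expr} {v : ℤ} (hv : e.eval r.state = v) :
    Exec M K (.write e) r.state { r with out := r.out ++ [v] }.state := by
  have := Exec.write (K := K) hM.two_le (e := e) (σ := r.state)
  rwa [hv] at this

/-- A loop whose counter is read and written by `get` and `set`. -/
theorem Exec.for (hM : Limits M K) {x : ℕ} {N : Expr} {p : Prog} {set : Regs → ℤ → Regs}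
    (hset : ∀ r v, r.state.setVar x v = (set r v).state) (F : ℕ → Regs) {n : ℕ} (hn : n ≤ K)
    (h0 : ∀ k, (F k).varAt x = 0) (hN : ∀ k ≤ n, N.eval (set (F k) k).state = n)
    (hp : ∀ k < n, Exec M K p (set (F k) k).state (set (F (k + 1)) k).state) :
    Exec M K (.loop x N p) (F 0).state (F n).state :=
  Exec.loop hM (fun k => (F k).state) hn h0 (fun k hk => by rw [hset]; exact hN k hk)
    fun k hk => by rw [hset, hset]; exact hp k hk

/-! ## Arrays -/

/-- The array `g` with its first `N` entries replaced by those of `f`. -/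
def fill (N : ℕ) (f : ℕ → ℤ) (g : ℤ → ℤ) (p : ℤ) : ℤ :=
  if 0 ≤ p ∧ p < N then f p.toNat else g p

theorem fill_zero (f : ℕ → ℤ) (g : ℤ → ℤ) : fill 0 f g = g := by
  funext p
  rw [fill, if_neg (by omega)]

theorem fill_natCast {N : ℕ} (f : ℕ → ℤ) (g : ℤ → ℤ) {i : ℕ} (hi : i < N) : fill N f g i = f i := by
  rw [fill, if_pos (by omega), Int.toNat_natCast]

theorem fill_natCast_of_le {N : ℕ} (f : ℕ → ℤ) (g : ℤ → ℤ) {i : ℕ} (hi : N ≤ i) :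
    fill N f g i = g i := by
  rw [fill, if_neg (by omega)]

/-- One pass of a loop that writes the cells of an array in order. -/
theorem update_fill (N : ℕ) (f : ℕ → ℤ) (g : ℤ → ℤ) :
    Function.update (fill N f g) (N : ℤ) (f N) = fill (N + 1) f g := by
  funext p
  by_cases hp : p = N
  · subst hp
    rw [Function.update_self, fill_natCast _ _ (by omega)]
  · rw [Function.update_of_ne hp, fill, fill]
    exact if_congr (by omega) rfl rfl

theorem fill_fill (N : ℕ) (f f' : ℕ → ℤ) (g : ℤ → ℤ) : fill N f (fill N f' g) = fill N f g := by
  funext p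
  rw [fill, fill, fill]
  split_ifs <;> rfl

/-- The array `g` with the matrix `q` of `c` columns and rows written over its beginning. -/
def flat (c : ℕ) (q : ℕ → ℕ → ℤ) (g : ℤ → ℤ) : ℤ → ℤ := fill (c * c) (fun p => q (p / c) (p % c)) g

theorem fill_flat {c : ℕ} (q q' : ℕ → ℕ → ℤ) (g : ℤ → ℤ) :
    fill (c * c) (fun p => q (p / c) (p % c)) (flat c q' g) = flat c q g := fill_fill _ _ _ _

theorem flat_apply {c : ℕ} (q : ℕ → ℕ → ℤ) (g : ℤ → ℤ) {i j : ℕ} (hi : i < c) (hj : j < c) :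
    flat c q g ((i : ℤ) * c + j) = q i j := by
  have h1 : i * c + j < c * c := by nlinarith
  have h2 := fill_natCast (fun p => q (p / c) (p % c)) g h1
  rw [flat]
  push_cast at h2
  rw [h2, mul_comm i c, Nat.mul_add_div (by omega), Nat.div_eq_of_lt hj, Nat.mul_add_mod,
    Nat.mod_eq_of_lt hj, add_zero]

end RAM

namespace RAM

variable {M K : ℕ}

/-! ## Procedures -/

/-- The product of the positive ones among the first `N` values. -/
def posProd (f : ℕ → ℤ) (N : ℕ) : ℤ := ∏ i ∈ Finset.range N, if 0 < f i then f i else 1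

/-- Sets `L` to the product of the positive letters of the input. -/
def Prog.posProd : Prog :=
  .seq (.assign 1 1) (.loop 10 .len (.ifPos (.inp .t) (.assign 1 (.L * .inp .t)) .skip))

theorem Exec.posProd (hM : Limits M K) {r : Regs} {N : ℕ} (hN : N ≤ K) (hlen : r.len = N)
    (ht : r.t = 0) (hb : ∀ k ≤ N, (RAM.posProd (fun i => r.inp i) k).natAbs ≤ M) :
    Exec M K .posProd r.state { r with L := RAM.posProd (fun i => r.inp i) N }.state := by
  refine .seq (.set hM (Regs.set_L _ 1) rfl (hb 0 (by omega))) ?_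
  refine Exec.for hM Regs.set_t (fun k => { r with L := RAM.posProd (fun i => r.inp i) k }) hN
    (fun _ => ht) (fun _ _ => hlen) fun k hk => ?_
  by_cases h : 0 < r.inp k
  · refine .ifTrue hM.two_le h (.set hM (Regs.set_L _ _) ?_ (hb (k + 1) hk))
    simp [RAM.posProd, Finset.prod_range_succ, h]
  · refine .ifFalse hM.two_le h ?_
    have : RAM.posProd (fun i => r.inp i) (k + 1) = RAM.posProd (fun i => r.inp i) k := by
      simp [RAM.posProd, Finset.prod_range_succ, h]
    rw [this]
    exact .skip _

/-- Scales every letter, as a numerator followed by its denominator, by `L`. -/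
def Prog.scale : Prog := .loop 10 .len (.store 1 .t (.inp .t * (.L / .inp (.t + 1))))

theorem Exec.scale (hM : Limits M K) {r : Regs} {N : ℕ} (hN : N ≤ K) (hlen : r.len = N)
    (ht : r.t = 0) (hb : ∀ k < N, (r.inp k * (r.L / r.inp (k + 1))).natAbs ≤ M) :
    Exec M K .scale r.state
      { r with S := fill N (fun k => r.inp k * (r.L / r.inp (k + 1))) r.S }.state := by
  have := Exec.for hM Regs.set_t
    (fun k => { r with S := fill k (fun k => r.inp k * (r.L / r.inp (k + 1))) r.S }) hN
    (fun _ => ht) (N := .len) (fun _ _ => hlen) (p := .store 1 .t (.inp .t * (.L / .inp (.t + 1))))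
    fun k hk => by
      rw [← update_fill]
      exact .put hM (Regs.store_S _ _ _) rfl rfl (hb k hk)
  rwa [fill_zero] at this

/-- Starts the elimination with the unit matrix and the denominator one. -/
def Prog.initQ : Prog :=
  .seq (.assign 5 1) (.loop 10 (.c * .c)
    (.store 2 .t (1 - (.t / .c - (.t - .t / .c * .c)) / (.t / .c - (.t - .t / .c * .c)))))

/-- The machine divides but has no remainder operation; programs compute it by the left-hand side.
-/
theorem natCast_sub_div_mul (t c : ℕ) : (t : ℤ) - t / c * c = (t % c : ℕ) := by
  rw [mul_comm, ← Int.emod_def, Int.natCast_mod]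

theorem Exec.initQ (hM : Limits M K) {r : Regs} {c : ℕ} (hc : r.c = c) (hcK : c * c ≤ K)
    (ht : r.t = 0) (R : ℕ → ℕ → ℤ) :
    Exec M K .initQ r.state
      { r with Q := flat c (elim c R 0).1 r.Q, d := (elim c R 0).2 }.state := by
  have h2 := hM.two_le
  refine .seq (.set hM (Regs.set_d _ 1) rfl (by simp; omega)) ?_
  have := Exec.for hM Regs.set_t
    (fun k => { r with Q := fill k (fun p => (elim c R 0).1 (p / c) (p % c)) r.Q, d := 1 }) hcK
    (fun _ => ht) (N := .c * .c) (fun _ _ => by simp [hc])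
    (p := .store 2 .t (1 - (.t / .c - (.t - .t / .c * .c)) / (.t / .c - (.t - .t / .c * .c))))
    fun k hk => by
      rw [← update_fill]
      refine .put hM (Regs.store_Q _ _ _) rfl ?_ ?_
      · simp only [Expr.eval_sub, Expr.eval_div, Expr.eval_mul, Regs.eval_t, Regs.eval_c, hc,
          Expr.eval_one, natCast_sub_div_mul]
        simp only [elim, ← Int.natCast_div]
        -- The stored value is `1 - x / x` for `x` the difference of row and column. As `0 / 0 = 0`,
        -- it is 1 on the diagonal and 0 elsewhere.
        split_ifs with h
        · simp [h]
        · rw [Int.ediv_self (by omega), sub_self]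
      · simp only [elim]
        split_ifs <;> simp
        omega
  rw [fill_zero] at this
  exact this

/-- Sets `w` to the product of the matrix `Q` and the vector `a`. -/
def Prog.matvec : Prog :=
  .loop 8 .c (.seq (.loop 9 .c (.assign 7 (.s + .Q (.i * .c + .j) * .a .j)))
    (.seq (.store 4 .i .s) (.assign 7 0)))

theorem Exec.matvec (hM : Limits M K) {r : Regs} {c : ℕ} (hc : r.c = c) (hcK : c ≤ K)
    (hi : r.i = 0) (hj : r.j = 0) (hs : r.s = 0) {q : ℕ → ℕ → ℤ} {f : ℕ → ℤ}
    (hq : ∀ i < c, ∀ j < c, r.Q (i * c + j) = q i j) (hf : ∀ j < c, r.a j = f j)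
    (hb : ∀ i < c, ∀ k ≤ c, (mulVecN k q f i).natAbs ≤ M) :
    Exec M K .matvec r.state { r with w := fill c (mulVecN c q f) r.w }.state := by
  have := Exec.for hM Regs.set_i
    (fun k => { r with w := fill k (mulVecN c q f) r.w }) hcK
    (fun _ => hi) (N := .c) (fun _ _ => hc)
    (p := .seq (.loop 9 .c (.assign 7 (.s + .Q (.i * .c + .j) * .a .j)))
      (.seq (.store 4 .i .s) (.assign 7 0)))
    fun k hk => by
      have h1 := Exec.for hM Regs.set_j
        (fun l => { r with w := fill k (mulVecN c q f) r.w, i := k, s := mulVecN l q f k }) hcK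
        (fun _ => hj) (N := .c) (fun _ _ => hc)
        (p := .assign 7 (.s + .Q (.i * .c + .j) * .a .j))
        fun l hl => by
          refine .set hM (Regs.set_s _ _) ?_ (hb k hk (l + 1) hl)
          simp only [Expr.eval_add, Expr.eval_mul, Regs.eval_s, Regs.eval_Q, Regs.eval_i,
            Regs.eval_c, Regs.eval_j, Regs.eval_a, hc, hq k hk l hl, hf l hl, mulVecN,
            Finset.sum_range_succ]
      -- The accumulator is zero on entry, so the initial state is the one with the empty sum.
      have h0 : mulVecN 0 q f k = r.s := by rw [hs]; rfl
      rw [h0] at h1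
      refine h1.seq ?_
      rw [← update_fill]
      refine .seq (.put hM (Regs.store_w _ _ _) rfl rfl (hb k hk c le_rfl)) ?_
      exact .set hM (Regs.set_s _ _) hs.symm (by simp [hs])
  rwa [fill_zero] at this

/-- Sets `e` to the dot product of `a` and `w`. -/
def Prog.dot : Prog := .seq (.assign 6 0) (.loop 9 .c (.assign 6 (.e + .a .j * .w .j)))

theorem Exec.dot (hM : Limits M K) {r : Regs} {c : ℕ} (hc : r.c = c) (hcK : c ≤ K)
    (hj : r.j = 0) {f g : ℕ → ℤ} (hf : ∀ j < c, r.a j = f j) (hg : ∀ j < c, r.w j = g j)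
    (hb : ∀ k ≤ c, (dotN k f g).natAbs ≤ M) :
    Exec M K .dot r.state { r with e := dotN c f g }.state := by
  refine .seq (.set hM (Regs.set_e _ 0) rfl (by simp)) ?_
  refine Exec.for hM Regs.set_j (fun k => { r with e := dotN k f g }) hcK
    (fun _ => hj) (N := .c) (fun _ _ => hc) fun k hk => ?_
  refine .set hM (Regs.set_e _ _) ?_ (hb (k + 1) hk)
  simp only [Expr.eval_add, Expr.eval_mul, Regs.eval_e, Regs.eval_w, Regs.eval_j, Regs.eval_a,
    hf k hk, hg k hk, dotN, Finset.sum_range_succ]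

/-- Eliminates the row in `a`. -/
def Prog.elimStep : Prog :=
  .seq .matvec (.seq .dot (.seq
    (.ifPos .e (.seq
      (.loop 10 (.c * .c) (.store 2 .t
        ((.e * .Q .t - .w (.t / .c) * .w (.t - .t / .c * .c)) / .d)))
      (.assign 5 .e)) .skip)
    (.assign 6 0)))

theorem Exec.elimStep (hM : Limits M K) {r : Regs} {c : ℕ} (hc : r.c = c) (hcK : c * c ≤ K)
    (hi : r.i = 0) (hj : r.j = 0) (ht : r.t = 0) (hs : r.s = 0) (he : r.e = 0)
    {q : ℕ → ℕ → ℤ} {f : ℕ → ℤ} {g : ℤ → ℤ} (hq : r.Q = flat c q g)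
    (hf : ∀ j < c, r.a j = f j)
    (hb : ∀ i < c, ∀ k ≤ c, (mulVecN k q f i).natAbs ≤ M)
    (hb' : ∀ k ≤ c, (dotN k f (mulVecN c q f)).natAbs ≤ M)
    (hb'' : ∀ i < c, ∀ j < c, ((_root_.elimStep c f (q, r.d)).1 i j).natAbs ≤ M) :
    Exec M K .elimStep r.state
      { r with
        Q := flat c (_root_.elimStep c f (q, r.d)).1 g
        d := (_root_.elimStep c f (q, r.d)).2
        w := fill c (mulVecN c q f) r.w }.state := by
  have hcK' : c ≤ K := (Nat.le_mul_self c).trans hcK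
  refine .seq (.matvec hM hc hcK' hi hj hs
    (fun i hi j hj => by rw [hq]; exact flat_apply q g hi hj) hf hb) ?_
  refine .seq (.dot (r := { r with w := fill c (mulVecN c q f) r.w }) hM hc hcK' hj hf
    (fun j hj => fill_natCast _ _ hj) hb') ?_
  refine .seq (σ' := { r with
        Q := flat c (_root_.elimStep c f (q, r.d)).1 g
        d := (_root_.elimStep c f (q, r.d)).2
        w := fill c (mulVecN c q f) r.w
        e := dotN c f (mulVecN c q f) }.state) ?_ ?_
  swap
  · exact .set hM (Regs.set_e _ _) he.symm (by simp [he])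
  by_cases hpos : 0 < dotN c f (mulVecN c q f)
  · refine .ifTrue hM.two_le hpos ?_
    have hstep : _root_.elimStep c f (q, r.d) = (fun i j =>
        (dotN c f (mulVecN c q f) * q i j - mulVecN c q f i * mulVecN c q f j) / r.d,
        dotN c f (mulVecN c q f)) := if_pos hpos
    rw [hstep] at hb'' ⊢
    -- The matrix can be overwritten in place: a new entry depends on the old entry in the same cell
    -- and on `w`, `e`, `d`, which the loop does not touch.
    have h1 := Exec.for hM Regs.set_t
      (fun k => { r with
        Q := fill k (fun p => (dotN c f (mulVecN c q f) * q (p / c) (p % c) -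
          mulVecN c q f (p / c) * mulVecN c q f (p % c)) / r.d) r.Q
        w := fill c (mulVecN c q f) r.w
        e := dotN c f (mulVecN c q f) }) hcK
      (fun _ => ht) (N := .c * .c) (fun _ _ => by simp [hc])
      (p := .store 2 .t ((.e * .Q .t - .w (.t / .c) * .w (.t - .t / .c * .c)) / .d))
      fun k hk => by
        have hc0 : 0 < c := Nat.pos_of_ne_zero (by rintro rfl; simp at hk)
        have h1 : k / c < c := Nat.div_lt_of_lt_mul hk
        have h2 : k % c < c := Nat.mod_lt _ hc0
        rw [← update_fill]
        refine .put hM (Regs.store_Q _ _ _) rfl ?_ (hb'' _ h1 _ h2)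
        simp only [Expr.eval_sub, Expr.eval_div, Expr.eval_mul, Regs.eval_t, Regs.eval_c, hc,
          Regs.eval_e, Regs.eval_Q, Regs.eval_w, Regs.eval_d, natCast_sub_div_mul]
        simp only [← Int.natCast_div, fill_natCast _ _ h1, fill_natCast _ _ h2,
          fill_natCast_of_le _ _ le_rfl]
        rw [hq, flat, fill_natCast _ _ hk]
    rw [fill_zero] at h1
    have h2 := h1.seq (Exec.set hM (Regs.set_d _ _) (e := .e) rfl (hb' c le_rfl))
    rw [hq, fill_flat fun i j =>
      (dotN c f (mulVecN c q f) * q i j - mulVecN c q f i * mulVecN c q f j) / r.d] at h2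
    rw [hq]
    exact h2
  · refine .ifFalse hM.two_le hpos ?_
    have hstep : _root_.elimStep c f (q, r.d) = (q, r.d) := if_neg hpos
    rw [hstep, ← hq]
    exact .skip _

/-! ### Output of fractions in lowest terms -/

/-- For `v ≤ u` the remainder satisfies `2 * (u % v) ≤ u`, so each pass at least halves the product
of the two numbers. -/
theorem exists_euclid_steps (N : ℕ) : ∀ u v : ℕ, v ≤ u → u * v < 2 ^ N →
    ∃ n ≤ N, (∀ k < n, 0 < ((fun p : ℕ × ℕ => (p.2, p.1 % p.2))^[k] (u, v)).2) ∧
      (∀ k ≤ n, ((fun p : ℕ × ℕ => (p.2, p.1 % p.2))^[k] (u, v)).1 ≤ u ∧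
        ((fun p : ℕ × ℕ => (p.2, p.1 % p.2))^[k] (u, v)).2 ≤ u) ∧
      (fun p : ℕ × ℕ => (p.2, p.1 % p.2))^[n] (u, v) = (Nat.gcd u v, 0) := by
  induction N with
  | zero =>
    intro u v hvu h
    have : v = 0 := by nlinarith
    subst this
    exact ⟨0, le_rfl, by simp, by simp, by simp⟩
  | succ N ih =>
    intro u v hvu h
    rcases Nat.eq_zero_or_pos v with rfl | hv
    · exact ⟨0, by omega, by simp, by simp, by simp⟩
    · have h1 : u % v < v := Nat.mod_lt _ hv
      have h2 : 2 * (u % v) ≤ u := by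
        have h3 := Nat.div_add_mod u v
        have h4 : 1 ≤ u / v := Nat.div_pos hvu hv
        nlinarith
      obtain ⟨n, hn, ha, hb, hc⟩ := ih v (u % v) h1.le (by rw [pow_succ] at h; nlinarith)
      refine ⟨n + 1, by omega, fun k hk => ?_, fun k hk => ?_, ?_⟩
      · cases k with
        | zero => exact hv
        | succ k => rw [Function.iterate_succ_apply]; exact ha k (by omega)
      · cases k with
        | zero => exact ⟨le_rfl, hvu⟩
        | succ k =>
          rw [Function.iterate_succ_apply]
          have := hb k (by omega)
          exact ⟨this.1.trans hvu, this.2.trans hvu⟩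
      · rw [Function.iterate_succ_apply]
        refine hc.trans ?_
        rw [Nat.gcd_comm u v, Nat.gcd_rec v u, Nat.gcd_comm v]

/-- Writes the fraction `e₁ / e₂` in lowest terms, by Euclid's algorithm. -/
def Prog.outRat (e₁ e₂ : Expr) : Prog :=
  .seq (.assign 14 e₁) (.seq (.assign 15 e₂) (.seq (.assign 11 .y) (.seq
    (.assign 12 (.x - .x / .y * .y)) (.seq
    (.whilePos .v (.seq (.assign 7 (.u - .u / .v * .v)) (.seq (.assign 11 .v) (.seq
      (.assign 12 .s) (.assign 7 0)))))
    (.seq (.write (.x / .u)) (.seq (.write (.y / .u))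
      (.seq (.assign 14 0) (.seq (.assign 15 0) (.assign 11 0)))))))))

/-- The scratch registers are zero. -/
structure Regs.Idle (r : Regs) : Prop where
  e : r.e = 0
  s : r.s = 0
  u : r.u = 0
  v : r.v = 0
  x : r.x = 0
  y : r.y = 0

theorem Exec.outRat (hM : Limits M K) {r : Regs} (hr : r.Idle) {e₁ e₂ : Expr} {N D : ℤ}
    (h₁ : e₁.eval r.state = N) (h₂ : e₂.eval { r with x := N }.state = D) (hD : 0 < D)
    (hNb : N.natAbs ≤ M) (hDb : D.natAbs ≤ M) {f : ℚ} (hf : (N : ℚ) = D * f) :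
    Exec M K (.outRat e₁ e₂) r.state { r with out := r.out ++ [f.num, (f.den : ℤ)] }.state := by
  have hfd : f = Rat.divInt N D := by
    rw [Rat.divInt_eq_div, hf]
    field_simp
  have hnum : f.num = N / (Int.gcd D N : ℤ) := by
    rw [hfd, Rat.num_divInt, Int.sign_eq_one_of_pos hD, one_mul]
  have hden : (f.den : ℤ) = D / (Int.gcd D N : ℤ) := by
    rw [hfd, Rat.den_divInt, if_neg hD.ne', Int.natCast_div, Int.natCast_natAbs,
      abs_of_pos hD]
  -- Euclid's algorithm starts from `D` and `N % D`, which are nonnegative and in order whatever the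
  -- sign of `N`.
  have hmod0 : 0 ≤ N % D := Int.emod_nonneg _ hD.ne'
  have hmodD : N % D < D := Int.emod_lt_of_pos _ hD
  obtain ⟨u, hu⟩ := Int.eq_ofNat_of_zero_le hD.le
  obtain ⟨v, hv⟩ := Int.eq_ofNat_of_zero_le hmod0
  have huM : u ≤ M := by omega
  have hvu : v ≤ u := by omega
  have hgcd : Nat.gcd u v = Int.gcd D N := by
    have h3 : Int.gcd (u : ℤ) (v : ℤ) = Nat.gcd u v := Int.gcd_natCast_natCast u v
    rw [← h3, ← hv, ← hu, Int.gcd_comm D (N % D), Int.gcd_comm D N]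
    exact Int.gcd_emod N D
  -- Both numbers are below `2 ^ Nat.size M`, so `2 * Nat.size M` passes suffice; `Limits.size_le`
  -- allows that many.
  obtain ⟨n, hn, ha, hb, hc⟩ := exists_euclid_steps (2 * Nat.size M) u v hvu (by
    have h4 := Nat.lt_size_self M
    rw [two_mul, pow_add]
    nlinarith)
  set F : ℕ → ℕ × ℕ := fun k => (fun p : ℕ × ℕ => (p.2, p.1 % p.2))^[k] (u, v) with hF
  refine .seq (.set hM (Regs.set_x _ N) h₁ hNb) ?_
  refine .seq (.set hM (Regs.set_y _ D) h₂ hDb) ?_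
  refine .seq (.set hM (Regs.set_u _ D) rfl hDb) ?_
  refine .seq (.set hM (Regs.set_v _ (N % D)) ?_ (by omega)) ?_
  · simp only [Expr.eval_sub, Expr.eval_mul, Expr.eval_div, Regs.eval_x, Regs.eval_y]
    rw [mul_comm, ← Int.emod_def]
  have hw := Exec.whilePos hM.two_le (e := .v)
    (p := .seq (.assign 7 (.u - .u / .v * .v)) (.seq (.assign 11 .v) (.seq
      (.assign 12 .s) (.assign 7 0))))
    (fun k => { r with x := N, y := D, u := (F k).1, v := (F k).2 }.state) (hn.trans hM.size_le)
    (fun k hk => by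
      change (0 : ℤ) < ((F k).2 : ℤ)
      exact_mod_cast ha k hk)
    (fun k hk => by
      have h5 := hb k hk.le
      have h6 := hb (k + 1) hk
      have hstep : F (k + 1) = ((F k).2, (F k).1 % (F k).2) := Function.iterate_succ_apply' _ _ _
      have h6' : (F (k + 1)).2 ≤ u := h6.2
      rw [hstep] at h6'
      rw [hstep]
      refine .seq (.set hM (Regs.set_s _ ((F k).1 % (F k).2 : ℕ)) ?_ ?_) ?_
      · simp only [Expr.eval_sub, Expr.eval_mul, Expr.eval_div, Regs.eval_u, Regs.eval_v,
          natCast_sub_div_mul]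
      · rw [Int.natAbs_natCast]; exact h6'.trans huM
      refine .seq (.set hM (Regs.set_u _ ((F k).2 : ℤ)) rfl (by
        rw [Int.natAbs_natCast]; exact h5.2.trans huM)) ?_
      refine .seq (.set hM (Regs.set_v _ ((F k).1 % (F k).2 : ℕ)) rfl (by
        rw [Int.natAbs_natCast]; exact h6'.trans huM)) ?_
      exact .set hM (Regs.set_s _ _) hr.s.symm (by simp [hr.s]))
    (by
      have : (F n).2 = 0 := by rw [hF]; simp only [hc]
      simp [this])
  have h7 : F 0 = (u, v) := rfl
  have h8 : F n = (Int.gcd D N, 0) := by rw [← hgcd]; exact hc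
  simp only [h7, h8, Nat.cast_zero] at hw
  rw [hv, hu]
  rw [hu] at hw
  refine hw.seq ?_
  rw [← hu]
  refine .seq (.emit hM (v := f.num) (by rw [hnum]; rfl)) ?_
  refine .seq (.emit hM (v := (f.den : ℤ)) (by rw [hden]; rfl)) ?_
  have hx := hr.x
  refine .seq (.set hM (Regs.set_x _ r.x) hr.x.symm (by simp [hr.x])) ?_
  refine .seq (.set hM (Regs.set_y _ r.y) hr.y.symm (by simp [hr.y])) ?_
  have := Exec.set (K := K) hM (e := 0) (Regs.set_u { r with
    out := r.out ++ [f.num] ++ [(f.den : ℤ)], u := (Int.gcd D N : ℤ), v := 0 } r.u) hr.u.symm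
    (by simp [hr.u])
  rw [List.append_assoc] at this
  rw [List.append_assoc]
  have h0 : (0 : ℤ) = r.v := hr.v.symm
  simp only [h0] at this ⊢
  exact this

end RAM

namespace RAM

variable {M K : ℕ}

/-! ## Elimination -/

/-- `B` bounds all numbers in the elimination of `N` rows of `c` numbers of size at most `E`. -/
structure ElimBound (c E N : ℕ) (R : ℕ → ℕ → ℤ) (B : ℕ) : Prop where
  one_le : 1 ≤ E
  le : ∀ i < N, ∀ j < c, (R i j).natAbs ≤ E
  pow_le : ((c + 1) * E) ^ (2 * N + 2) ≤ B

namespace ElimBound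

variable {c E N B : ℕ} {R : ℕ → ℕ → ℤ} (h : ElimBound c E N R B)
include h

/-- Two factors beyond the bound on the denominator leave room for the partial sums of `Q a` and `a
· Q a`. -/
theorem pow_mul_le {k : ℕ} (hk : k ≤ N) :
    ((c + 1) * E) * (((c + 1) * E) * ((c + 1) * E) ^ (2 * k)) ≤ B := by
  refine le_trans ?_ h.pow_le
  have := h.one_le
  rw [← mul_assoc, ← sq, ← pow_add]
  exact Nat.pow_le_pow_right (Nat.mul_pos (by omega) this) (by omega)

theorem snd_le {k : ℕ} (hk : k ≤ N) : (elim c R k).2.natAbs ≤ B := by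
  refine (natAbs_elim_snd_le h.one_le h.le k hk).trans (le_trans ?_ (h.pow_mul_le hk))
  have h1 : 1 ≤ (c + 1) * E := Nat.mul_pos (by omega) h.one_le
  rw [← mul_assoc]
  exact Nat.le_mul_of_pos_left _ (Nat.mul_pos h1 h1)

theorem fst_le {k : ℕ} (hk : k ≤ N) {i j : ℕ} (hi : i < c) (hj : j < c) :
    ((elim c R k).1 i j).natAbs ≤ B := (natAbs_elim_le k hi hj).trans (h.snd_le hk)

theorem mulVecN_le' {k : ℕ} (hk : k ≤ N) {f : ℕ → ℤ} (hf : ∀ j < c, (f j).natAbs ≤ E)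
    {l : ℕ} (hl : l ≤ c) {i : ℕ} (hi : i < c) :
    (mulVecN l (elim c R k).1 f i).natAbs ≤ c * (((c + 1) * E) ^ (2 * k) * E) :=
  natAbs_dotN_le (a := (elim c R k).1 i) hl
    (fun _ hj => (natAbs_elim_le k hi hj).trans (natAbs_elim_snd_le h.one_le h.le k hk)) hf

theorem mulVecN_le {k : ℕ} (hk : k ≤ N) {f : ℕ → ℤ} (hf : ∀ j < c, (f j).natAbs ≤ E)
    {l : ℕ} (hl : l ≤ c) {i : ℕ} (hi : i < c) :
    (mulVecN l (elim c R k).1 f i).natAbs ≤ B := by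
  refine (h.mulVecN_le' hk hf hl hi).trans (le_trans ?_ (h.pow_mul_le hk))
  have h1 : 1 ≤ (c + 1) * E := Nat.mul_pos (by omega) h.one_le
  calc c * (((c + 1) * E) ^ (2 * k) * E) = 1 * ((c * E) * ((c + 1) * E) ^ (2 * k)) := by ring
    _ ≤ _ := by gcongr; omega

theorem dotN_le {k : ℕ} (hk : k ≤ N) {f : ℕ → ℤ} (hf : ∀ j < c, (f j).natAbs ≤ E)
    {l : ℕ} (hl : l ≤ c) :
    (dotN l f (mulVecN c (elim c R k).1 f)).natAbs ≤ B := by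
  refine (natAbs_dotN_le hl hf fun i hi => h.mulVecN_le' hk hf le_rfl hi).trans
    (le_trans ?_ (h.pow_mul_le hk))
  calc c * (E * (c * (((c + 1) * E) ^ (2 * k) * E)))
      = (c * E) * ((c * E) * ((c + 1) * E) ^ (2 * k)) := by ring
    _ ≤ _ := by gcongr <;> omega

end ElimBound

/-- The loop counters of the inner loops are zero. -/
structure Regs.Clean (r : Regs) : Prop extends r.Idle where
  i : r.i = 0
  j : r.j = 0
  t : r.t = 0

theorem Exec.elimStep_elim (hM : Limits M K) {r : Regs} (hr : r.Clean) {c E N k : ℕ}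
    {R : ℕ → ℕ → ℤ} (hR : ElimBound c E N R M) (hk : k < N) (hc : r.c = c) (hcK : c * c ≤ K)
    {g a : ℤ → ℤ} (hQ : r.Q = flat c (elim c R k).1 g) (hd : r.d = (elim c R k).2)
    (ha : r.a = fill c (R k) a) :
    Exec M K .elimStep r.state
      { r with
        Q := flat c (elim c R (k + 1)).1 g
        d := (elim c R (k + 1)).2
        w := fill c (mulVecN c (elim c R k).1 (R k)) r.w }.state := by
  have he : elim c R (k + 1) = _root_.elimStep c (R k) ((elim c R k).1, r.d) := by rw [hd]; rfl
  have hRk := hR.le k hk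
  rw [he]
  refine .elimStep hM hc hcK hr.i hr.j hr.t hr.s hr.e hQ
    (fun j hj => by rw [ha, fill_natCast _ _ hj])
    (fun i hi l hl => hR.mulVecN_le hk.le hRk hl hi) (fun l hl => hR.dotN_le hk.le hRk hl) ?_
  rw [← he]
  exact fun i hi j hj => hR.fst_le (k := k + 1) hk hi hj

/-- Eliminates `N` rows, loading row `k` into `a`. -/
def Prog.elim (N : Expr) (load : Prog) : Prog := .seq .initQ (.loop 16 N (.seq load .elimStep))

/-- The contents of an array that is overwritten in each pass. -/
def overwrite (c : ℕ) (f : ℕ → ℕ → ℤ) (g : ℤ → ℤ) : ℕ → ℤ → ℤ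
  | 0 => g
  | k + 1 => fill c (f k) (overwrite c f g k)

/-- `hload` allows arbitrary contents of `Q`, `d`, `a`, `w`, since these change from pass to pass.
The final contents of `a` and `w` are scratch and stay existential. -/
theorem Exec.elim (hM : Limits M K) {r : Regs} (hr : r.Clean) (hrk : r.k = 0) {c E n N : ℕ}
    {R : ℕ → ℕ → ℤ} (hR : ElimBound c E N R M) (hn : n ≤ N) (hnK : n ≤ K) (hc : r.c = c)
    (hcK : c * c ≤ K) {len : Expr} {load : Prog}
    (hlen : ∀ (k : ℤ) (Q : ℤ → ℤ) (d : ℤ) (a w : ℤ → ℤ),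
      len.eval { r with Q := Q, d := d, a := a, w := w, k := k }.state = n)
    (hload : ∀ k < n, ∀ (Q : ℤ → ℤ) (d : ℤ) (a w : ℤ → ℤ),
      Exec M K load { r with Q := Q, d := d, a := a, w := w, k := k }.state
        { r with Q := Q, d := d, a := fill c (R k) a, w := w, k := k }.state) :
    ∃ a w, Exec M K (.elim len load) r.state
      { r with
        Q := flat c (_root_.elim c R n).1 r.Q
        d := (_root_.elim c R n).2
        a := a
        w := w }.state := by
  refine ⟨overwrite c R r.a n,
    overwrite c (fun k => mulVecN c (_root_.elim c R k).1 (R k)) r.w n,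
    (Exec.initQ hM hc hcK hr.t R).seq ?_⟩
  refine Exec.for hM Regs.set_k (fun k => { r with
        Q := flat c (_root_.elim c R k).1 r.Q
        d := (_root_.elim c R k).2
        a := overwrite c R r.a k
        w := overwrite c (fun k => mulVecN c (_root_.elim c R k).1 (R k)) r.w k }) hnK
    (fun _ => hrk) (fun k hk => hlen _ _ _ _ _) fun k hk => ?_
  refine (hload k hk _ _ _ _).seq ?_
  exact Exec.elimStep_elim (r := { r with
      Q := flat c (_root_.elim c R k).1 r.Q
      d := (_root_.elim c R k).2
      a := fill c (R k) (overwrite c R r.a k)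
      w := overwrite c (fun k => mulVecN c (_root_.elim c R k).1 (R k)) r.w k
      k := k }) hM ⟨⟨hr.e, hr.s, hr.u, hr.v, hr.x, hr.y⟩, hr.i, hr.j, hr.t⟩ hR (by omega) hc hcK
    rfl rfl rfl

/-- Loads `N` numbers into `a`. -/
def Prog.loadVec (N e : Expr) : Prog := .loop 9 N (.store 3 .j e)

theorem Exec.loadVec (hM : Limits M K) {r : Regs} (hj : r.j = 0) {n : ℕ} (hn : n ≤ K)
    {N e : Expr} {f : ℕ → ℤ}
    (hN : ∀ (j : ℤ) (a : ℤ → ℤ), N.eval { r with j := j, a := a }.state = n)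
    (he : ∀ j < n, ∀ a : ℤ → ℤ, e.eval { r with j := j, a := a }.state = f j)
    (hf : ∀ j < n, (f j).natAbs ≤ M) :
    Exec M K (.loadVec N e) r.state { r with a := fill n f r.a }.state := by
  have := Exec.for hM Regs.set_j (fun k => { r with a := fill k f r.a }) hn (fun _ => hj) (N := N)
    (fun _ _ => hN _ _) (p := .store 3 .j e) fun k hk => by
      rw [← update_fill]
      exact .put hM (Regs.store_a _ _ _) rfl (he k hk _) (hf k hk)
  rwa [fill_zero] at this

/-- Loads a row of an augmented matrix with `n + 1` columns. -/
def Prog.loadRow (e e' : Expr) : Prog := .seq (.loadVec .n e) (.store 3 .n e')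

theorem Exec.loadRow (hM : Limits M K) {r : Regs} (hj : r.j = 0) {n : ℕ} (hn : n ≤ K)
    (hrn : r.n = n) {e e' : Expr} {f : ℕ → ℤ}
    (he : ∀ j < n, ∀ a : ℤ → ℤ, e.eval { r with j := j, a := a }.state = f j)
    (he' : ∀ a : ℤ → ℤ, e'.eval { r with a := a }.state = f n)
    (hf : ∀ j < n + 1, (f j).natAbs ≤ M) :
    Exec M K (.loadRow e e') r.state { r with a := fill (n + 1) f r.a }.state := by
  refine (Exec.loadVec hM hj hn (N := .n) (fun _ _ => hrn) he fun j hj => hf j (by omega)).seq ?_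
  rw [← update_fill]
  exact .put hM (Regs.store_a _ _ _) hrn (he' _) (hf n (by omega))

/-! ## Solving a linear system -/

/-- Projects onto the null space of the augmented matrix with the entries `e`, `e'`, and splits off the
solution that belongs to the last column. -/
def Prog.solve (e e' : Expr) : Prog :=
  .seq (.assign 4 (.n + 1)) (.seq (.elim .m (.loadRow e e')) (.seq (.loadRow 0 1) .elimStep))

/-- The rows of the augmented matrix, followed by the last unit vector. -/
def unitRow (m n : ℕ) (f : ℕ → ℕ → ℤ) (i j : ℕ) : ℤ :=
  if i = m then if j = n then 1 else 0 else f i j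

/-- The rows of `(D | s)` are followed by the last unit vector. The last step computes `Q a` into
`w`, which is the last column of the projection for `(D | s)`, and then turns the leading block of
`Q` into the projection for `D`; both have the final `d` as denominator. -/
theorem Exec.solve (hM : Limits M K) {r : Regs} (hr : r.Clean) (hrk : r.k = 0) {m n E : ℕ}
    (hm : r.m = m) (hn : r.n = n) (hmK : m ≤ K) (hnK : (n + 1) * (n + 1) ≤ K) (hE : 1 ≤ E)
    (hEM : ((n + 2) * E) ^ (2 * m + 4) ≤ M) {f : ℕ → ℕ → ℤ} {e e' : Expr}
    (he : ∀ i < m, ∀ j < n, ∀ (c : ℤ) (Q : ℤ → ℤ) (d : ℤ) (a w : ℤ → ℤ), e.eval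
      { r with c := c, Q := Q, d := d, a := a, w := w, k := i, j := j }.state = f i j)
    (he' : ∀ i < m, ∀ (c : ℤ) (Q : ℤ → ℤ) (d : ℤ) (a w : ℤ → ℤ), e'.eval
      { r with c := c, Q := Q, d := d, a := a, w := w, k := i }.state = f i n)
    (hf : ∀ i < m, ∀ j < n + 1, (f i j).natAbs ≤ E) {D : Matrix (Fin m) (Fin n) ℚ}
    {s : Fin m → ℚ} {L : ℚ} (hL : L ≠ 0)
    (hD : ∀ (i : Fin m) (j : Fin n), (f i j : ℚ) = L * D i j)
    (hs : ∀ i : Fin m, (f i n : ℚ) = L * s i) (hsol : ∃ v, D *ᵥ v = s) :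
    ∃ (R : ℕ → ℕ → ℤ) (g a w : ℤ → ℤ), Exec M K (.solve e e') r.state
      { r with
        c := n + 1
        Q := flat (n + 1) (_root_.elim (n + 1) R (m + 1)).1 g
        d := (_root_.elim (n + 1) R (m + 1)).2
        a := a
        w := w }.state ∧
      ElimBound (n + 1) E (m + 1) R (((n + 2) * E) ^ (2 * m + 4)) ∧
      (∀ i j : Fin n, ((_root_.elim (n + 1) R (m + 1)).1 i j : ℚ) =
        (_root_.elim (n + 1) R (m + 1)).2 * nullProj D i j) ∧
      (∀ i : Fin n, (w i : ℚ) = -((_root_.elim (n + 1) R (m + 1)).2 * particular D s i)) ∧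
      (∀ i < n, (w i).natAbs ≤ ((n + 2) * E) ^ (2 * m + 4)) := by
  have hKM := hM.le
  set R := unitRow m n f with hRdef
  have hRi : ∀ i < m, R i = f i := fun i hi => by
    funext j
    rw [hRdef, unitRow, if_neg (by omega)]
  have hRm : ∀ j, R m j = if j = n then 1 else 0 := fun j => by rw [hRdef, unitRow, if_pos rfl]
  have hbd : ElimBound (n + 1) E (m + 1) R (((n + 2) * E) ^ (2 * m + 4)) := by
    refine ⟨hE, fun i hi j hj => ?_, le_rfl⟩
    rcases Nat.lt_succ_iff_lt_or_eq.1 hi with h | rfl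
    · rw [hRi i h]
      exact hf i h j hj
    · rw [hRm]
      split_ifs <;> simp
      exact hE
  have hbd' : ElimBound (n + 1) E (m + 1) R M := ⟨hE, hbd.le, hEM⟩
  have hEle : E ≤ M := by
    refine le_trans ?_ hEM
    calc E ≤ (n + 2) * E := Nat.le_mul_of_pos_left _ (by omega)
      _ ≤ _ := Nat.le_self_pow (by omega) _
  have hn1 : n ≤ K := by nlinarith
  obtain ⟨a, w, h1⟩ := Exec.elim (r := { r with c := ((n + 1 : ℕ) : ℤ) }) hM
    ⟨⟨hr.e, hr.s, hr.u, hr.v, hr.x, hr.y⟩, hr.i, hr.j, hr.t⟩ hrk hbd' (n := m) (by omega) hmK rfl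
    hnK (len := .m) (load := .loadRow e e') (fun _ _ _ _ _ => hm) (fun k hk Q d a w => by
      rw [hRi k hk]
      exact Exec.loadRow (r := { r with
        c := ((n + 1 : ℕ) : ℤ), Q := Q, d := d, a := a, w := w, k := k }) hM hr.j hn1 hn
        (fun j hj a => he k hk j hj _ _ _ _ _)
        (fun a => he' k hk _ _ _ _ _) fun j hj => (hf k hk j hj).trans hEle)
  have hs' : ∀ i : Fin m, (R i n : ℚ) = L * s i := fun i => by rw [hRi i i.2]; exact hs i
  have hD' : ∀ (i : Fin m) (j : Fin n), (R i j : ℚ) = L * D i j := fun i j => by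
    rw [hRi i i.2]; exact hD i j
  refine ⟨R, r.Q, fill (n + 1) (R m) a,
    fill (n + 1) (mulVecN (n + 1) (_root_.elim (n + 1) R m).1 (R m)) w, ?_, hbd,
    elim_unit_fst hL hD' hs' fun j _ => hRm j, fun i => ?_, fun i hi => ?_⟩
  · refine .seq (.set hM (Regs.set_c _ ((n + 1 : ℕ) : ℤ)) ?_ ?_) (h1.seq ?_)
    · simp [hn]
    · rw [Int.natAbs_natCast]
      nlinarith
    -- The constant expressions 0 and 1 load the unit vector.
    refine (Exec.loadRow (r := { r with
        c := ((n + 1 : ℕ) : ℤ)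
        Q := flat (n + 1) (_root_.elim (n + 1) R m).1 r.Q
        d := (_root_.elim (n + 1) R m).2
        a := a
        w := w }) hM hr.j hn1 hn (e := 0) (e' := 1) (f := R m) (fun j hj a => ?_)
      (fun a => ?_) fun j hj => (hbd.le m (by omega) j hj).trans hEle).seq ?_
    · rw [hRm, if_neg hj.ne]
      rfl
    · rw [hRm, if_pos rfl]
      rfl
    · exact Exec.elimStep_elim (r := { r with
        c := ((n + 1 : ℕ) : ℤ)
        Q := flat (n + 1) (_root_.elim (n + 1) R m).1 r.Q
        d := (_root_.elim (n + 1) R m).2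
        a := fill (n + 1) (R m) a
        w := w }) hM ⟨⟨hr.e, hr.s, hr.u, hr.v, hr.x, hr.y⟩, hr.i, hr.j, hr.t⟩ hbd' (by omega)
        rfl hnK rfl rfl rfl
  · rw [fill_natCast _ _ (by omega)]
    exact mulVecN_elim_unit hsol hL hD' hs' (fun j _ => hRm j) i
  · rw [fill_natCast _ _ (by omega)]
    exact hbd.mulVecN_le (by omega) (hbd.le m (by omega)) le_rfl (by omega)

/-! ## Output of lists of fractions -/

/-- Writes `N` fractions. -/
def Prog.outRats (N e₁ e₂ : Expr) : Prog := .loop 16 N (.outRat e₁ e₂)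

theorem encRats_append (l l' : List ℚ) : encRats (l ++ l') = encRats l ++ encRats l' :=
  List.flatMap_append

theorem Exec.outRats (hM : Limits M K) {r : Regs} (hr : r.Idle) (hk : r.k = 0) {n : ℕ}
    (hn : n ≤ K) {N e₁ e₂ : Expr} {f : Fin n → ℚ} {p q : Fin n → ℤ}
    (hN : ∀ (k : ℤ) (out : List ℤ), N.eval { r with k := k, out := out }.state = n)
    (he₁ : ∀ (k : Fin n) (out : List ℤ),
      e₁.eval { r with k := (k : ℕ), out := out }.state = p k)
    (he₂ : ∀ (k : Fin n) (x : ℤ) (out : List ℤ),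
      e₂.eval { r with k := (k : ℕ), x := x, out := out }.state = q k)
    (hq : ∀ k, 0 < q k) (hpM : ∀ k, (p k).natAbs ≤ M) (hqM : ∀ k, (q k).natAbs ≤ M)
    (hf : ∀ k, (p k : ℚ) = q k * f k) :
    Exec M K (.outRats N e₁ e₂) r.state
      { r with out := r.out ++ encRats (List.ofFn f) }.state := by
  have := Exec.for hM Regs.set_k
    (fun k => { r with out := r.out ++ encRats ((List.ofFn f).take k) }) hn (fun _ => hk) (N := N)
    (fun _ _ => hN _ _) (p := .outRat e₁ e₂) fun k hk => by
      have := Exec.outRat (K := K)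
        (r := { r with k := k, out := r.out ++ encRats ((List.ofFn f).take k) }) hM
        ⟨hr.e, hr.s, hr.u, hr.v, hr.x, hr.y⟩ (he₁ ⟨k, hk⟩ _) (he₂ ⟨k, hk⟩ _ _) (hq ⟨k, hk⟩)
        (hpM _) (hqM _) (hf ⟨k, hk⟩)
      have hl : k < (List.ofFn f).length := by simpa using hk
      rw [List.take_succ_eq_append_getElem hl, encRats_append, ← List.append_assoc]
      simp only [List.getElem_ofFn]
      exact this
  have h0 : (List.ofFn f).take n = List.ofFn f := List.take_of_length_le (by simp)
  have h1 : encRats [] = [] := rfl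
  rw [h0, List.take_zero, h1, List.append_nil] at this
  exact this

end RAM

namespace RAM

variable {M K : ℕ}

/-! ## Input words -/

/-- The letters at `p` and `p + 1` are the numerator and the denominator of `q`. -/
structure FracAt (ws : List ℤ) (p : ℕ) (q : ℚ) : Prop where
  num : ws.getD p 0 = q.num
  den : ws.getD (p + 1) 0 = q.den
  lt : p + 1 < ws.length

theorem fracAt_encRats (u v : List ℤ) (l : List ℚ) {i : ℕ} (hi : i < l.length) :
    FracAt (u ++ encRats l ++ v) (u.length + 2 * i) l[i] := by
  have h1 : encRats l =
      encRats (l.take i) ++ (l[i].num :: (l[i].den : ℤ) :: encRats (l.drop (i + 1))) := by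
    conv_lhs => rw [← List.take_append_drop i l, List.drop_eq_getElem_cons hi, encRats_append]
    rfl
  have h2 : (u ++ encRats (l.take i)).length = u.length + 2 * i := by
    rw [List.length_append, length_encRats, List.length_take, min_eq_left hi.le]
  have h3 : u ++ encRats l ++ v = (u ++ encRats (l.take i)) ++
      (l[i].num :: (l[i].den : ℤ) :: (encRats (l.drop (i + 1)) ++ v)) := by
    rw [h1]
    simp only [List.append_assoc, List.cons_append]
  rw [h3, ← h2]
  refine ⟨?_, ?_, ?_⟩
  · rw [List.getD_append_right _ _ _ _ le_rfl, Nat.sub_self]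
    rfl
  · rw [List.getD_append_right _ _ _ _ (by omega), Nat.add_sub_cancel_left]
    rfl
  · simp only [List.length_append, List.length_cons]
    omega

theorem flatten_ofFn {m n : ℕ} (A : Matrix (Fin m) (Fin n) ℚ) :
    (List.ofFn fun i => List.ofFn fun j => A i j).flatten =
      List.ofFn fun t : Fin (m * n) => A t.divNat t.modNat := by
  rw [List.ofFn_mul]
  congr 2
  funext i
  congr 1
  funext j
  have hn : 0 < n := j.pos
  congr 1
  · ext
    simp only [Fin.coe_divNat]
    rw [mul_comm, Nat.mul_add_div hn, Nat.div_eq_of_lt j.2, add_zero]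
  · ext
    simp only [Fin.coe_modNat]
    rw [mul_comm, Nat.mul_add_mod, Nat.mod_eq_of_lt j.2]

/-- A word contains the code of `⟨D, s⟩` at address `o`. -/
structure SystemAt (ws : List ℤ) (o : ℕ) {m n : ℕ} (D : Matrix (Fin m) (Fin n) ℚ)
    (s : Fin m → ℚ) : Prop where
  rows : ws.getD o 0 = m
  cols : ws.getD (o + 1) 0 = n
  mat : ∀ (i : Fin m) (j : Fin n), FracAt ws (o + 2 + m + n + 2 * (i * n + j)) (D i j)
  vec : ∀ i : Fin m, FracAt ws (o + 2 + m + n + 2 * (m * n + i)) (s i)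
  le : o + 2 + m + n ≤ ws.length

/-- After the two dimensions and `m + n` padding letters, matrix and vector form one list of
fractions, with two letters each: entry `(i, j)` has index `i * n + j`, and entry `i` of the vector
has index `m * n + i`. -/
theorem systemAt_append (u v : List ℤ) {m n : ℕ} (D : Matrix (Fin m) (Fin n) ℚ)
    (s : Fin m → ℚ) : SystemAt (u ++ encSystem D s ++ v) u.length D s := by
  set l := List.ofFn (fun t : Fin (m * n) => D t.divNat t.modNat) ++ List.ofFn s with hl
  have hlen : l.length = m * n + m := by simp [hl]
  have h1 : u ++ encSystem D s ++ v =
      (u ++ ((m : ℤ) :: (n : ℤ) :: List.replicate (m + n) 0)) ++ encRats l ++ v := by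
    rw [encSystem, encMat, flatten_ofFn, hl, encRats_append]
    simp only [List.append_assoc, List.cons_append]
  have h2 : (u ++ ((m : ℤ) :: (n : ℤ) :: List.replicate (m + n) 0)).length =
      u.length + 2 + m + n := by
    simp
    omega
  refine ⟨?_, ?_, fun i j => ?_, fun i => ?_, ?_⟩
  · rw [h1, List.append_assoc, List.append_assoc, List.getD_append_right _ _ _ _ le_rfl,
      Nat.sub_self]
    rfl
  · rw [h1, List.append_assoc, List.append_assoc, List.getD_append_right _ _ _ _ (by omega),
      Nat.add_sub_cancel_left]
    rfl
  · have hij : (i : ℕ) * n + j < m * n := by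
      have h3 := i.2
      have h4 := j.2
      nlinarith
    have hn : 0 < n := j.pos
    have h3 := fracAt_encRats (u ++ ((m : ℤ) :: (n : ℤ) :: List.replicate (m + n) 0)) v l
      (i := i * n + j) (by omega)
    rw [h1, ← h2]
    convert h3 using 1
    rw [List.getElem_of_eq hl, List.getElem_append_left (by simpa using hij), List.getElem_ofFn]
    congr 1
    · ext
      simp only [Fin.coe_divNat]
      rw [mul_comm, Nat.mul_add_div hn, Nat.div_eq_of_lt j.2, add_zero]
    · ext
      simp only [Fin.coe_modNat]
      rw [mul_comm, Nat.mul_add_mod, Nat.mod_eq_of_lt j.2]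
  · have h3 := fracAt_encRats (u ++ ((m : ℤ) :: (n : ℤ) :: List.replicate (m + n) 0)) v l
      (i := m * n + i) (by omega)
    rw [h1, ← h2]
    convert h3 using 1
    rw [List.getElem_of_eq hl, List.getElem_append_right (by simp), List.getElem_ofFn]
    congr 1
    ext
    simp
  · rw [h1, List.length_append, List.length_append, h2]
    omega

theorem systemAt_encSystem {m n : ℕ} (D : Matrix (Fin m) (Fin n) ℚ) (s : Fin m → ℚ) :
    SystemAt (encSystem D s) 0 D s := by
  simpa using systemAt_append [] [] D s

theorem length_encSystem {m n : ℕ} (D : Matrix (Fin m) (Fin n) ℚ) (s : Fin m → ℚ) :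
    (encSystem D s).length = 2 + m + n + 2 * (m * n + m) := by
  rw [encSystem, List.length_append, length_encMat, length_encRats, List.length_ofFn]
  ring

theorem systemAt_encPair {m n : ℕ} (D : Matrix (Fin m) (Fin n) ℚ) (s : Fin m → ℚ)
    (v : List ℤ) : SystemAt (encPair (encSystem D s) v) 1 D s :=
  systemAt_append [((encSystem D s).length : ℤ)] v D s

/-- The first 1 in the address is the length prefix of the pair, the second the length prefix of the
vector. -/
theorem fracAt_encPair {m n k : ℕ} (D : Matrix (Fin m) (Fin n) ℚ) (s : Fin m → ℚ)
    (x : Fin k → ℚ) (i : Fin k) : FracAt (encPair (encSystem D s) (encVec x))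
      (1 + 2 + m + n + 2 * (m * n + m) + 1 + 2 * i) (x i) := by
  have h := fracAt_encRats (((encSystem D s).length : ℤ) :: (encSystem D s ++ [(k : ℤ)])) []
    (List.ofFn x) (i := i) (by simp)
  have h1 : (((encSystem D s).length : ℤ) :: (encSystem D s ++ [(k : ℤ)])).length =
      1 + 2 + m + n + 2 * (m * n + m) + 1 := by
    simp only [List.length_cons, List.length_append, length_encSystem, List.length_nil]
    omega
  rw [h1, List.getElem_ofFn] at h
  convert h using 1
  simp [encPair, encVec]

/-! ## Sizes -/

theorem sum_bitLen_getD (ws : List ℤ) :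
    ∑ i ∈ Finset.range ws.length, bitLen (ws.getD i 0) = wordSize ws := by
  induction ws with
  | nil => rfl
  | cons z ws ih =>
    rw [List.length_cons, Finset.sum_range_succ']
    simp only [List.getD_cons_succ, List.getD_cons_zero, ih]
    simp [wordSize, add_comm]

theorem length_le_wordSize (ws : List ℤ) : ws.length ≤ wordSize ws := by
  induction ws with
  | nil => rfl
  | cons z ws ih =>
    simp only [wordSize, List.length_cons, List.map_cons, List.sum_cons, bitLen] at *
    omega

theorem natAbs_lt_two_pow_bitLen (z : ℤ) : z.natAbs < 2 ^ bitLen z := by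
  have := Nat.lt_size_self z.natAbs
  rw [bitLen, pow_succ]
  omega

theorem natAbs_getD_le (ws : List ℤ) (i : ℕ) : (ws.getD i 0).natAbs ≤ 2 ^ wordSize ws := by
  by_cases hi : i < ws.length
  · refine (natAbs_lt_two_pow_bitLen _).le.trans (Nat.pow_le_pow_right (by norm_num) ?_)
    rw [← sum_bitLen_getD]
    exact Finset.single_le_sum (f := fun i => bitLen (ws.getD i 0)) (fun _ _ => Nat.zero_le _)
      (Finset.mem_range.2 hi)
  · rw [List.getD_eq_default _ _ (by omega)]
    simp

/-- A product has at most as many bits as its factors together, so the common multiple `L` is no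
longer than the input. -/
theorem natAbs_posProd_le (f : ℕ → ℤ) (k : ℕ) :
    (posProd f k).natAbs ≤ 2 ^ ∑ i ∈ Finset.range k, bitLen (f i) := by
  induction k with
  | zero => simp [posProd]
  | succ k ih =>
    rw [posProd, Finset.prod_range_succ, Finset.sum_range_succ, pow_add, Int.natAbs_mul]
    refine Nat.mul_le_mul ih ?_
    split_ifs
    · exact (natAbs_lt_two_pow_bitLen _).le
    · exact Nat.one_le_two_pow

theorem posProd_pos (f : ℕ → ℤ) (k : ℕ) : 0 < posProd f k :=
  Finset.prod_pos fun i _ => by split_ifs <;> omega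

/-- A bound for the registers on inputs of size `W`. -/
def regBound (W : ℕ) : ℕ := 2 ^ (6 * W ^ 2 + 3 * W + 3)

/-- A bound for the number of passes through a loop on inputs of size `W`. -/
def passBound (W : ℕ) : ℕ := 2 * (6 * W ^ 2 + 3 * W + 3) + 2

theorem size_regBound (W : ℕ) : Nat.size (regBound W) = 6 * W ^ 2 + 3 * W + 4 := Nat.size_pow

theorem limits (W : ℕ) : Limits (regBound W) (passBound W) where
  two_le := Nat.le_self_pow (by omega) 2
  le := by
    rw [passBound, regBound]
    -- What is needed is `2 * X + 2 ≤ 2 ^ X`, with equality at `X = 3`.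
    generalize h : 6 * W ^ 2 + 3 * W + 3 = X
    have hX : 3 ≤ X := by omega
    clear h
    induction X, hX using Nat.le_induction with
    | base => norm_num
    | succ X _ ih => rw [pow_succ]; omega
  size_le := by
    rw [size_regBound, passBound]
    omega

theorem two_pow_le_regBound {W e : ℕ} (h : e ≤ 6 * W ^ 2 + 3 * W + 3) : 2 ^ e ≤ regBound W :=
  Nat.pow_le_pow_right (by norm_num) h

theorem le_regBound {W k : ℕ} (h : k ≤ W + 1) : k ≤ regBound W :=
  h.trans (Nat.lt_two_pow_self.le.trans (two_pow_le_regBound (by nlinarith)))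

/-- Bounds the numbers in an elimination with at most `W` rows and columns. -/
theorem elim_bound {W c N : ℕ} (hc : c + 1 ≤ W) (hN : 2 * N + 2 ≤ 2 * W) :
    ((c + 1) * 2 ^ (2 * W + 1)) ^ (2 * N + 2) * 2 ^ (W + 1) ≤ regBound W := by
  -- Scaled entries are at most `2 ^ (2 * W + 1)`, allowing for a difference of two of them. The
  -- spare factor `2 ^ (W + 1)` pays for a multiplication by `L` and one subtraction.
  have h1 : (c + 1) * 2 ^ (2 * W + 1) ≤ 2 ^ (3 * W + 1) := by
    have : c + 1 ≤ 2 ^ W := hc.trans Nat.lt_two_pow_self.le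
    calc (c + 1) * 2 ^ (2 * W + 1) ≤ 2 ^ W * 2 ^ (2 * W + 1) := by gcongr
      _ = 2 ^ (3 * W + 1) := by rw [← pow_add]; congr 1; ring
  calc ((c + 1) * 2 ^ (2 * W + 1)) ^ (2 * N + 2) * 2 ^ (W + 1)
      ≤ (2 ^ (3 * W + 1)) ^ (2 * W) * 2 ^ (W + 1) := by
        refine Nat.mul_le_mul_right _ ((Nat.pow_le_pow_left h1 _).trans ?_)
        exact Nat.pow_le_pow_right Nat.one_le_two_pow hN
    _ = 2 ^ ((3 * W + 1) * (2 * W) + (W + 1)) := by rw [← pow_mul, ← pow_add]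
    _ ≤ _ := two_pow_le_regBound (by nlinarith)

/-! ## Reading the input -/

/-- The initial contents of the registers. -/
def Regs.init (ws : List ℤ) : Regs where
  len := ws.length
  L := 0
  m := 0
  n := 0
  c := 0
  d := 0
  e := 0
  s := 0
  i := 0
  j := 0
  t := 0
  u := 0
  v := 0
  b := 0
  x := 0
  y := 0
  k := 0
  inp i := if 0 ≤ i then ws.getD i.toNat 0 else 0
  S _ := 0
  Q _ := 0
  a _ := 0
  w _ := 0
  z _ := 0
  out := []

theorem init_eq (ws : List ℤ) : init ws = (Regs.init ws).state := by
  have hv : (init ws).var = (Regs.init ws).varAt := by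
    funext x
    cases x with
    | zero => rfl
    | succ x =>
      simp only [init, Regs.init, Regs.varAt]
      rw [if_neg (by omega)]
      split <;> first | rfl | omega
  have ha : (init ws).arr = (Regs.init ws).arrAt := by
    funext a i
    cases a with
    | zero => simp [init, Regs.init, Regs.arrAt]
    | succ a =>
      simp only [init, Regs.init, Regs.arrAt]
      rw [if_neg (by omega)]
      obtain _ | _ | _ | _ | _ | a := a <;> rfl
  rw [Regs.state, ← hv, ← ha]
  rfl

theorem bdd_init (ws : List ℤ) : (init ws).Bdd (regBound (wordSize ws)) := by
  refine ⟨fun x => ?_, fun a i => ?_⟩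
  · simp only [init]
    split_ifs
    · rw [Int.natAbs_natCast]
      exact le_regBound ((length_le_wordSize ws).trans (by omega))
    · simp
  · simp only [init]
    split_ifs
    · exact (natAbs_getD_le _ _).trans (two_pow_le_regBound (by nlinarith))
    · simp

/-- The dimensions and the scaled entries of the input `ws` of size `W` have been read. -/
structure Loaded (ws : List ℤ) (o m n : ℕ) (r : Regs) : Prop extends r.Clean where
  k_eq : r.k = 0
  rows : r.m = m
  cols : r.n = n
  base : r.b = (o + 2 + m + n : ℕ)
  L_pos : 0 < r.L
  L_le : r.L.natAbs ≤ 2 ^ wordSize ws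
  scaled : ∀ p q, FracAt ws p q → (r.S p : ℚ) = r.L * q
  scaled_le : ∀ p q, FracAt ws p q → (r.S p).natAbs ≤ 2 ^ (2 * wordSize ws)
  out : r.out = []

/-- Reads the instance encoded at address `o` of the input. -/
def Prog.read (o : Expr) : Prog :=
  .seq (.assign 2 (.inp o)) (.seq (.assign 3 (.inp (o + 1))) (.seq (.assign 13 (o + 2 + .m + .n))
    (.seq .posProd .scale)))

theorem exec_read {ws : List ℤ} {o m n : ℕ} {D : Matrix (Fin m) (Fin n) ℚ} {s : Fin m → ℚ}
    (h : SystemAt ws o D s) {e : Expr} (he : ∀ σ, e.eval σ = o) :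
    ∃ r, Exec (regBound (wordSize ws)) (passBound (wordSize ws)) (.read e) (init ws) r.state ∧
      Loaded ws o m n r := by
  have hM := limits (wordSize ws)
  have hlen := length_le_wordSize ws
  have hle := h.le
  have hinp : ∀ k : ℕ, (Regs.init ws).inp k = ws.getD k 0 := fun k => by simp [Regs.init]
  have hinp' : ∀ k : ℕ, (Regs.init ws).inp (k + 1) = ws.getD (k + 1) 0 := fun k => by
    rw [← hinp]; rfl
  have hlenK : ws.length ≤ passBound (wordSize ws) := by rw [passBound]; omega
  set L := posProd (fun i => ws.getD i 0) ws.length with hL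
  have hLle : L.natAbs ≤ 2 ^ wordSize ws := by
    rw [← sum_bitLen_getD]
    exact natAbs_posProd_le _ _
  -- Every letter is scaled by its successor as if it were a numerator; only the results at true
  -- numerators are used, but all of them must obey the bound.
  have hS : ∀ k, (ws.getD k 0 * (L / ws.getD (k + 1) 0)).natAbs ≤ 2 ^ (2 * wordSize ws) := by
    intro k
    rw [Int.natAbs_mul, two_mul, pow_add]
    exact Nat.mul_le_mul (natAbs_getD_le _ _) ((Int.natAbs_ediv_le_natAbs _ _).trans hLle)
  have hp := Exec.posProd (r := { Regs.init ws with
    m := (m : ℤ), n := (n : ℤ), b := ((o + 2 + m + n : ℕ) : ℤ) }) hM hlenK rfl rfl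
    (fun k hk => by
      refine (natAbs_posProd_le _ _).trans (two_pow_le_regBound ?_)
      simp only [hinp]
      have h1 : ∑ i ∈ Finset.range k, bitLen (ws.getD i 0) ≤ wordSize ws := by
        rw [← sum_bitLen_getD]
        exact Finset.sum_le_sum_of_subset (Finset.range_mono hk)
      nlinarith)
  simp only [hinp, ← hL] at hp
  have hs := Exec.scale (r := { Regs.init ws with
    m := (m : ℤ), n := (n : ℤ), b := ((o + 2 + m + n : ℕ) : ℤ), L := L }) hM hlenK rfl rfl
    (fun k hk => by
      simp only [hinp, hinp']
      exact (hS k).trans (two_pow_le_regBound (by nlinarith)))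
  simp only [hinp, hinp'] at hs
  refine ⟨{ Regs.init ws with
    m := (m : ℤ), n := (n : ℤ), b := ((o + 2 + m + n : ℕ) : ℤ), L := L
    S := fill ws.length (fun k => ws.getD k 0 * (L / ws.getD (k + 1) 0)) fun _ => 0 },
    ?_, ⟨⟨⟨rfl, rfl, rfl, rfl, rfl, rfl⟩, rfl, rfl, rfl⟩, rfl, rfl, rfl, rfl,
    posProd_pos _ _, hLle, fun p q hpq => ?_, fun p q hpq => ?_, rfl⟩⟩
  · rw [init_eq]
    refine .seq (.set hM (Regs.set_m _ (m : ℤ)) ?_ ?_) ?_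
    · rw [Regs.eval_inp, he, hinp, h.rows]
    · rw [Int.natAbs_natCast]; exact le_regBound (by omega)
    refine .seq (.set hM (Regs.set_n _ (n : ℤ)) ?_ ?_) ?_
    · rw [Regs.eval_inp, Expr.eval_add, he, Expr.eval_one]
      exact (hinp' o).trans h.cols
    · rw [Int.natAbs_natCast]; exact le_regBound (by omega)
    refine .seq (.set hM (Regs.set_b _ ((o + 2 + m + n : ℕ) : ℤ)) ?_ ?_) (hp.seq hs)
    · simp [he]
    · rw [Int.natAbs_natCast]; exact le_regBound (by omega)
  · have hlt := hpq.lt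
    change ((fill ws.length (fun k => ws.getD k 0 * (L / ws.getD (k + 1) 0)) (fun _ => 0)
      (p : ℤ) : ℤ) : ℚ) =
      (L : ℚ) * q
    rw [fill_natCast _ _ (by omega), hpq.num, hpq.den]
    -- A denominator is one of the positive letters of the input, hence a factor of `L`.
    have hdvd : (q.den : ℤ) ∣ L := by
      have h1 : (if 0 < ws.getD (p + 1) 0 then ws.getD (p + 1) 0 else 1) = (q.den : ℤ) := by
        rw [hpq.den, if_pos (by exact_mod_cast q.den_pos)]
      rw [← h1]
      exact Finset.dvd_prod_of_mem _ (Finset.mem_range.2 hlt)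
    obtain ⟨z, hz⟩ := hdvd
    rw [hz, Int.mul_ediv_cancel_left _ (by exact_mod_cast q.den_ne_zero)]
    push_cast
    rw [← Rat.mul_den_eq_num]
    ring
  · have hlt := hpq.lt
    change (fill ws.length (fun k => ws.getD k 0 * (L / ws.getD (k + 1) 0)) (fun _ => 0)
      (p : ℤ) : ℤ).natAbs ≤ _
    rw [fill_natCast _ _ (by omega)]
    exact hS p

/-! ## Output of systems and vectors -/

/-- Writes the code of a vector. -/
def Prog.outVec (N e₁ e₂ : Expr) : Prog := .seq (.write N) (.outRats N e₁ e₂)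

/-- Writes the code of a square matrix and a vector. -/
def Prog.outSystem (N e₁ e₂ e₃ e₄ : Expr) : Prog :=
  .seq (.write N) (.seq (.write N) (.seq (.loop 10 (N + N) (.write 0))
    (.seq (.outRats (N * N) e₁ e₂) (.outRats N e₃ e₄))))

theorem Exec.outVec (hM : Limits M K) {r : Regs} (hr : r.Idle) (hk : r.k = 0) {n : ℕ}
    (hn : n ≤ K) {N e₁ e₂ : Expr} {f : Fin n → ℚ} {p q : Fin n → ℤ}
    (hN : ∀ (k : ℤ) (out : List ℤ), N.eval { r with k := k, out := out }.state = n)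
    (he₁ : ∀ (k : Fin n) (out : List ℤ),
      e₁.eval { r with k := (k : ℕ), out := out }.state = p k)
    (he₂ : ∀ (k : Fin n) (x : ℤ) (out : List ℤ),
      e₂.eval { r with k := (k : ℕ), x := x, out := out }.state = q k)
    (hq : ∀ k, 0 < q k) (hpM : ∀ k, (p k).natAbs ≤ M) (hqM : ∀ k, (q k).natAbs ≤ M)
    (hf : ∀ k, (p k : ℚ) = q k * f k) (hout : r.out = []) :
    Exec M K (.outVec N e₁ e₂) r.state { r with out := encVec f }.state := by
  have h1 := Exec.outRats (r := { r with out := r.out ++ [(n : ℤ)] }) hM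
    ⟨hr.e, hr.s, hr.u, hr.v, hr.x, hr.y⟩ hk hn (N := N) (fun k out => hN k out) he₁ he₂ hq hpM
    hqM hf
  have h2 : r.out ++ [(n : ℤ)] ++ encRats (List.ofFn f) = encVec f := by rw [hout]; rfl
  rw [h2] at h1
  exact .seq (.emit hM (hN r.k r.out)) h1

theorem Exec.outSystem (hM : Limits M K) {r : Regs} (hr : r.Clean) (hk : r.k = 0) {n : ℕ}
    (hnK : 2 * n ≤ K) (hnnK : n * n ≤ K) {N e₁ e₂ e₃ e₄ : Expr} {A : Matrix (Fin n) (Fin n) ℚ}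
    {y : Fin n → ℚ} {a : ℕ → ℕ → ℤ} {p : Fin n → ℤ} {d d' : ℤ}
    (hN : ∀ (k t : ℤ) (out : List ℤ), N.eval { r with k := k, t := t, out := out }.state = n)
    (he₁ : ∀ k < n * n, ∀ out : List ℤ,
      e₁.eval { r with k := (k : ℕ), out := out }.state = a (k / n) (k % n))
    (he₂ : ∀ (k x : ℤ) (out : List ℤ), e₂.eval { r with k := k, x := x, out := out }.state = d)
    (he₃ : ∀ (k : Fin n) (out : List ℤ),
      e₃.eval { r with k := (k : ℕ), out := out }.state = p k)
    (he₄ : ∀ (k x : ℤ) (out : List ℤ), e₄.eval { r with k := k, x := x, out := out }.state = d')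
    (hd : 0 < d) (hd' : 0 < d') (haM : ∀ i < n, ∀ j < n, (a i j).natAbs ≤ M)
    (hdM : d.natAbs ≤ M) (hpM : ∀ k, (p k).natAbs ≤ M) (hdM' : d'.natAbs ≤ M)
    (hA : ∀ i j : Fin n, (a i j : ℚ) = d * A i j) (hy : ∀ k, (p k : ℚ) = d' * y k)
    (hout : r.out = []) :
    Exec M K (.outSystem N e₁ e₂ e₃ e₄) r.state { r with out := encSystem A y }.state := by
  have hI := hr.toIdle
  refine .seq (.emit hM (hN r.k r.t r.out)) (.seq (.emit hM (hN r.k r.t _)) ?_)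
  have hz := Exec.for hM Regs.set_t
    (fun k => { r with out := r.out ++ [(n : ℤ)] ++ [(n : ℤ)] ++ List.replicate k 0 })
    (n := n + n) (by omega) (fun _ => hr.t) (N := N + N)
    (fun k _ => by rw [Expr.eval_add, hN r.k k _]; push_cast; rfl) (p := .write 0)
    fun k _ => by
      rw [List.replicate_succ', ← List.append_assoc]
      exact .emit hM rfl
  rw [List.replicate_zero, List.append_nil] at hz
  refine hz.seq ?_
  -- Entry `k` of the list is the matrix entry in row `k / n` and column `k % n`.
  refine (Exec.outRats (r := { r with
      out := r.out ++ [(n : ℤ)] ++ [(n : ℤ)] ++ List.replicate (n + n) 0 })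
    (f := fun t : Fin (n * n) => A t.divNat t.modNat)
    (p := fun t : Fin (n * n) => a (t / n) (t % n)) (q := fun _ => d) hM
    ⟨hI.e, hI.s, hI.u, hI.v, hI.x, hI.y⟩ hk hnnK
    (fun k out => by rw [Expr.eval_mul, hN k r.t out]; push_cast; rfl)
    (fun k out => he₁ k k.2 out) (fun k x out => he₂ _ _ _) (fun _ => hd)
    (fun k => ?_) (fun _ => hdM) fun k => hA k.divNat k.modNat).seq ?_
  · have hn0 : 0 < n := Nat.pos_of_ne_zero (by rintro rfl; exact absurd k.2 (by simp))
    exact haM _ (Nat.div_lt_of_lt_mul k.2) _ (Nat.mod_lt _ hn0)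
  · rw [← flatten_ofFn]
    have h1 := Exec.outRats (r := { r with
        out := r.out ++ [(n : ℤ)] ++ [(n : ℤ)] ++ List.replicate (n + n) 0 ++
          encRats (List.ofFn fun i => List.ofFn fun j => A i j).flatten })
      (f := y) (q := fun _ => d') hM ⟨hI.e, hI.s, hI.u, hI.v, hI.x, hI.y⟩ hk (by omega)
      (N := N) (fun k out => hN k r.t out) (fun k out => he₃ k out) (fun k x out => he₄ _ _ _)
      (fun _ => hd') hpM (fun _ => hdM') hy
    have h2 : r.out ++ [(n : ℤ)] ++ [(n : ℤ)] ++ List.replicate (n + n) 0 ++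
        encRats (List.ofFn fun i => List.ofFn fun j => A i j).flatten ++ encRats (List.ofFn y) =
        encSystem A y := by
      rw [hout]
      simp [encSystem, encMat]
    rw [h2] at h1
    exact h1

theorem polyTime_of_exec_regs {α : Type} {input output : α → List ℤ} (p : Prog)
    (h : ∀ a, ∃ r : Regs, Exec (regBound (wordSize (input a))) (passBound (wordSize (input a))) p
      (init (input a)) r.state ∧ r.out = output a) :
    PolyTime input output := by
  -- The polynomial is `passBound`, which is twice the bit length of `regBound`.
  refine polyTime_of_exec p (12 * Polynomial.X ^ 2 + 6 * Polynomial.X + 8) fun a => ?_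
  obtain ⟨r, hr, hout⟩ := h a
  refine ⟨_, _, ?_, ?_, bdd_init _, r.state, hr, hout⟩
  · rw [size_regBound]
    simp
    omega
  · rw [passBound]
    simp
    omega

end RAM

/-! ## The reductions run in polynomial time -/

namespace RAM

/-- Denominators multiply: with a matrix over `d` and a vector scaled by `L`, the product is scaled
by `d * L`. -/
theorem mulVecN_cast {c : ℕ} {q : ℕ → ℕ → ℤ} {f : ℕ → ℤ} {d L : ℚ}
    {P : Matrix (Fin c) (Fin c) ℚ} {x : Fin c → ℚ}
    (hq : ∀ i j : Fin c, (q i j : ℚ) = d * P i j) (hf : ∀ j : Fin c, (f j : ℚ) = L * x j)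
    (i : Fin c) : (mulVecN c q f i : ℚ) = d * L * (P *ᵥ x) i := by
  rw [mulVecN, Finset.sum_range, Int.cast_sum, Matrix.mulVec, dotProduct, Finset.mul_sum]
  refine Finset.sum_congr rfl fun j _ => ?_
  rw [Int.cast_mul, hq, hf]
  ring

theorem sq_le_passBound {W k : ℕ} (h : k ≤ W) : k * k ≤ passBound W := by
  rw [passBound]
  nlinarith

theorem two_mul_le_passBound {W k : ℕ} (h : k ≤ W) : 2 * k ≤ passBound W := by
  rw [passBound]
  nlinarith

/-! ### Entries of a loaded instance and the solver applied to it -/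

section

variable {ws : List ℤ} {o m n : ℕ} {D : Matrix (Fin m) (Fin n) ℚ} {s : Fin m → ℚ} {r : Regs}

theorem SystemAt.add_le (h : SystemAt ws o D s) : m + n + 2 ≤ wordSize ws := by
  have := h.le
  have := length_le_wordSize ws
  omega

/-- The bound for the numbers in the computation of a solution. -/
def solveBound (W m n : ℕ) : ℕ := ((n + 2) * 2 ^ (2 * W + 1)) ^ (2 * m + 4)

theorem SystemAt.solveBound_mul_le (h : SystemAt ws o D s) :
    solveBound (wordSize ws) m n * 2 ^ (wordSize ws + 1) ≤ regBound (wordSize ws) := by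
  have := h.add_le
  exact elim_bound (c := n + 1) (N := m + 1) (by omega) (by omega)

theorem SystemAt.solveBound_le (h : SystemAt ws o D s) :
    solveBound (wordSize ws) m n ≤ regBound (wordSize ws) :=
  (Nat.le_mul_of_pos_right _ (Nat.two_pow_pos _)).trans h.solveBound_mul_le

theorem two_pow_two_mul_le (W : ℕ) : 2 ^ (2 * W) ≤ 2 ^ (2 * W + 1) :=
  Nat.pow_le_pow_right (by norm_num) (by omega)

/-- The scaled entry of the matrix in the input. -/
abbrev Expr.matEntry (i j : Expr) : Expr := .S (.b + 2 * (i * .n + j))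
/-- The scaled entry of the right-hand side in the input. -/
abbrev Expr.vecEntry (i : Expr) : Expr := .S (.b + 2 * (.m * .n + i))
/-- The scaled entry of the vector that follows the instance in the input. -/
abbrev Expr.solEntry (i : Expr) : Expr := .S (.b + 2 * (.m * .n + .m) + 1 + 2 * i)

/-- The value of `Expr.matEntry`. -/
def Regs.matEntry (r : Regs) (i j : ℕ) : ℤ := r.S (r.b + 2 * (i * r.n + j))
/-- The value of `Expr.vecEntry`. -/
def Regs.vecEntry (r : Regs) (i : ℕ) : ℤ := r.S (r.b + 2 * (r.m * r.n + i))
/-- The value of `Expr.solEntry`. -/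
def Regs.solEntry (r : Regs) (i : ℕ) : ℤ := r.S (r.b + 2 * (r.m * r.n + r.m) + 1 + 2 * i)

theorem Loaded.matEntry_spec (hr : Loaded ws o m n r) (h : SystemAt ws o D s) (i : Fin m)
    (j : Fin n) : (r.matEntry i j : ℚ) = r.L * D i j ∧
      (r.matEntry i j).natAbs ≤ 2 ^ (2 * wordSize ws) := by
  have e : r.matEntry i j = r.S (o + 2 + m + n + 2 * (i * n + j) : ℕ) := by
    rw [Regs.matEntry, hr.base, hr.cols]
    congr 1
  rw [e]
  exact ⟨hr.scaled _ _ (h.mat i j), hr.scaled_le _ _ (h.mat i j)⟩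

theorem Loaded.vecEntry_spec (hr : Loaded ws o m n r) (h : SystemAt ws o D s) (i : Fin m) :
    (r.vecEntry i : ℚ) = r.L * s i ∧ (r.vecEntry i).natAbs ≤ 2 ^ (2 * wordSize ws) := by
  have e : r.vecEntry i = r.S (o + 2 + m + n + 2 * (m * n + i) : ℕ) := by
    rw [Regs.vecEntry, hr.base, hr.cols, hr.rows]
    congr 1
  rw [e]
  exact ⟨hr.scaled _ _ (h.vec i), hr.scaled_le _ _ (h.vec i)⟩

theorem Loaded.solEntry_spec {k : ℕ} {x : Fin k → ℚ}
    (hr : Loaded (encPair (encSystem D s) (encVec x)) 1 m n r) (i : Fin k) :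
    (r.solEntry i : ℚ) = r.L * x i ∧
      (r.solEntry i).natAbs ≤ 2 ^ (2 * wordSize (encPair (encSystem D s) (encVec x))) := by
  have e : r.solEntry i = r.S (1 + 2 + m + n + 2 * (m * n + m) + 1 + 2 * i : ℕ) := by
    rw [Regs.solEntry, hr.base, hr.cols, hr.rows]
    congr 1
  rw [e]
  exact ⟨hr.scaled _ _ (fracAt_encPair D s x i), hr.scaled_le _ _ (fracAt_encPair D s x i)⟩

/-- The right-hand side is left open, so that it can be the input vector `s` as well as the
difference `y - v`. It only has to carry the same scale `L` as the matrix, which then cancels. -/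
theorem exec_solve (h : SystemAt ws o D s) (hr : Loaded ws o m n r) {e : Expr} {g : ℕ → ℤ}
    (he : ∀ i < m, ∀ (c : ℤ) (Q : ℤ → ℤ) (d : ℤ) (a w : ℤ → ℤ),
      e.eval { r with c := c, Q := Q, d := d, a := a, w := w, k := (i : ℕ) }.state = g i)
    {s' : Fin m → ℚ} (hg : ∀ i : Fin m, (g i : ℚ) = r.L * s' i)
    (hgb : ∀ i < m, (g i).natAbs ≤ 2 ^ (2 * wordSize ws + 1)) (hsol : ∃ v, D *ᵥ v = s') :
    ∃ (R : ℕ → ℕ → ℤ) (g a w : ℤ → ℤ),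
      Exec (regBound (wordSize ws)) (passBound (wordSize ws)) (.solve (.matEntry .k .j) e) r.state
      { r with
        c := n + 1
        Q := flat (n + 1) (elim (n + 1) R (m + 1)).1 g
        d := (elim (n + 1) R (m + 1)).2
        a := a
        w := w }.state ∧
      ElimBound (n + 1) (2 ^ (2 * wordSize ws + 1)) (m + 1) R (solveBound (wordSize ws) m n) ∧
      (∀ i j : Fin n, ((elim (n + 1) R (m + 1)).1 i j : ℚ) =
        (elim (n + 1) R (m + 1)).2 * nullProj D i j) ∧
      (∀ i : Fin n, (w i : ℚ) = -((elim (n + 1) R (m + 1)).2 * particular D s' i)) ∧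
      (∀ i < n, (w i).natAbs ≤ solveBound (wordSize ws) m n) := by
  have hle := h.add_le
  refine Exec.solve (limits _) hr.toClean hr.k_eq hr.rows hr.cols
    (by have := two_mul_le_passBound (k := m) (W := wordSize ws) (by omega); omega)
    (sq_le_passBound (by omega)) Nat.one_le_two_pow h.solveBound_le
    (f := fun i j => if j = n then g i else r.matEntry i j)
    (fun i hi j hj c Q d a w => ?_) (fun i hi c Q d a w => ?_) (fun i hi j hj => ?_)
    (L := r.L) (by exact_mod_cast hr.L_pos.ne') (fun i j => ?_) (fun i => ?_) hsol
  · rw [if_neg hj.ne]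
    rfl
  · rw [if_pos rfl]
    exact he i hi _ _ _ _ _
  · split_ifs with hjn
    · exact hgb i hi
    · exact (hr.matEntry_spec h ⟨i, hi⟩ ⟨j, by omega⟩).2.trans (two_pow_two_mul_le _)
  · rw [if_neg j.2.ne]
    exact (hr.matEntry_spec h i j).1
  · rw [if_pos rfl]
    exact hg i

end

/-! ### From exact dictionary representation to min unsatisfy -/

/-- Computes `EDRInst.toMU`. -/
def Prog.toMU : Prog :=
  .seq (.read 0) (.seq (.solve (.matEntry .k .j) (.vecEntry .k))
    (.outSystem .n (.Q (.k / .n * .c + (.k - .k / .n * .n))) .d (0 - .w .k) .d))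

theorem polyTime_toMU : PolyTime EDR.encInst fun I => MU.encInst (EDRInst.toMU I) := by
  refine polyTime_of_exec_regs .toMU fun I : EDRInst => ?_
  have h : SystemAt (encSystem I.D I.s) 0 I.D I.s := systemAt_encSystem I.D I.s
  change ∃ r : Regs, Exec (regBound (wordSize (encSystem I.D I.s)))
    (passBound (wordSize (encSystem I.D I.s))) .toMU (init (encSystem I.D I.s)) r.state ∧
      r.out = encSystem (nullProj I.D) (particular I.D I.s)
  generalize encSystem I.D I.s = ws at h ⊢
  obtain ⟨r, hread, hr⟩ := exec_read h (e := 0) fun _ => rfl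
  have hle := h.add_le
  obtain ⟨R, g, a, w, hsolve, hR, hQ, hw, hwb⟩ := exec_solve h hr (e := .vecEntry .k)
    (g := r.vecEntry) (fun _ _ _ _ _ _ _ => rfl) (fun i => (hr.vecEntry_spec h i).1)
    (fun i hi => (hr.vecEntry_spec h ⟨i, hi⟩).2.trans (two_pow_two_mul_le _)) I.exists_mulVec_eq
  have hn : I.n ≤ wordSize ws := by omega
  refine ⟨_, hread.seq (hsolve.seq (Exec.outSystem (r := { r with
      c := I.n + 1, Q := flat (I.n + 1) (elim (I.n + 1) R (I.m + 1)).1 g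
      d := (elim (I.n + 1) R (I.m + 1)).2, a := a, w := w })
    (n := I.n) (N := .n) (e₁ := .Q (.k / .n * .c + (.k - .k / .n * .n))) (e₂ := .d)
    (e₃ := 0 - .w .k) (e₄ := .d) (A := nullProj I.D) (y := particular I.D I.s)
    (a := (elim (I.n + 1) R (I.m + 1)).1) (p := fun k => 0 - w k)
    (limits _) ⟨⟨hr.e, hr.s, hr.u, hr.v, hr.x, hr.y⟩, hr.i, hr.j, hr.t⟩ hr.k_eq
    (two_mul_le_passBound hn) (sq_le_passBound hn) (fun _ _ _ => hr.cols)
    (fun k hk out => ?_) (fun _ _ _ => rfl) (fun _ _ => rfl) (fun _ _ _ => rfl) (elim_pos _ _ _)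
    (elim_pos _ _ _) (fun i hi j hj => ?_) ?_ (fun k => ?_) ?_ hQ (fun k => ?_) hr.out)), by rfl⟩
  · have hn0 : 0 < I.n := Nat.pos_of_ne_zero (by rintro h0; rw [h0] at hk; omega)
    have h1 : k / I.n < I.n := Nat.div_lt_of_lt_mul hk
    have h2 : k % I.n < I.n := Nat.mod_lt _ hn0
    -- The stored matrix has `n + 1` columns, and only its leading `n × n` block is written; hence
    -- the address uses `c` while `k` is split by `n`.
    have h3 := flat_apply (elim (I.n + 1) R (I.m + 1)).1 g (h1.trans (Nat.lt_succ_self _))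
      (h2.trans (Nat.lt_succ_self _))
    rw [← h3]
    simp only [Regs.eval_Q, Expr.eval_add, Expr.eval_mul, Expr.eval_sub, Expr.eval_div,
      Regs.eval_k, Regs.eval_n, Regs.eval_c, hr.cols, natCast_sub_div_mul]
    push_cast
    rfl
  · exact (hR.fst_le le_rfl (by omega) (by omega)).trans h.solveBound_le
  · exact (hR.snd_le le_rfl).trans h.solveBound_le
  · rw [zero_sub, Int.natAbs_neg]
    exact (hwb k k.2).trans h.solveBound_le
  · exact (hR.snd_le le_rfl).trans h.solveBound_le
  · rw [zero_sub, Int.cast_neg, hw, neg_neg]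

/-- Computes `EDRInst.ofMUSol`. -/
def Prog.ofMUSol : Prog :=
  .seq (.read 1) (.seq (.solve (.matEntry .k .j) (.vecEntry .k))
    (.seq (.loop 10 .n (.store 5 .t (.w .t))) (.seq (.loadRow (.solEntry .j) 0) (.seq .matvec
      (.outVec .n (0 - .z .k * .L - .w .k) (.d * .L))))))

theorem polyTime_ofMUSol : PolyTime
    (fun p : (I : EDRInst) × (Fin I.n → ℚ) => encPair (EDR.encInst p.1) (encVec p.2))
    (fun p => encVec (p.1.ofMUSol p.2).1) := by
  refine polyTime_of_exec_regs .ofMUSol fun p => ?_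
  obtain ⟨I, x⟩ := p
  have h := systemAt_encPair I.D I.s (encVec x)
  change ∃ r : Regs, Exec (regBound (wordSize (encPair (encSystem I.D I.s) (encVec x))))
    (passBound (wordSize (encPair (encSystem I.D I.s) (encVec x)))) .ofMUSol
      (init (encPair (encSystem I.D I.s) (encVec x))) r.state ∧
      r.out = encVec (particular I.D I.s - nullProj I.D *ᵥ x)
  obtain ⟨r, hread, hr⟩ := exec_read h (e := 1) fun _ => rfl
  have hx := hr.solEntry_spec
  generalize encPair (encSystem I.D I.s) (encVec x) = ws at h hread hr hx ⊢
  have hle := h.add_le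
  have hM := limits (wordSize ws)
  have hnK : I.n ≤ passBound (wordSize ws) := by
    have := two_mul_le_passBound (k := I.n) (W := wordSize ws) (by omega)
    omega
  have hn1K : I.n + 1 ≤ passBound (wordSize ws) := by
    have := two_mul_le_passBound (k := I.n + 1) (W := wordSize ws) (by omega)
    omega
  obtain ⟨R, g, a, w, hsolve, hR, hQ, hw, hwb⟩ := exec_solve h hr (e := .vecEntry .k)
    (g := r.vecEntry) (fun _ _ _ _ _ _ _ => rfl) (fun i => (hr.vecEntry_spec h i).1)
    (fun i hi => (hr.vecEntry_spec h ⟨i, hi⟩).2.trans (two_pow_two_mul_le _)) I.exists_mulVec_eq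
  set q := (elim (I.n + 1) R (I.m + 1)).1 with hq
  set d := (elim (I.n + 1) R (I.m + 1)).2 with hd
  -- `Q` still has `n + 1` columns, so `x` is padded by a zero.
  set f : ℕ → ℤ := fun j => if j = I.n then 0 else r.solEntry j with hf
  have hfb : ∀ j < I.n + 1, (f j).natAbs ≤ 2 ^ (2 * wordSize ws + 1) := fun j hj => by
    simp only [hf]
    split_ifs with hjn
    · simp
    · exact (hx ⟨j, by omega⟩).2.trans (two_pow_two_mul_le _)
  have hfM : ∀ j < I.n + 1, (f j).natAbs ≤ regBound (wordSize ws) := fun j hj =>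
    (hfb j hj).trans (two_pow_le_regBound (by nlinarith))
  have hmul : ∀ i < I.n + 1, ∀ l ≤ I.n + 1,
      (mulVecN l q f i).natAbs ≤ solveBound (wordSize ws) I.m I.n :=
    fun i hi l hl => hR.mulVecN_le le_rfl hfb hl hi
  have hmulQ : ∀ i : Fin I.n, (mulVecN (I.n + 1) q f i : ℚ) = d * r.L * (nullProj I.D *ᵥ x) i := by
    intro i
    have h1 : mulVecN (I.n + 1) q f i = mulVecN I.n q f i := by
      simp [mulVecN, Finset.sum_range_succ, hf]
    rw [h1]
    exact mulVecN_cast hQ (fun j => by simp only [hf, if_neg j.2.ne]; exact (hx j).1) i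
  -- `matvec` overwrites `w`, so the particular solution is first saved in `z`.
  have hcopy := Exec.for hM Regs.set_t
    (fun l => { r with
      c := I.n + 1, Q := flat (I.n + 1) q g, d := d, a := a, w := w
      z := fill l (fun t => w t) r.z })
    hnK (fun _ => hr.t) (N := .n) (fun _ _ => hr.cols) (p := .store 5 .t (.w .t)) fun l hl => by
      rw [← update_fill]
      exact .put hM (Regs.store_z _ _ _) rfl rfl ((hwb l hl).trans h.solveBound_le)
  rw [fill_zero] at hcopy
  have hload := Exec.loadRow (r := { r with
      c := I.n + 1, Q := flat (I.n + 1) q g, d := d, a := a, w := w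
      z := fill I.n (fun t => w t) r.z }) hM hr.j hnK hr.cols (e := .solEntry .j) (e' := 0) (f := f)
    (fun j hj _ => by simp only [hf, if_neg hj.ne]; rfl)
    (fun _ => by simp only [hf, if_pos]; rfl) hfM
  have hmv := Exec.matvec (r := { r with
      c := I.n + 1, Q := flat (I.n + 1) q g, d := d, a := fill (I.n + 1) f a, w := w
      z := fill I.n (fun t => w t) r.z }) (c := I.n + 1) hM rfl hn1K hr.i hr.j hr.s (q := q)
    (f := f) (fun i hi j hj => flat_apply q g hi hj) (fun j hj => fill_natCast f a hj)
    (fun i hi l hl => (hmul i hi l hl).trans h.solveBound_le)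
  refine ⟨_, hread.seq (hsolve.seq (hcopy.seq (hload.seq (hmv.seq (Exec.outVec (r := { r with
      c := I.n + 1, Q := flat (I.n + 1) q g, d := d, a := fill (I.n + 1) f a
      w := fill (I.n + 1) (mulVecN (I.n + 1) q f) w, z := fill I.n (fun t => w t) r.z })
    (n := I.n) (N := .n) (e₁ := 0 - .z .k * .L - .w .k) (e₂ := .d * .L)
    (f := particular I.D I.s - nullProj I.D *ᵥ x)
    (p := fun k => 0 - w k * r.L - mulVecN (I.n + 1) q f k) (q := fun _ => d * r.L)
    hM ⟨hr.e, hr.s, hr.u, hr.v, hr.x, hr.y⟩ hr.k_eq hnK (fun _ _ => hr.cols)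
    (fun k out => ?_) (fun _ _ _ => rfl) (fun _ => mul_pos (elim_pos _ _ _) hr.L_pos)
    (fun k => ?_) (fun _ => ?_) (fun k => ?_) hr.out))))), by rfl⟩
  · simp only [Expr.eval_sub, Expr.eval_mul, Expr.eval_zero, Regs.eval_z, Regs.eval_w,
      Regs.eval_k, Regs.eval_L, fill_natCast _ _ k.2,
      fill_natCast _ _ (k.2.trans (Nat.lt_succ_self _))]
  · refine le_trans ?_ h.solveBound_mul_le
    have h1 := Int.natAbs_sub_le (0 - w k * r.L) (mulVecN (I.n + 1) q f k)
    have h2 : (0 - w k * r.L).natAbs ≤ solveBound (wordSize ws) I.m I.n * 2 ^ wordSize ws := by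
      rw [zero_sub, Int.natAbs_neg, Int.natAbs_mul]
      exact Nat.mul_le_mul (hwb k k.2) hr.L_le
    have h3 := hmul k (by omega) (I.n + 1) le_rfl
    have h4 : solveBound (wordSize ws) I.m I.n ≤
        solveBound (wordSize ws) I.m I.n * 2 ^ wordSize ws :=
      Nat.le_mul_of_pos_right _ (Nat.two_pow_pos _)
    rw [pow_succ, ← mul_assoc]
    omega
  · refine le_trans ?_ h.solveBound_mul_le
    rw [Int.natAbs_mul, pow_succ]
    exact Nat.mul_le_mul (hR.snd_le le_rfl) (hr.L_le.trans (by omega))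
  · push_cast
    rw [hw, hmulQ, Pi.sub_apply]
    ring

/-! ### From min unsatisfy to exact dictionary representation -/

/-- Computes `MUInst.toEDR`. -/
def Prog.toEDR : Prog :=
  .seq (.read 0) (.seq (.assign 4 .m) (.seq (.elim .n (.loadVec .c (.matEntry .j .k)))
    (.seq (.loadVec .c (.vecEntry .j)) (.seq .matvec
      (.outSystem .m (.Q .k) .d (.w .k) (.d * .L))))))

theorem polyTime_toEDR : PolyTime MU.encInst fun I => EDR.encInst (MUInst.toEDR I) := by
  refine polyTime_of_exec_regs .toEDR fun I : MUInst => ?_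
  have h : SystemAt (encSystem I.A I.y) 0 I.A I.y := systemAt_encSystem I.A I.y
  change ∃ r : Regs, Exec (regBound (wordSize (encSystem I.A I.y)))
    (passBound (wordSize (encSystem I.A I.y))) .toEDR (init (encSystem I.A I.y)) r.state ∧
      r.out = encSystem (nullProj I.Aᵀ) (nullProj I.Aᵀ *ᵥ I.y)
  generalize encSystem I.A I.y = ws at h ⊢
  obtain ⟨r, hread, hr⟩ := exec_read h (e := 0) fun _ => rfl
  have hle := h.add_le
  have hM := limits (wordSize ws)
  have hmK : I.m ≤ passBound (wordSize ws) := by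
    have := two_mul_le_passBound (k := I.m) (W := wordSize ws) (by omega)
    omega
  have hnK : I.n ≤ passBound (wordSize ws) := by
    have := two_mul_le_passBound (k := I.n) (W := wordSize ws) (by omega)
    omega
  set B := ((I.m + 1) * 2 ^ (2 * wordSize ws + 1)) ^ (2 * I.n + 2) with hBdef
  have hB2 : B * 2 ^ (wordSize ws + 1) ≤ regBound (wordSize ws) :=
    elim_bound (by omega) (by omega)
  have hB : B ≤ regBound (wordSize ws) :=
    (Nat.le_mul_of_pos_right _ (Nat.two_pow_pos _)).trans hB2
  -- The rows to be eliminated are those of `Aᵀ`, so the indices are exchanged.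
  set R : ℕ → ℕ → ℤ := fun i j => r.matEntry j i with hRdef
  have hR : ElimBound I.m (2 ^ (2 * wordSize ws + 1)) I.n R B :=
    ⟨Nat.one_le_two_pow, fun i hi j hj =>
      (hr.matEntry_spec h ⟨j, hj⟩ ⟨i, hi⟩).2.trans (two_pow_two_mul_le _), le_rfl⟩
  have hR' : ElimBound I.m (2 ^ (2 * wordSize ws + 1)) I.n R (regBound (wordSize ws)) :=
    ⟨hR.one_le, hR.le, hB⟩
  have hEM : 2 ^ (2 * wordSize ws + 1) ≤ regBound (wordSize ws) :=
    two_pow_le_regBound (by nlinarith)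
  have hy : ∀ j < I.m, (r.vecEntry j).natAbs ≤ 2 ^ (2 * wordSize ws + 1) := fun j hj =>
    (hr.vecEntry_spec h ⟨j, hj⟩).2.trans (two_pow_two_mul_le _)
  obtain ⟨a, w, helim⟩ := Exec.elim (r := { r with c := (I.m : ℤ) }) hM
    ⟨⟨hr.e, hr.s, hr.u, hr.v, hr.x, hr.y⟩, hr.i, hr.j, hr.t⟩ hr.k_eq hR' le_rfl hnK rfl
    (sq_le_passBound (by omega)) (len := .n) (load := .loadVec .c (.matEntry .j .k))
    (fun _ _ _ _ _ => hr.cols) fun k hk Q d a w => Exec.loadVec (r := { r with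
        c := (I.m : ℤ), Q := Q, d := d, a := a, w := w, k := k }) hM hr.j hmK (N := .c)
      (e := .matEntry .j .k) (f := R k) (fun _ _ => rfl) (fun _ _ _ => rfl)
      fun j hj => (hR.le k hk j hj).trans hEM
  set q := (elim I.m R I.n).1 with hq
  set d := (elim I.m R I.n).2 with hd
  have hload := Exec.loadVec (r := { r with
      c := (I.m : ℤ), Q := flat I.m q r.Q, d := d, a := a, w := w }) hM hr.j hmK (N := .c)
    (e := .vecEntry .j) (f := r.vecEntry) (fun _ _ => rfl) (fun _ _ _ => rfl)
    fun j hj => (hy j hj).trans hEM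
  have hmul : ∀ i < I.m, ∀ l ≤ I.m, (mulVecN l q r.vecEntry i).natAbs ≤ B :=
    fun i hi l hl => hR.mulVecN_le le_rfl hy hl hi
  have hmv := Exec.matvec (r := { r with
      c := (I.m : ℤ), Q := flat I.m q r.Q, d := d, a := fill I.m r.vecEntry a, w := w })
    (c := I.m) hM rfl hmK hr.i hr.j hr.s (q := q) (f := r.vecEntry)
    (fun i hi j hj => flat_apply q _ hi hj) (fun j hj => fill_natCast r.vecEntry a hj)
    (fun i hi l hl => (hmul i hi l hl).trans hB)
  -- Scaling the matrix by `L` does not change its null space, so `L` enters only the denominator of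
  -- the vector `P y`.
  have hQ : ∀ i j : Fin I.m, (q i j : ℚ) = d * nullProj I.Aᵀ i j :=
    elim_eq_nullProj (L := r.L) (by exact_mod_cast hr.L_pos.ne')
      fun i j => (hr.matEntry_spec h j i).1
  have hm : I.m ≤ wordSize ws := by omega
  have hset : Exec (regBound (wordSize ws)) (passBound (wordSize ws)) (.assign 4 .m) r.state
      { r with c := (I.m : ℤ) }.state := .set hM (Regs.set_c _ (I.m : ℤ)) hr.rows (by
    rw [Int.natAbs_natCast]
    exact le_regBound (by omega))
  refine ⟨_, hread.seq (hset.seq (helim.seq (hload.seq (hmv.seq (Exec.outSystem (r := { r with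
      c := (I.m : ℤ), Q := flat I.m q r.Q, d := d, a := fill I.m r.vecEntry a
      w := fill I.m (mulVecN I.m q r.vecEntry) w })
    (n := I.m) (N := .m) (e₁ := .Q .k) (e₂ := .d) (e₃ := .w .k) (e₄ := .d * .L) (A := nullProj I.Aᵀ)
    (y := nullProj I.Aᵀ *ᵥ I.y) (a := q) (p := fun k => mulVecN I.m q r.vecEntry k)
    (d := d) (d' := d * r.L) hM ⟨⟨hr.e, hr.s, hr.u, hr.v, hr.x, hr.y⟩, hr.i, hr.j, hr.t⟩ hr.k_eq
    (two_mul_le_passBound hm) (sq_le_passBound hm) (fun _ _ _ => hr.rows)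
    (fun k hk out => ?_) (fun _ _ _ => rfl) (fun k _ => ?_) (fun _ _ _ => rfl) (elim_pos _ _ _)
    (mul_pos (elim_pos _ _ _) hr.L_pos) (fun i hi j hj => ?_) ?_ (fun k => ?_) ?_ hQ
    (fun k => ?_) hr.out))))), by rfl⟩
  · exact fill_natCast (fun p => q (p / I.m) (p % I.m)) _ hk
  · exact fill_natCast _ _ k.2
  · exact (hR.fst_le le_rfl hi hj).trans hB
  · exact (hR.snd_le le_rfl).trans hB
  · exact (hmul k k.2 _ le_rfl).trans hB
  · refine le_trans ?_ hB2
    rw [Int.natAbs_mul, pow_succ]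
    exact Nat.mul_le_mul (hR.snd_le le_rfl) (hr.L_le.trans (by omega))
  · rw [Int.cast_mul]
    exact mulVecN_cast hQ (fun j => (hr.vecEntry_spec h j).1) k

/-- Computes `MUInst.ofEDRSol`. -/
def Prog.ofEDRSol : Prog :=
  .seq (.read 1) (.seq (.solve (.matEntry .k .j) (.vecEntry .k - .solEntry .k))
    (.outVec .n (0 - .w .k) .d))

theorem polyTime_ofEDRSol : PolyTime
    (fun p : (I : MUInst) × {v : Fin I.m → ℚ // nullProj I.Aᵀ *ᵥ v = nullProj I.Aᵀ *ᵥ I.y} =>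
      encPair (MU.encInst p.1) (encVec p.2.1))
    (fun p => encVec (p.1.ofEDRSol p.2)) := by
  refine polyTime_of_exec_regs .ofEDRSol fun p => ?_
  obtain ⟨I, v⟩ := p
  have h := systemAt_encPair I.A I.y (encVec v.1)
  change ∃ r : Regs, Exec (regBound (wordSize (encPair (encSystem I.A I.y) (encVec v.1))))
    (passBound (wordSize (encPair (encSystem I.A I.y) (encVec v.1)))) .ofEDRSol
      (init (encPair (encSystem I.A I.y) (encVec v.1))) r.state ∧
      r.out = encVec (particular I.A (I.y - v.1))
  obtain ⟨r, hread, hr⟩ := exec_read h (e := 1) fun _ => rfl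
  have hx := hr.solEntry_spec
  generalize encPair (encSystem I.A I.y) (encVec v.1) = ws at h hread hr hx ⊢
  have hle := h.add_le
  have hnK : I.n ≤ passBound (wordSize ws) := by
    have := two_mul_le_passBound (k := I.n) (W := wordSize ws) (by omega)
    omega
  obtain ⟨R, g, a, w, hsolve, hR, hQ, hw, hwb⟩ := exec_solve h hr (e := .vecEntry .k - .solEntry .k)
    (g := fun i => r.vecEntry i - r.solEntry i) (fun _ _ _ _ _ _ _ => rfl) (s' := I.y - v.1)
    (fun i => by
      rw [Int.cast_sub, (hr.vecEntry_spec h i).1, (hx i).1, Pi.sub_apply]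
      ring)
    -- The difference of two scaled entries may be twice as large as one of them, which is the
    -- reason for the exponent `2 * W + 1`.
    (fun i hi => by
      have h1 := Int.natAbs_sub_le (r.vecEntry i) (r.solEntry i)
      have h2 := (hr.vecEntry_spec h ⟨i, hi⟩).2
      have h3 := (hx ⟨i, hi⟩).2
      rw [pow_succ]
      dsimp only at h2 h3
      omega) (I.exists_mulVec_eq v)
  refine ⟨_, hread.seq (hsolve.seq (Exec.outVec (r := { r with
      c := I.n + 1, Q := flat (I.n + 1) (elim (I.n + 1) R (I.m + 1)).1 g
      d := (elim (I.n + 1) R (I.m + 1)).2, a := a, w := w })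
    (n := I.n) (N := .n) (e₁ := 0 - .w .k) (e₂ := .d) (f := particular I.A (I.y - v.1))
    (p := fun k => 0 - w k) (q := fun _ => (elim (I.n + 1) R (I.m + 1)).2)
    (limits _) ⟨hr.e, hr.s, hr.u, hr.v, hr.x, hr.y⟩ hr.k_eq hnK (fun _ _ => hr.cols)
    (fun _ _ => rfl) (fun _ _ _ => rfl) (fun _ => elim_pos _ _ _)
    (fun k => ?_) (fun _ => ?_) (fun k => ?_) hr.out)), by rfl⟩
  · rw [zero_sub, Int.natAbs_neg]
    exact (hwb k k.2).trans h.solveBound_le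
  · exact (hR.snd_le le_rfl).trans h.solveBound_le
  · rw [zero_sub, Int.cast_neg, hw, neg_neg]

end RAM

theorem mainTheorem6 :
    MinProblem.Equivalent EDR MU ∧
    (∃ (k : EDRInst → ℕ) (A : ∀ I : EDRInst, Matrix (Fin I.n) (Fin (k I)) ℚ)
        (y : ∀ I : EDRInst, Fin I.n → ℚ)
        (t₂ : ∀ I : EDRInst, (Fin (k I) → ℚ) → {v : Fin I.n → ℚ // I.D *ᵥ v = I.s}),
      MinProblem.IsExactReduction EDR MU (fun I => MUInst.mk I.n (k I) (A I) (y I)) t₂ ∧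
      (∀ I : EDRInst, IsFullNullMatrix I.D (A I) ∧ I.D *ᵥ y I = I.s) ∧
      (∀ (I : EDRInst) (x : Fin (k I) → ℚ), (t₂ I x).1 = y I - A I *ᵥ x)) ∧
    (∃ (p : MUInst → ℕ) (D : ∀ I : MUInst, Matrix (Fin (p I)) (Fin I.m) ℚ)
        (t₂ : ∀ I : MUInst,
          {v : Fin I.m → ℚ // D I *ᵥ v = D I *ᵥ I.y} → (Fin I.n → ℚ)),
      MinProblem.IsExactReduction MU EDR (fun I => EDRInst.ofVec (D I) I.y) t₂ ∧
      (∀ I : MUInst, IsFullNullMatrix (D I) I.A) ∧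
      (∀ (I : MUInst) (v : {v : Fin I.m → ℚ // D I *ᵥ v = D I *ᵥ I.y}),
        I.A *ᵥ t₂ I v = I.y - v.1)) := by
  have h₁ := isExactReduction_EDR_MU RAM.polyTime_toMU RAM.polyTime_ofMUSol
  have h₂ := isExactReduction_MU_EDR RAM.polyTime_toEDR RAM.polyTime_ofEDRSol
  exact ⟨⟨⟨_, _, h₁⟩, ⟨_, _, h₂⟩⟩,
    ⟨_, _, _, _, h₁, fun I => ⟨isFullNullMatrix_nullProj I.D,
      mulVec_particular I.exists_mulVec_eq⟩, fun _ _ => rfl⟩,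
    ⟨_, _, _, h₂, fun I => isFullNullMatrix_nullProj_transpose I.A, MUInst.mulVec_ofEDRSol⟩⟩
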